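/- **Setting.** Fix $\mu,\omega,\mathcal E>0$. Let $D\subset\mathbb R^2$ be a bounded domain with $0\in D$, contained in the Hill region $\{\|z\|<\sqrt{2\mathcal E}/\omega\}$, lying on one side of its boundary, which is a simple closed $C^1$ curve parametrized by arc length by $\gamma:[0,L]\to\mathbb R^2$. For $h\in\mathbb R$ put $V_E(z)=\mathcal E-\frac{\omega^2}{2}\|z\|^2$ and $V_I(z)=\mathcal E+h+\frac{\mu}{\|z\|}$. Let $t=\dot\gamma$ and let $n$ be the outward unit normal. *Arcs.* An outer arc from $\gamma(\xi_1)$ to $\gamma(\xi_2)$ is a pair $(T,z)$ with $T>0$ and $z:[0,T]\to\mathbb R^2$ such that $z''=-\omega^2z$ and $\frac12\|z'\|^2=V_E(z)$ on $[0,T]$, $z(s)\notin D$ for $0<s<T$, $z(0)=\gamma(\xi_1)$, $z(T)=\gamma(\xi_2)$. An inner arc is defined in the same way with $z''=-\mu z/\|z\|^3$, $\frac12\|z'\|^2=V_I(z)$ and $z(s)\in D$ for $0<s<T$; if $\xi_1\ne\xi_2$ it is also required to avoid $0$ and to be topologically non-trivial, i.e. not homotopic with fixed endpoints in $\mathbb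 R^2\setminus\{0\}$ to the segment $[\gamma(\xi_1),\gamma(\xi_2)]$; if $\xi_1=\xi_2$ it is understood in the regularized sense (a solution reaching $0$ is reflected back along the same path). When the arcs are unique, $S_E(\xi_1,\xi_2)=\int_0^T\|z'\|\sqrt{V_E(z)}\,ds$ and $S_I(\xi_1,\xi_2;h)=\int_0^T\|z'\|\sqrt{V_I(z)}\,ds$ denote their Jacobi lengths; $\partial_a,\partial_b$ are the derivatives in the first and the second variable. *Admissibility.* Let $m\ge2$, let $(a_i,b_i)\subset[0,L]$, $1\le i\le m$, be non-empty disjoint open intervals, and let $[\alpha_i,\beta_i]\subset(a_i,b_i)$. Write $j\in NA(i)$ if $0\notin[\gamma(\xi_1),\gamma(\xi_2)]$ for all $\xi_1\in(a_i,b_i)$, $\xi_2\in(a_j,b_j)$ (the intervals are not antipodal). $D$ is admissible, with these intervals, if there are $0<h_0\le h_1$ such that 1. (outer-arc property) for all $i$ and all $\xi_1,\xi_2\in(a_i,b_i)$ there is a unique outer arc from $\gamma(\xi_1)$ to $\gamma(\xi_2)$; 2. (inner-arc property) for all $i$ we have $i\in NA(i)$ and some $j\ne i$ belongs to $NA(i)$;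 and for all $i$, all $j\in NA(i)$, $\xi_1\in(a_i,b_i)$, $\xi_2\in(a_j,b_j)$ and $h>h_0$ there is a unique inner arc from $\gamma(\xi_1)$ to $\gamma(\xi_2)$; 3. (change-sign property) for all $h>h_1$, all $i$, all $\xi_E\in[\alpha_i,\beta_i]$ and all $\xi_I\in\bigcup_{j\in NA(i)}[\alpha_j,\beta_j]$, $$\big(\partial_bS_E(\xi_E,\alpha_i)+\partial_aS_I(\alpha_i,\xi_I;h)\big)\big(\partial_bS_E(\xi_E,\beta_i)+\partial_aS_I(\beta_i,\xi_I;h)\big)<0 .$$ *Dynamics.* Let $\Xi_r^{\pm}$ be the set of $(\xi,v)\in[\alpha_r,\beta_r]\times\mathbb R^2$ with $\frac12\|v\|^2=V_E(\gamma(\xi))$ and $\pm\langle n(\xi),v\rangle>0$. Refraction at $\gamma(\xi)$ (Snell's law) sends the outer velocity $v=a\,t+b\,n$ to the inner velocity $R(v)=a\,t+\operatorname{sgn}(b)\sqrt{2V_I(\gamma(\xi))-a^2}\,n$. The first return map is defined at $(\xi,v)\in\Xi_r^+$, with value $(\xi_2,v_2)$, if the outer motion from $(\gamma(\xi),v)$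 stays outside $\overline D$ until it reaches some $(\gamma(\xi_1),v_1)$ with $(\xi_1,v_1)\in\Xi^-_r$, and the (regularized) inner motion from $(\gamma(\xi_1),R(v_1))$ then stays in $D$ until it reaches $(\gamma(\xi_2),R(v_2))$ with $(\xi_2,v_2)\in\bigcup_{r'\in NA(r)}\Xi^+_{r'}$. Let $X=X_h\subset\bigcup_r\Xi_r^+$ be the set of initial conditions at which all forward and backward iterates of the first return map are defined. Let $\mathcal L=\{\underline\ell\in\{1,\dots,m\}^{\mathbb Z}:\ \ell_{k+1}\in NA(\ell_k)\ \forall k\in\mathbb Z\}$ be the set of admissible words, with the product topology, and let $\sigma:\mathcal L\to\mathcal L$, $\sigma(\underline\ell)_k=\ell_{k+1}$, be the Bernoulli shift. **Theorem.** Let $D$ be admissible with the intervals $(a_i,b_i)$ and $[\alpha_i,\beta_i]$. Then there is $\bar h$ such that for every $h>\bar h$ the first return map restricts to a bijection $\mathcal F:X\to X$, and there is a continuous surjective map $\pi:X\to\mathcal L$ such that $\pi\circ\mathcal F=\sigma\circ\pi$ and, for all $x\in X$ and $k\in\mathbb Z$, the boundary parameter of $\mathcal F^k(x)$ lies in $[\alpha_r,\beta_r]$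 with $r=\pi(x)_k$ (the trajectory of $x$ realizes the word $\pi(x)$). -/

import Mathlib

open Set Filter Topology

noncomputable section

/-- The data of a refraction billiard. The Euclidean plane is identified with `ℂ`, whose norm and
real inner product `inner ℝ` are the Euclidean ones. `D` is a bounded domain containing the origin
and contained in the Hill region of the outer potential; its boundary is a simple closed curve of
class `C¹`, parametrized by arc length by the (`L`-periodic extension of the) curve `γ`, and `D`
lies on one side of it. -/
structure RefractionBilliard where
  /-- the mass parameter `μ` of the Keplerian centre -/
  μ : ℝ
  /-- the frequency `ω` of the outer harmonic oscillator -/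
  ω : ℝ
  /-- the energy `E` of the outer problem -/
  E : ℝ
  /-- the length of the boundary -/
  L : ℝ
  /-- the domain -/
  D : Set ℂ
  /-- the arc length parametrization of the boundary -/
  γ : ℝ → ℂ
  μ_pos : 0 < μ
  ω_pos : 0 < ω
  E_pos : 0 < E
  L_pos : 0 < L
  isOpen : IsOpen D
  isConnected : IsConnected D
  zero_mem : (0 : ℂ) ∈ D
  subset_hill : D ⊆ Metric.ball 0 (√(2 * E) / ω)
  contDiff : ContDiff ℝ 1 γ
  periodic : Function.Periodic γ L
  norm_deriv : ∀ ξ, ‖deriv γ ξ‖ = 1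
  injOn : InjOn γ (Ico 0 L)
  frontier_eq : frontier D = γ '' Icc 0 L
  exists_normal : ∀ ξ, ∃ ν : ℂ, ‖ν‖ = 1 ∧ inner ℝ ν (deriv γ ξ) = 0 ∧
    (∀ᶠ t : ℝ in 𝓝[>] 0, γ ξ - t • ν ∈ D) ∧ (∀ᶠ t : ℝ in 𝓝[>] 0, γ ξ + t • ν ∉ closure D)

namespace RefractionBilliard

variable (B : RefractionBilliard)

/-- The outer potential `V_E`. -/
def outerPotential (z : ℂ) : ℝ := B.E - B.ω ^ 2 / 2 * ‖z‖ ^ 2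

/-- The inner potential `V_I`, depending on the energy jump `h`. -/
def innerPotential (h : ℝ) (z : ℂ) : ℝ := B.E + h + B.μ / ‖z‖

/-- The unit tangent vector. -/
def tangent (ξ : ℝ) : ℂ := deriv B.γ ξ

/-- The outward-pointing unit normal vector. -/
def normal (ξ : ℝ) : ℂ := Classical.choose (B.exists_normal ξ)

/-! ### Outer and inner motions -/

/-- On `[0, T]`, `z` is a zero-energy solution of the outer problem with velocity `v`. -/
structure IsOuterSolution (T : ℝ) (z v : ℝ → ℂ) : Prop where
  hasDeriv : ∀ s ∈ Icc 0 T, HasDerivWithinAt z (v s) (Icc 0 T) s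
  equation : ∀ s ∈ Icc 0 T, HasDerivWithinAt v (-(B.ω ^ 2 • z s)) (Icc 0 T) s
  conservation : ∀ s ∈ Icc 0 T, ‖v s‖ ^ 2 / 2 - B.outerPotential (z s) = 0

/-- On `[0, T]`, `z` is a (regularized) zero-energy solution of the inner problem with energy jump
`h` and velocity `v`: away from the collisions with the centre it is a classical solution of the
Kepler problem, and at a collision it is reflected back along the same path. -/
structure IsInnerSolution (h T : ℝ) (z v : ℝ → ℂ) : Prop where
  continuousOn : ContinuousOn z (Icc 0 T)
  hasDeriv : ∀ s ∈ Icc 0 T, z s ≠ 0 → HasDerivWithinAt z (v s) (Icc 0 T) s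
  equation : ∀ s ∈ Icc 0 T, z s ≠ 0 →
    HasDerivWithinAt v (-((B.μ / ‖z s‖ ^ 3) • z s)) (Icc 0 T) s
  conservation : ∀ s ∈ Icc 0 T, z s ≠ 0 → ‖v s‖ ^ 2 / 2 - B.innerPotential h (z s) = 0
  reflection : ∀ s ∈ Icc 0 T, z s = 0 →
    ∀ τ, s - τ ∈ Icc 0 T → s + τ ∈ Icc 0 T → z (s + τ) = z (s - τ)

/-- The path `z` on `[0, T]` avoids the origin and is not homotopic, with fixed endpoints and in the
punctured plane, to the segment joining its endpoints. -/
def TopologicallyNontrivial (T : ℝ) (z : ℝ → ℂ) : Prop :=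
  (∀ s ∈ Icc 0 T, z s ≠ 0) ∧
  ¬ ∃ H : C(unitInterval × unitInterval, ℂ),
      (∀ q, H q ≠ 0) ∧
      (∀ t : unitInterval, H (0, t) = z (T * t)) ∧
      (∀ t : unitInterval, H (1, t) = AffineMap.lineMap (z 0) (z T) (t : ℝ)) ∧
      (∀ u, H (u, 0) = z 0) ∧ (∀ u, H (u, 1) = z T)

/-- An outer arc from `γ ξ₁` to `γ ξ₂`. -/
structure IsOuterArc (ξ₁ ξ₂ T : ℝ) (z v : ℝ → ℂ) : Prop where
  pos : 0 < T
  solution : B.IsOuterSolution T z v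
  outside : ∀ s ∈ Ioo 0 T, z s ∉ B.D
  start_eq : z 0 = B.γ ξ₁
  end_eq : z T = B.γ ξ₂

/-- An inner arc from `γ ξ₁` to `γ ξ₂` for the energy jump `h`: a topologically non-trivial
classical solution if `ξ₁ ≠ ξ₂`, a regularized solution if `ξ₁ = ξ₂`. -/
structure IsInnerArc (h ξ₁ ξ₂ T : ℝ) (z v : ℝ → ℂ) : Prop where
  pos : 0 < T
  solution : B.IsInnerSolution h T z v
  inside : ∀ s ∈ Ioo 0 T, z s ∈ B.D
  start_eq : z 0 = B.γ ξ₁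
  end_eq : z T = B.γ ξ₂
  nontrivial : ξ₁ ≠ ξ₂ → TopologicallyNontrivial T z

/-! ### Jacobi lengths -/

open Classical in
/-- `S_E`: the Jacobi length of the outer arc from `γ ξ₁` to `γ ξ₂`. -/
def outerLength (ξ₁ ξ₂ : ℝ) : ℝ :=
  if H : ∃ p : ℝ × (ℝ → ℂ) × (ℝ → ℂ), B.IsOuterArc ξ₁ ξ₂ p.1 p.2.1 p.2.2 then
    ∫ s in (0 : ℝ)..(choose H).1,
      ‖(choose H).2.2 s‖ * √(B.outerPotential ((choose H).2.1 s))
  else 0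

open Classical in
/-- `S_I`: the Jacobi length of the inner arc from `γ ξ₁` to `γ ξ₂`. -/
def innerLength (h ξ₁ ξ₂ : ℝ) : ℝ :=
  if H : ∃ p : ℝ × (ℝ → ℂ) × (ℝ → ℂ), B.IsInnerArc h ξ₁ ξ₂ p.1 p.2.1 p.2.2 then
    ∫ s in (0 : ℝ)..(choose H).1,
      ‖(choose H).2.2 s‖ * √(B.innerPotential h ((choose H).2.1 s))
  else 0

/-! ### Admissibility -/

/-- The outer-arc property of the interval `(a, b)`. -/
def OuterArcProperty (a b : ℝ) : Prop :=
  ∀ ξ₁ ∈ Ioo a b, ∀ ξ₂ ∈ Ioo a b, ∃ T z v, B.IsOuterArc ξ₁ ξ₂ T z v ∧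
    ∀ T' z' v', B.IsOuterArc ξ₁ ξ₂ T' z' v' → T' = T ∧ EqOn z' z (Icc 0 T)

/-- The `i`-th and the `j`-th intervals are not antipodal. -/
def NotAntipodal {m : ℕ} (a b : Fin m → ℝ) (i j : Fin m) : Prop :=
  ∀ ξ₁ ∈ Ioo (a i) (b i), ∀ ξ₂ ∈ Ioo (a j) (b j), (0 : ℂ) ∉ segment ℝ (B.γ ξ₁) (B.γ ξ₂)

/-- The inner-arc property of the union of the intervals `(a i, b i)`, with energy threshold
`h₀`. -/
structure InnerArcProperty {m : ℕ} (a b : Fin m → ℝ) (h₀ : ℝ) : Prop where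
  two_le : 2 ≤ m
  lt : ∀ i, a i < b i
  subset : ∀ i, Ioo (a i) (b i) ⊆ Icc 0 B.L
  disjoint : Pairwise fun i j => Disjoint (Ioo (a i) (b i)) (Ioo (a j) (b j))
  notAntipodal : ∀ i, B.NotAntipodal a b i i ∧ ∃ j, j ≠ i ∧ B.NotAntipodal a b i j
  pos : 0 < h₀
  existsUnique : ∀ i j, B.NotAntipodal a b i j →
    ∀ ξ₁ ∈ Ioo (a i) (b i), ∀ ξ₂ ∈ Ioo (a j) (b j), ∀ h, h₀ < h →
      ∃ T z v, B.IsInnerArc h ξ₁ ξ₂ T z v ∧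
        ∀ T' z' v', B.IsInnerArc h ξ₁ ξ₂ T' z' v' → T' = T ∧ EqOn z' z (Icc 0 T)

/-- `∂_b S_E (ξE, ξ) + ∂_a S_I (ξ, ξI; h)`. -/
def lengthDeriv (h ξE ξ ξI : ℝ) : ℝ :=
  deriv (fun x => B.outerLength ξE x) ξ + deriv (fun x => B.innerLength h x ξI) ξ

/-- The change-sign property, realized by the compact intervals `[α i, β i] ⊆ (a i, b i)` and the
energy threshold `h₁`. -/
structure ChangeSignProperty {m : ℕ} (a b α β : Fin m → ℝ) (h₁ : ℝ) : Prop where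
  left_lt : ∀ i, a i < α i
  le : ∀ i, α i ≤ β i
  lt_right : ∀ i, β i < b i
  mul_neg : ∀ h, h₁ < h → ∀ i j, B.NotAntipodal a b i j →
    ∀ ξE ∈ Icc (α i) (β i), ∀ ξI ∈ Icc (α j) (β j),
      B.lengthDeriv h ξE (α i) ξI * B.lengthDeriv h ξE (β i) ξI < 0

/-- The domain is admissible, as witnessed by the union of the intervals `(a i, b i)` and by their
compact subintervals `[α i, β i]`. -/
def IsAdmissible {m : ℕ} (a b α β : Fin m → ℝ) : Prop :=
  ∃ h₀ h₁ : ℝ, h₀ ≤ h₁ ∧ B.InnerArcProperty a b h₀ ∧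
    (∀ i, B.OuterArcProperty (a i) (b i)) ∧ B.ChangeSignProperty a b α β h₁

/-! ### Admissible words -/

/-- The bi-infinite admissible words: consecutive symbols are never antipodal. The topology is
induced by the product topology of `ℤ → Fin m`. -/
abbrev Word {m : ℕ} (a b : Fin m → ℝ) : Type :=
  {ℓ : ℤ → Fin m // ∀ j, B.NotAntipodal a b (ℓ j) (ℓ (j + 1))}

/-- The Bernoulli shift. -/
def shift {m : ℕ} {a b : Fin m → ℝ} (ℓ : B.Word a b) : B.Word a b :=
  ⟨fun j => ℓ.1 (j + 1), fun j => ℓ.2 (j + 1)⟩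

/-! ### The first return map -/

/-- The refraction map `R_EI(·; ξ, h)` from outer to inner velocities given by Snell's law: the
tangential component and the sign of the normal component are preserved. -/
def refract (h ξ : ℝ) (v : ℂ) : ℂ :=
  inner ℝ v (B.tangent ξ) • B.tangent ξ +
    (Real.sign (inner ℝ v (B.normal ξ)) *
      √(2 * B.innerPotential h (B.γ ξ) - inner ℝ v (B.tangent ξ) ^ 2)) • B.normal ξ

/-- Initial conditions `(ξ, v)` of the outer energy shell with `ξ ∈ [c, d]` and `v` pointing
outward. -/
def outward (c d : ℝ) : Set (ℝ × ℂ) :=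
  {x | x.1 ∈ Icc c d ∧ ‖x.2‖ ^ 2 / 2 - B.outerPotential (B.γ x.1) = 0 ∧
    0 < inner ℝ (B.normal x.1) x.2}

/-- Initial conditions `(ξ, v)` of the outer energy shell with `ξ ∈ [c, d]` and `v` pointing
inward. -/
def inward (c d : ℝ) : Set (ℝ × ℂ) :=
  {x | x.1 ∈ Icc c d ∧ ‖x.2‖ ^ 2 / 2 - B.outerPotential (B.γ x.1) = 0 ∧
    inner ℝ (B.normal x.1) x.2 < 0}

/-- The graph of the first return map `(ξ, v) ↦ (ξ₂, v₂)`. The outer motion starting from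
`(γ ξ, v)`, with `v` outward and `ξ` in the `i`-th compact interval, stays outside `closure D` until
it hits the boundary inward, at `γ ξ₁` with `ξ₁` in the same interval; there it is refracted, and
the inner motion stays in `D` until it hits the boundary at `γ ξ₂`, with `ξ₂` in the `j`-th compact
interval and `i`, `j` not antipodal; there it is refracted to the outward velocity `v₂`. -/
def Returns {m : ℕ} (a b α β : Fin m → ℝ) (h : ℝ) (x y : ℝ × ℂ) : Prop :=
  ∃ i j : Fin m, B.NotAntipodal a b i j ∧
    x ∈ B.outward (α i) (β i) ∧ y ∈ B.outward (α j) (β j) ∧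
    ∃ (ξ₁ s₁ : ℝ) (zE vE : ℝ → ℂ) (s₂ : ℝ) (zI vI : ℝ → ℂ),
      0 < s₁ ∧ B.IsOuterSolution s₁ zE vE ∧
      zE 0 = B.γ x.1 ∧ vE 0 = x.2 ∧
      (∀ s ∈ Ioo 0 s₁, zE s ∉ closure B.D) ∧
      zE s₁ = B.γ ξ₁ ∧ (ξ₁, vE s₁) ∈ B.inward (α i) (β i) ∧
      0 < s₂ ∧ B.IsInnerSolution h s₂ zI vI ∧
      zI 0 = B.γ ξ₁ ∧ vI 0 = B.refract h ξ₁ (vE s₁) ∧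
      (∀ s ∈ Ioo 0 s₂, zI s ∈ B.D) ∧
      zI s₂ = B.γ y.1 ∧ vI s₂ = B.refract h y.1 y.2

/-- The set `X` of the initial conditions at which all the forward and backward iterates of the
first return map are defined. -/
def returnSet {m : ℕ} (a b α β : Fin m → ℝ) (h : ℝ) : Set (ℝ × ℂ) :=
  {x | ∃ o : ℤ → ℝ × ℂ, o 0 = x ∧ ∀ k, B.Returns a b α β h (o k) (o (k + 1))}

end RefractionBilliard

end

namespace RefractionBilliard

variable (B : RefractionBilliard)

/-! ### Geometry of the boundary -/

/-! A word is realized by a chain of arcs. Put two boundary parameters in each interval `ℓ k`, join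
them by the outer arc, and join the second one to the first parameter of the interval `ℓ (k + 1)` by
the inner arc. The arcs form a billiard orbit exactly when the tangential components match at every
vertex, which is Snell's law. Since tangential velocities are, up to the factor `√2` and a sign,
derivatives of the Jacobi lengths, this says that `lengthDeriv` vanishes. There is thus one equation
per unknown. It involves three consecutive unknowns, and the change-sign property gives it opposite
signs at the two ends of the middle interval, whatever the neighbours are.

The outgoing term of each equation is moreover injective in the next unknown, a twist condition.
This permits shooting: a one-parameter family of partial solutions whose last vertex sweeps its
whole interval can be prolonged by one vertex (`exists_crossing_path`, `exists_finite_chain`).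
Compactness of a product of intervals yields bi-infinite chains (`exists_chain`, `exists_orbit`).

Only existence and uniqueness of the arcs are assumed; their regularity has to be derived. The outer
flow is explicit. The arcs from a fixed point have initial velocities tracing a continuous injective
curve in a circle, so each velocity can be rotated both ways. A tangential start, or a contact with
the boundary, would therefore produce a neighbouring arc entering `D` (`inner_normal_oq_pos`,
`notMem_closure`). Continuity can fail only through durations tending to zero, which is excluded by
the sign of `og` near the diagonal (`og_neg_near_diagonal`, `continuousAt_arc`). Non-conjugacy
(`og_ne_zero`) then makes the length differentiable (`hasDerivAt_outerLength`).

Inner arcs are linearized by the Levi-Civita map `z = w ^ 2`, `dt = ‖w‖ ^ 2 dτ`, under which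
regularized collision orbits become ordinary linear motions through zero
(`IsInnerSolution.exists_lc`). Topological non-triviality selects the square roots of the endpoints
with negative inner product (`IsInnerArc.exists_lc`), and everything about the arc becomes explicit.

For the dynamics, crossings of the boundary are transversal, so hitting times and states vary
continuously (`PathFamily.contRel_hit`). By time reversal the same is true backwards. Hence the
first return is single-valued and continuous in both directions, it permutes the set of full orbits,
and the itinerary is locally constant in each coordinate. -/

lemma norm_normal (ξ : ℝ) : ‖B.normal ξ‖ = 1 := (Classical.choose_spec (B.exists_normal ξ)).1

lemma inner_normal_tangent (ξ : ℝ) : inner ℝ (B.normal ξ) (B.tangent ξ) = 0 :=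
  (Classical.choose_spec (B.exists_normal ξ)).2.1

lemma eventually_sub_normal_mem (ξ : ℝ) :
    ∀ᶠ t : ℝ in 𝓝[>] 0, B.γ ξ - t • B.normal ξ ∈ B.D :=
  (Classical.choose_spec (B.exists_normal ξ)).2.2.1

lemma eventually_add_normal_notMem (ξ : ℝ) :
    ∀ᶠ t : ℝ in 𝓝[>] 0, B.γ ξ + t • B.normal ξ ∉ closure B.D :=
  (Classical.choose_spec (B.exists_normal ξ)).2.2.2

lemma norm_tangent (ξ : ℝ) : ‖B.tangent ξ‖ = 1 := B.norm_deriv ξ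

lemma continuous_γ : Continuous B.γ := B.contDiff.continuous

lemma continuous_tangent : Continuous B.tangent :=
  B.contDiff.continuous_deriv le_rfl

lemma hasStrictDerivAt_γ (ξ : ℝ) : HasStrictDerivAt B.γ (B.tangent ξ) ξ :=
  B.contDiff.contDiffAt.hasStrictDerivAt (by norm_num)

lemma hasDerivAt_γ (ξ : ℝ) : HasDerivAt B.γ (B.tangent ξ) ξ := (B.hasStrictDerivAt_γ ξ).hasDerivAt

lemma frontier_eq_range : frontier B.D = range B.γ := by
  rw [B.frontier_eq]
  have := B.periodic.image_Icc B.L_pos 0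
  simpa using this

lemma γ_mem_frontier (ξ : ℝ) : B.γ ξ ∈ frontier B.D := by
  rw [B.frontier_eq_range]; exact mem_range_self ξ

lemma γ_mem_closure (ξ : ℝ) : B.γ ξ ∈ closure B.D := frontier_subset_closure (B.γ_mem_frontier ξ)

lemma γ_notMem (ξ : ℝ) : B.γ ξ ∉ B.D := by
  have := B.γ_mem_frontier ξ
  rw [B.isOpen.frontier_eq] at this
  exact this.2

lemma γ_ne_zero (ξ : ℝ) : B.γ ξ ≠ 0 := fun h => B.γ_notMem ξ (h ▸ B.zero_mem)

lemma exists_γ_eq {z : ℂ} (hz : z ∈ closure B.D) (hz' : z ∉ B.D) : ∃ ζ, B.γ ζ = z := by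
  have : z ∈ frontier B.D := by
    rw [B.isOpen.frontier_eq]; exact ⟨hz, hz'⟩
  rwa [B.frontier_eq_range] at this

/-- Reduction modulo `L` shows that the parameters differ by an integer multiple of `L`, which is
smaller than `L` in absolute value. This form of injectivity can be used around any base parameter,
including the junction `0`. -/
lemma γ_eq_iff_of_abs_lt {x y : ℝ} (h : |x - y| < B.L) (hxy : B.γ x = B.γ y) : x = y := by
  have hL := B.L_pos
  obtain ⟨hx, hx'⟩ := toIcoMod_mem_Ico' hL x
  obtain ⟨hy, hy'⟩ := toIcoMod_mem_Ico' hL y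
  have e1 : B.γ (toIcoMod hL 0 x) = B.γ (toIcoMod hL 0 y) := by
    have h1 : ∀ x, B.γ (toIcoMod hL 0 x) = B.γ x := fun x => by
      rw [toIcoMod, B.periodic.sub_zsmul_eq]
    rw [h1, h1, hxy]
  have e2 := B.injOn ⟨hx, hx'⟩ ⟨hy, hy'⟩ e1
  rw [toIcoMod, toIcoMod] at e2
  have e3 : x - y = ((toIcoDiv hL 0 x - toIcoDiv hL 0 y : ℤ) : ℝ) * B.L := by
    push_cast
    simp only [zsmul_eq_mul] at e2
    linarith
  rw [e3, abs_mul, abs_of_pos hL] at h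
  have h4 : |((toIcoDiv hL 0 x - toIcoDiv hL 0 y : ℤ) : ℝ)| < 1 := by
    by_contra hc
    push Not at hc
    nlinarith
  have h5 : (toIcoDiv hL 0 x - toIcoDiv hL 0 y : ℤ) = 0 := by
    rw [← Int.abs_lt_one_iff]; exact_mod_cast h4
  rw [h5] at e3
  simp at e3
  linarith

lemma γ_injOn_Ioo : InjOn B.γ (Ioo 0 B.L) := B.injOn.mono Ioo_subset_Ico_self

/-- Rays leaving the boundary transversally do not meet it for a while, uniformly. -/
lemma exists_forall_notMem_frontier (ξ₀ M c : ℝ) (hc : 0 < c) (hM : 0 < M) :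
    ∃ δ > 0, ∀ ξ ∈ Metric.ball ξ₀ δ, ∀ w : ℂ, ‖w‖ ≤ M → c ≤ |inner ℝ (B.normal ξ₀) w| →
      ∀ τ ∈ Ioo 0 δ, B.γ ξ + (τ : ℝ) • w ∉ frontier B.D := by
  have hL := B.L_pos
  -- The bound `1 / 2` gives `|η - ξ| ≤ 2 τ M` for a boundary point hit at time `τ`. The bound `c /
  -- (4 M)` then makes the normal displacement at most `τ c / 2`, whereas the ray has normal
  -- displacement at least `τ c`.
  set ε : ℝ := min (1 / 2) (c / (4 * M)) with hε
  have hε0 : 0 < ε := by positivity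
  have hstrict := (B.hasStrictDerivAt_γ ξ₀).isLittleO.def hε0
  rw [nhds_prod_eq, Filter.eventually_prod_self_iff'] at hstrict
  obtain ⟨U, hU, hUs⟩ := hstrict
  obtain ⟨δ₁, hδ₁, hball⟩ := Metric.mem_nhds_iff.1 hU
  -- far boundary points
  set K : Set ℝ := {η | δ₁ ≤ |η - ξ₀| ∧ |η - ξ₀| ≤ B.L / 2}
  have hK : IsCompact K := by
    have h1 : K ⊆ Icc (ξ₀ - B.L / 2) (ξ₀ + B.L / 2) := fun η hη => by
      have := abs_le.1 hη.2
      constructor <;> linarith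
    refine isCompact_Icc.of_isClosed_subset ?_ h1
    have h2 : Continuous fun η : ℝ => |η - ξ₀| := by fun_prop
    exact (isClosed_le continuous_const h2).inter (isClosed_le h2 continuous_const)
  have hKimg : IsClosed (B.γ '' K) := (hK.image B.continuous_γ).isClosed
  have hnot : B.γ ξ₀ ∉ B.γ '' K := by
    rintro ⟨η, hη, he⟩
    have := B.γ_eq_iff_of_abs_lt (x := η) (y := ξ₀) (by linarith [hη.2]) he
    have h2 := hη.1
    rw [this] at h2
    simp at h2
    linarith
  obtain ⟨ρ, hρ, hρs⟩ := Metric.mem_nhds_iff.1 (hKimg.isOpen_compl.mem_nhds hnot)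
  obtain ⟨δ₂, hδ₂, hδ₂s⟩ := Metric.continuousAt_iff.1 (B.continuous_γ.continuousAt (x := ξ₀))
    (ρ / 2) (by positivity)
  refine ⟨min (min δ₁ δ₂) (ρ / (2 * M)), by positivity, ?_⟩
  intro ξ hξ w hw hcw τ hτ hmem
  rw [B.frontier_eq_range] at hmem
  have hξ1 : ξ ∈ Metric.ball ξ₀ δ₁ :=
    Metric.ball_subset_ball ((min_le_left _ _).trans (min_le_left _ _)) hξ
  have hξ2 : dist ξ ξ₀ < δ₂ :=
    Metric.ball_subset_ball ((min_le_left _ _).trans (min_le_right _ _)) hξ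
  have hτ0 : 0 < τ := hτ.1
  have hτ3 : τ < ρ / (2 * M) := hτ.2.trans_le (min_le_right _ _)
  have hnormτ : ‖(τ : ℝ) • w‖ ≤ τ * M := by
    rw [norm_smul, Real.norm_of_nonneg hτ0.le]
    gcongr
  obtain ⟨η, hη⟩ : ∃ η ∈ Icc (ξ₀ - B.L / 2) (ξ₀ - B.L / 2 + B.L), B.γ η = B.γ ξ + (τ : ℝ) • w := by
    have h3 := B.periodic.image_Icc hL (ξ₀ - B.L / 2)
    rw [← h3] at hmem
    exact hmem
  have hηL : |η - ξ₀| ≤ B.L / 2 := by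
    rw [abs_le]; constructor <;> linarith [hη.1.1, hη.1.2]
  -- Far parameters have images at distance at least `ρ` from `γ ξ₀`, by compactness. Near
  -- parameters are controlled by strict differentiability.
  rcases le_or_gt δ₁ |η - ξ₀| with hfar | hnear
  · have h5 : B.γ η ∈ Metric.ball (B.γ ξ₀) ρ := by
      rw [Metric.mem_ball, hη.2, dist_eq_norm]
      have h6 := hδ₂s hξ2
      rw [dist_eq_norm] at h6
      have h7 : τ * M < ρ / 2 := by
        rw [lt_div_iff₀ (by positivity)] at hτ3
        linarith
      calc ‖B.γ ξ + τ • w - B.γ ξ₀‖ = ‖(B.γ ξ - B.γ ξ₀) + τ • w‖ := by congr 1; ring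
        _ ≤ ‖B.γ ξ - B.γ ξ₀‖ + ‖τ • w‖ := norm_add_le _ _
        _ < ρ := by linarith
    exact hρs h5 ⟨η, ⟨hfar, hηL⟩, rfl⟩
  · have h1 := hUs η (hball (by rwa [Metric.mem_ball, Real.dist_eq])) ξ (hball hξ1)
    simp only at h1
    have h2 : B.γ η - B.γ ξ = (τ : ℝ) • w := by rw [hη.2]; ring
    rw [h2] at h1
    have h3 : |η - ξ| ≤ 2 * (τ * M) := by
      have h4 : ‖(η - ξ) • B.tangent ξ₀‖ = |η - ξ| := by
        rw [norm_smul, B.norm_tangent, mul_one, Real.norm_eq_abs]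
      have h5 : ‖(η - ξ) • B.tangent ξ₀‖ ≤
          ‖(τ : ℝ) • w‖ + ‖(τ : ℝ) • w - (η - ξ) • B.tangent ξ₀‖ := by
        have := norm_sub_le ((τ : ℝ) • w) ((τ : ℝ) • w - (η - ξ) • B.tangent ξ₀)
        simpa using this
      have h6 : ε * ‖η - ξ‖ ≤ 1 / 2 * |η - ξ| := by
        rw [Real.norm_eq_abs]
        exact mul_le_mul_of_nonneg_right (min_le_left _ _) (abs_nonneg _)
      have h7 : ‖(τ : ℝ) • w - (η - ξ) • B.tangent ξ₀‖ ≤ ε * ‖η - ξ‖ := by simpa using h1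
      linarith
    have h8 : |inner ℝ (B.normal ξ₀) ((τ : ℝ) • w)| ≤ ε * |η - ξ| := by
      have h9 : inner ℝ (B.normal ξ₀) ((τ : ℝ) • w) =
          inner ℝ (B.normal ξ₀) ((τ : ℝ) • w - (η - ξ) • B.tangent ξ₀) := by
        rw [inner_sub_right, inner_smul_right, inner_smul_right, B.inner_normal_tangent]; simp
      rw [h9]
      refine (abs_real_inner_le_norm _ _).trans ?_
      rw [B.norm_normal, one_mul]
      simpa using h1
    rw [inner_smul_right, abs_mul, abs_of_pos hτ0] at h8
    have h10 : ε * |η - ξ| ≤ c / (4 * M) * (2 * (τ * M)) := by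
      gcongr
      exact min_le_right _ _
    have h11 : c / (4 * M) * (2 * (τ * M)) = τ * c / 2 := by field_simp; ring
    have h12 : τ * c ≤ τ * |inner ℝ (B.normal ξ₀) w| := by gcongr
    have : 0 < τ * c := by positivity
    linarith

/-- Off the frontier the plane is the disjoint union of the two open sets `D` and `(closure D)ᶜ`. -/
lemma mem_or_notMem_closure_of_isPreconnected {A : Set ℂ} (hA : IsPreconnected A)
    (hd : ∀ z ∈ A, z ∉ frontier B.D) : A ⊆ B.D ∨ A ⊆ (closure B.D)ᶜ := by
  have h := (isPreconnected_iff_subset_of_disjoint.1 hA) B.D (closure B.D)ᶜ B.isOpen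
    isClosed_closure.isOpen_compl ?_ ?_
  · exact h
  · intro z hz
    by_cases h1 : z ∈ closure B.D
    · left
      by_contra h2
      exact hd z hz (by rw [B.isOpen.frontier_eq]; exact ⟨h1, h2⟩)
    · exact Or.inr h1
  · ext z
    simp only [mem_inter_iff, mem_compl_iff, mem_empty_iff_false, iff_false, not_and, not_not]
    exact fun _ h => subset_closure h

/-- A uniform cone condition at a boundary point, for a sign `σ` of the normal component. -/
lemma cone_aux (ξ₀ : ℝ) {w₀ : ℂ} (σ : ℝ) (hσ : |σ| = 1)
    (hw₀ : 0 < σ * inner ℝ (B.normal ξ₀) w₀) (U : Set ℂ) (V : Set ℂ)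
    (hUV : ∀ A : Set ℂ, IsPreconnected A → (∀ z ∈ A, z ∉ frontier B.D) → A ⊆ U ∨ A ⊆ V)
    (hdisj : Disjoint U V)
    (hν : ∀ᶠ t : ℝ in 𝓝[>] 0, B.γ ξ₀ + t • (σ • B.normal ξ₀) ∈ U) :
    ∀ᶠ x : ℝ × ℂ × ℝ in 𝓝 ξ₀ ×ˢ 𝓝 w₀ ×ˢ 𝓝[>] 0, B.γ x.1 + x.2.2 • x.2.1 ∈ U := by
  set M : ℝ := max ‖w₀‖ 1 + 1 with hM
  set c : ℝ := min 1 (σ * inner ℝ (B.normal ξ₀) w₀) / 2 with hc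
  have hM0 : 0 < M := by positivity
  have hc0 : 0 < c := by positivity
  have hσ2 : σ * σ = 1 := by rw [← abs_mul_abs_self, hσ]; norm_num
  obtain ⟨δ, hδ, hδs⟩ := B.exists_forall_notMem_frontier ξ₀ M c hc0 hM0
  set W : Set ℂ := {w | ‖w‖ ≤ M ∧ c ≤ σ * inner ℝ (B.normal ξ₀) w}
  have hW : Convex ℝ W := by
    have h1 : Convex ℝ {w : ℂ | ‖w‖ ≤ M} := by
      have := convex_closedBall (0 : ℂ) M
      simpa [Metric.closedBall, dist_zero_right] using this
    have h2 : Convex ℝ {w : ℂ | c ≤ σ * inner ℝ (B.normal ξ₀) w} := by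
      intro x hx y hy a b ha hb hab
      have hx' : c ≤ σ * inner ℝ (B.normal ξ₀) x := hx
      have hy' : c ≤ σ * inner ℝ (B.normal ξ₀) y := hy
      change c ≤ σ * inner ℝ (B.normal ξ₀) (a • x + b • y)
      rw [inner_add_right, inner_smul_right, inner_smul_right]
      calc c = a * c + b * c := by rw [← add_mul, hab, one_mul]
        _ ≤ a * (σ * inner ℝ (B.normal ξ₀) x) + b * (σ * inner ℝ (B.normal ξ₀) y) := by gcongr
        _ = _ := by ring
    exact h1.inter h2
  -- All the short rays together form a connected set missing the frontier, so they lie on a single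
  -- side; the ray along `σ n` tells which one.
  set A : Set ℂ := (fun x : ℝ × ℂ × ℝ => B.γ x.1 + x.2.2 • x.2.1) ''
    (Metric.ball ξ₀ δ ×ˢ (W ×ˢ Ioo 0 δ)) with hA
  have hAc : IsPreconnected A := by
    refine IsPreconnected.image ?_ _ ?_
    · exact ((convex_ball ξ₀ δ).prod (hW.prod (convex_Ioo 0 δ))).isPreconnected
    · have := B.continuous_γ
      exact Continuous.continuousOn (by fun_prop)
  have hAf : ∀ z ∈ A, z ∉ frontier B.D := by
    rintro z ⟨⟨ξ, w, τ⟩, ⟨hξ, hw, hτ⟩, rfl⟩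
    refine hδs ξ hξ w hw.1 ?_ τ hτ
    calc c ≤ σ * inner ℝ (B.normal ξ₀) w := hw.2
      _ ≤ |σ * inner ℝ (B.normal ξ₀) w| := le_abs_self _
      _ = _ := by rw [abs_mul, hσ, one_mul]
  have hAU : A ⊆ U := by
    rcases hUV A hAc hAf with h | h
    · exact h
    · exfalso
      obtain ⟨t, ht, htU⟩ := (Filter.Eventually.and (Ioo_mem_nhdsGT hδ) hν).exists
      refine hdisj.ne_of_mem htU (h ⟨(ξ₀, σ • B.normal ξ₀, t), ⟨?_, ⟨?_, ?_⟩, ht⟩, rfl⟩) rfl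
      · exact Metric.mem_ball_self hδ
      · rw [norm_smul, B.norm_normal, Real.norm_eq_abs, hσ, hM]
        have := le_max_right ‖w₀‖ 1
        linarith
      · simp only
        rw [inner_smul_right, real_inner_self_eq_norm_sq, B.norm_normal, ← mul_assoc, hσ2, hc]
        have := min_le_left 1 (σ * inner ℝ (B.normal ξ₀) w₀)
        linarith
  have hWn : W ∈ 𝓝 w₀ := by
    refine inter_mem ?_ ?_
    · refine (continuous_norm.tendsto w₀).eventually (eventually_le_nhds ?_)
      have := le_max_left ‖w₀‖ 1
      rw [hM]; linarith
    · have h1 : Continuous fun w : ℂ => σ * inner ℝ (B.normal ξ₀) w := by fun_prop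
      refine (h1.tendsto w₀).eventually (eventually_ge_nhds ?_)
      have := min_le_right 1 (σ * inner ℝ (B.normal ξ₀) w₀)
      rw [hc]; linarith
  filter_upwards [prod_mem_prod (Metric.ball_mem_nhds ξ₀ hδ)
    (prod_mem_prod hWn (Ioo_mem_nhdsGT hδ))] with x hx
  exact hAU ⟨x, hx, rfl⟩

lemma eventually_cone_mem {ξ₀ : ℝ} {w₀ : ℂ} (hw₀ : inner ℝ (B.normal ξ₀) w₀ < 0) :
    ∀ᶠ x : ℝ × ℂ × ℝ in 𝓝 ξ₀ ×ˢ 𝓝 w₀ ×ˢ 𝓝[>] 0, B.γ x.1 + x.2.2 • x.2.1 ∈ B.D := by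
  refine B.cone_aux ξ₀ (-1) (by norm_num) (by linarith) B.D (closure B.D)ᶜ
    (fun A h1 h2 => B.mem_or_notMem_closure_of_isPreconnected h1 h2) ?_ ?_
  · exact disjoint_compl_right.mono_left subset_closure
  · filter_upwards [B.eventually_sub_normal_mem ξ₀] with t ht
    simpa [sub_eq_add_neg] using ht

lemma eventually_cone_notMem {ξ₀ : ℝ} {w₀ : ℂ} (hw₀ : 0 < inner ℝ (B.normal ξ₀) w₀) :
    ∀ᶠ x : ℝ × ℂ × ℝ in 𝓝 ξ₀ ×ˢ 𝓝 w₀ ×ˢ 𝓝[>] 0, B.γ x.1 + x.2.2 • x.2.1 ∈ (closure B.D)ᶜ := by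
  refine B.cone_aux ξ₀ 1 (by norm_num) (by linarith) (closure B.D)ᶜ B.D
    (fun A h1 h2 => (B.mem_or_notMem_closure_of_isPreconnected h1 h2).symm) ?_ ?_
  · exact disjoint_compl_left.mono_right subset_closure
  · filter_upwards [B.eventually_add_normal_notMem ξ₀] with t ht
    simpa using ht

/-- The unit normal is, up to sign, the rotated tangent; every vector decomposes accordingly. -/
lemma decomp (ξ : ℝ) (v : ℂ) :
    v = (inner ℝ v (B.tangent ξ)) • B.tangent ξ + (inner ℝ v (B.normal ξ)) • B.normal ξ := by
  have h1 := B.norm_tangent ξ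
  have h2 := B.norm_normal ξ
  have h3 := B.inner_normal_tangent ξ
  set t := B.tangent ξ
  set n := B.normal ξ
  have e1 : t.re ^ 2 + t.im ^ 2 = 1 := by
    have := Complex.sq_norm t
    rw [h1, Complex.normSq_apply] at this; linarith
  have e2 : n.re ^ 2 + n.im ^ 2 = 1 := by
    have := Complex.sq_norm n
    rw [h2, Complex.normSq_apply] at this; linarith
  have e3 : n.re * t.re + n.im * t.im = 0 := by
    rw [Complex.inner] at h3; simp at h3; linarith
  -- The matrix with columns `t` and `n` is orthogonal, so its rows are orthonormal as well.
  have k1 : t.re ^ 2 + n.re ^ 2 = 1 := by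
    linear_combination (-n.re ^ 2 + 1) * e1 + t.im ^ 2 * e2 + (t.re * n.re - t.im * n.im) * e3
  have k2 : t.re * t.im + n.re * n.im = 0 := by
    linear_combination -(n.re * n.im) * e1 - (t.re * t.im) * e2 + (t.re * n.im + t.im * n.re) * e3
  have k3 : t.im ^ 2 + n.im ^ 2 = 1 := by linarith
  simp only [Complex.inner]
  apply Complex.ext
  · simp
    linear_combination (-v.re) * k1 - v.im * k2
  · simp
    linear_combination (-v.im) * k3 - v.re * k2

lemma norm_sq_decomp (ξ : ℝ) (v : ℂ) :
    ‖v‖ ^ 2 = inner ℝ v (B.tangent ξ) ^ 2 + inner ℝ v (B.normal ξ) ^ 2 := by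
  have h := B.decomp ξ v
  have h1 := B.norm_tangent ξ
  have h2 := B.norm_normal ξ
  rw [← real_inner_self_eq_norm_sq]
  nth_rewrite 2 [h]
  rw [inner_add_right, inner_smul_right, inner_smul_right]
  ring

/-- Nearby normals cannot flip, so the normal is continuous. -/
lemma continuous_normal : Continuous B.normal := by
  rw [continuous_iff_continuousAt]
  intro ξ₀
  rw [ContinuousAt, tendsto_iff_ultrafilter]
  intro g hg
  obtain ⟨n', hn', hlim⟩ := (isCompact_closedBall (0 : ℂ) 1).ultrafilter_le_nhds
    (g.map B.normal) (by
      simp only [le_principal_iff, Ultrafilter.mem_coe, Ultrafilter.mem_map]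
      refine univ_mem' fun ξ => ?_
      simp [B.norm_normal])
  have hlim' : Tendsto B.normal g (𝓝 n') := hlim
  have e1 : ‖n'‖ = 1 := by
    have := hlim'.norm
    simp only [B.norm_normal] at this
    exact (tendsto_nhds_unique this tendsto_const_nhds)
  have e2 : inner ℝ n' (B.tangent ξ₀) = 0 := by
    have h1 : Tendsto (fun ξ => inner ℝ (B.normal ξ) (B.tangent ξ)) g (𝓝 (inner ℝ n' (B.tangent ξ₀))) :=
      hlim'.inner ((B.continuous_tangent.tendsto ξ₀).mono_left hg)
    simp only [B.inner_normal_tangent] at h1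
    exact (tendsto_nhds_unique h1 tendsto_const_nhds)
  have e3 := B.decomp ξ₀ n'
  have e4 := B.norm_sq_decomp ξ₀ n'
  rw [e2, e1] at e4
  rw [e2] at e3
  have e5 : inner ℝ n' (B.normal ξ₀) = 1 ∨ inner ℝ n' (B.normal ξ₀) = -1 :=
    sq_eq_one_iff.1 (by linarith)
  rcases e5 with e5 | e5
  · rw [e5] at e3
    simp at e3
    rw [← e3]; exact hlim
  · exfalso
    rw [e5] at e3
    simp at e3
    -- If the normals flipped in the limit, the inward rays at the nearby points would have
    -- directions close to the outward normal at `ξ₀`, hence would lie outside `closure D`.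
    have h1 := B.eventually_cone_notMem (ξ₀ := ξ₀) (w₀ := -n') (by
      rw [e3]; simp [B.norm_normal])
    have h2 : Tendsto (fun x : ℝ × ℝ => (x.1, -B.normal x.1, x.2)) ((g : Filter ℝ) ×ˢ 𝓝[>] 0)
        (𝓝 ξ₀ ×ˢ 𝓝 (-n') ×ˢ 𝓝[>] 0) :=
      (tendsto_fst.mono_right hg).prodMk ((hlim'.neg.comp tendsto_fst).prodMk tendsto_snd)
    have h3 := h2.eventually h1
    obtain ⟨ξ, hξ⟩ := h3.curry.exists
    obtain ⟨t, ht1, ht2⟩ := (hξ.and (B.eventually_sub_normal_mem ξ)).exists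
    simp only [smul_neg] at ht1
    exact ht1 (subset_closure (by simpa [sub_eq_add_neg] using ht2))

end RefractionBilliard

noncomputable section

namespace RefractionBilliard

/-! ### Linear second-order flows -/

/-- `C` and `S` are the fundamental solutions of `x'' = κ x`. -/
structure Propagator (κ : ℝ) (C S : ℝ → ℝ) : Prop where
  derivC : ∀ t, HasDerivAt C (κ * S t) t
  derivS : ∀ t, HasDerivAt S (C t) t
  C_zero : C 0 = 1
  S_zero : S 0 = 0

lemma propagator_cos {ω : ℝ} (hω : ω ≠ 0) :
    Propagator (-ω ^ 2) (fun t => Real.cos (ω * t)) (fun t => Real.sin (ω * t) / ω) where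
  derivC t := by
    refine (((hasDerivAt_id' t).const_mul ω).cos).congr_deriv ?_
    field_simp
  derivS t := by
    refine ((((hasDerivAt_id' t).const_mul ω).sin).div_const ω).congr_deriv ?_
    field_simp
  C_zero := by simp
  S_zero := by simp

lemma propagator_cosh {Ω : ℝ} (hΩ : Ω ≠ 0) :
    Propagator (Ω ^ 2) (fun t => Real.cosh (Ω * t)) (fun t => Real.sinh (Ω * t) / Ω) where
  derivC t := by
    refine (((hasDerivAt_id' t).const_mul Ω).cosh).congr_deriv ?_
    field_simp
  derivS t := by
    refine ((((hasDerivAt_id' t).const_mul Ω).sinh).div_const Ω).congr_deriv ?_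
    field_simp
  C_zero := by simp
  S_zero := by simp

namespace Propagator

variable {κ : ℝ} {C S : ℝ → ℝ} (P : Propagator κ C S)

include P

lemma continuousC : Continuous C :=
  continuous_iff_continuousAt.2 fun t => (P.derivC t).continuousAt

lemma continuousS : Continuous S :=
  continuous_iff_continuousAt.2 fun t => (P.derivS t).continuousAt

lemma sq (t : ℝ) : C t ^ 2 - κ * S t ^ 2 = 1 := by
  have h : ∀ t, HasDerivAt (fun t => C t ^ 2 - κ * S t ^ 2) 0 t := fun t => by
    refine HasDerivAt.congr_deriv (((P.derivC t).pow 2).sub (((P.derivS t).pow 2).const_mul κ)) ?_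
    ring
  have := is_const_of_deriv_eq_zero (fun t => (h t).differentiableAt) (fun t => (h t).deriv) t 0
  simp only [P.C_zero, P.S_zero] at this
  simpa using this

/-- The inverse fundamental matrix applied to the translated solution is constant in time. The
argument does not depend on the sign of `κ`, so it serves the trigonometric and the hyperbolic case
together. -/
lemma add (s t : ℝ) : C (s + t) = C s * C t + κ * S s * S t ∧ S (s + t) = S s * C t + C s * S t := by
  have dC := fun t => (P.derivC (s + t)).comp_const_add s t
  have dS := fun t => (P.derivS (s + t)).comp_const_add s t
  have h1 : ∀ t, HasDerivAt (fun t => C (s + t) * C t - κ * S (s + t) * S t) 0 t := fun t => by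
    refine HasDerivAt.congr_deriv (((dC t).mul (P.derivC t)).sub ((((dS t).const_mul κ)).mul (P.derivS t))) ?_
    ring
  have h2 : ∀ t, HasDerivAt (fun t => S (s + t) * C t - C (s + t) * S t) 0 t := fun t => by
    refine HasDerivAt.congr_deriv (((dS t).mul (P.derivC t)).sub ((dC t).mul (P.derivS t))) ?_
    ring
  have e1 := is_const_of_deriv_eq_zero (fun t => (h1 t).differentiableAt) (fun t => (h1 t).deriv) t 0
  have e2 := is_const_of_deriv_eq_zero (fun t => (h2 t).differentiableAt) (fun t => (h2 t).deriv) t 0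
  simp only [P.C_zero, P.S_zero, add_zero, mul_one, mul_zero, sub_zero] at e1 e2
  have e3 := P.sq t
  constructor
  · linear_combination C t * e1 + κ * S t * e2 - C (s + t) * e3
  · linear_combination S t * e1 + C t * e2 - S (s + t) * e3

lemma neg (t : ℝ) : C (-t) = C t ∧ S (-t) = -S t := by
  have h := P.add (-t) t
  simp only [neg_add_cancel, P.C_zero, P.S_zero] at h
  have h3 := P.sq t
  constructor
  · linear_combination -C t * h.1 + κ * S t * h.2 - C (-t) * h3
  · linear_combination S t * h.1 - C t * h.2 - S (-t) * h3

end Propagator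

/-- The solution of `x'' = κ x` with initial position `p` and initial velocity `q`. -/
def flow (C S : ℝ → ℝ) (p q : ℂ) (t : ℝ) : ℂ := C t • p + S t • q

/-- The velocity of `flow`. -/
def flowVel (κ : ℝ) (C S : ℝ → ℝ) (p q : ℂ) (t : ℝ) : ℂ := (κ * S t) • p + C t • q

namespace Propagator

variable {κ : ℝ} {C S : ℝ → ℝ} (P : Propagator κ C S)

include P

lemma hasDerivAt_flow (p q : ℂ) (t : ℝ) :
    HasDerivAt (flow C S p q) (flowVel κ C S p q t) t :=
  ((P.derivC t).smul_const p).add ((P.derivS t).smul_const q)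

lemma hasDerivAt_flowVel (p q : ℂ) (t : ℝ) :
    HasDerivAt (flowVel κ C S p q) (κ • flow C S p q t) t := by
  refine HasDerivAt.congr_deriv ((((P.derivS t).const_mul κ).smul_const p).add ((P.derivC t).smul_const q)) ?_
  simp only [flow, smul_add, smul_smul]

lemma flow_zero (p q : ℂ) : flow C S p q 0 = p := by simp [flow, P.C_zero, P.S_zero]

lemma flowVel_zero (p q : ℂ) : flowVel κ C S p q 0 = q := by simp [flowVel, P.C_zero, P.S_zero]

lemma continuous_flow (p q : ℂ) : Continuous (flow C S p q) :=
  continuous_iff_continuousAt.2 fun t => (P.hasDerivAt_flow p q t).continuousAt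

lemma continuous_flow_uncurry : Continuous fun x : (ℂ × ℂ) × ℝ => flow C S x.1.1 x.1.2 x.2 := by
  have := P.continuousC
  have := P.continuousS
  unfold flow
  fun_prop

lemma continuous_flowVel_uncurry :
    Continuous fun x : (ℂ × ℂ) × ℝ => flowVel κ C S x.1.1 x.1.2 x.2 := by
  have := P.continuousC
  have := P.continuousS
  unfold flowVel
  fun_prop

lemma flow_add (p q : ℂ) (s t : ℝ) :
    flow C S p q (s + t) = flow C S (flow C S p q s) (flowVel κ C S p q s) t := by
  obtain ⟨h1, h2⟩ := P.add s t
  simp only [flow, flowVel, h1, h2, Complex.real_smul]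
  push_cast
  ring

lemma flowVel_add (p q : ℂ) (s t : ℝ) :
    flowVel κ C S p q (s + t) = flowVel κ C S (flow C S p q s) (flowVel κ C S p q s) t := by
  obtain ⟨h1, h2⟩ := P.add s t
  simp only [flow, flowVel, h1, h2, Complex.real_smul]
  push_cast
  ring

lemma flow_neg (p q : ℂ) (t : ℝ) : flow C S p (-q) t = flow C S p q (-t) := by
  obtain ⟨h1, h2⟩ := P.neg t
  simp [flow, h1, h2]

lemma flowVel_neg (p q : ℂ) (t : ℝ) : flowVel κ C S p (-q) t = -flowVel κ C S p q (-t) := by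
  obtain ⟨h1, h2⟩ := P.neg t
  simp [flowVel, h1, h2]
  ring

lemma flow_reverse (p q : ℂ) (T t : ℝ) :
    flow C S (flow C S p q T) (-flowVel κ C S p q T) t = flow C S p q (T - t) := by
  rw [P.flow_neg, ← P.flow_add, sub_eq_add_neg]

lemma flowVel_reverse (p q : ℂ) (T t : ℝ) :
    flowVel κ C S (flow C S p q T) (-flowVel κ C S p q T) t = -flowVel κ C S p q (T - t) := by
  rw [P.flowVel_neg, ← P.flowVel_add, sub_eq_add_neg]

lemma energy (p q : ℂ) (t : ℝ) :
    ‖flowVel κ C S p q t‖ ^ 2 - κ * ‖flow C S p q t‖ ^ 2 = ‖q‖ ^ 2 - κ * ‖p‖ ^ 2 := by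
  have h := P.sq t
  simp only [Complex.sq_norm, Complex.normSq_apply, flow, flowVel]
  simp
  linear_combination (q.re ^ 2 + q.im ^ 2 - κ * (p.re ^ 2 + p.im ^ 2)) * h

/-- A solution of `x'' = κ x` on an interval is given by the flow. -/
lemma eq_flow {T : ℝ} {z v : ℝ → ℂ}
    (hz : ∀ s ∈ Icc 0 T, HasDerivWithinAt z (v s) (Icc 0 T) s)
    (hv : ∀ s ∈ Icc 0 T, HasDerivWithinAt v (κ • z s) (Icc 0 T) s) :
    ∀ s ∈ Icc 0 T, z s = flow C S (z 0) (v 0) s ∧ v s = flowVel κ C S (z 0) (v 0) s := by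
  intro s hs
  have hT : 0 ≤ T := hs.1.trans hs.2
  have h0 : (0 : ℝ) ∈ Icc 0 T := ⟨le_rfl, hT⟩
  have dC := fun t => (P.derivC t).hasDerivWithinAt (s := Icc 0 T)
  have dS := fun t => (P.derivS t).hasDerivWithinAt (s := Icc 0 T)
  -- Variation of constants: pulling `(z, v)` back by the fundamental matrix gives two constants of
  -- motion.
  have h1 : ∀ t ∈ Icc 0 T, HasDerivWithinAt (fun t => C t • z t - S t • v t) 0 (Icc 0 T) t := by
    intro t ht
    refine HasDerivWithinAt.congr_deriv (((dC t).smul (hz t ht)).sub ((dS t).smul (hv t ht))) ?_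
    simp only [Complex.real_smul]; push_cast; ring
  have h2 : ∀ t ∈ Icc 0 T, HasDerivWithinAt (fun t => C t • v t - (κ * S t) • z t) 0 (Icc 0 T) t := by
    intro t ht
    refine HasDerivWithinAt.congr_deriv (((dC t).smul (hv t ht)).sub (((dS t).const_mul κ).smul (hz t ht))) ?_
    simp only [Complex.real_smul]; push_cast; ring
  have key : ∀ f : ℝ → ℂ, (∀ t ∈ Icc 0 T, HasDerivWithinAt f 0 (Icc 0 T) t) → f s = f 0 := by
    intro f hf
    have := (convex_Icc 0 T).norm_image_sub_le_of_norm_hasDerivWithin_le (C := 0) hf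
      (by simp) h0 hs
    simpa [sub_eq_zero] using this
  have e1 := key _ h1
  have e2 := key _ h2
  simp only [P.C_zero, P.S_zero, one_smul, zero_smul, mul_zero, sub_zero, Complex.real_smul] at e1 e2
  have e3 : (C s : ℂ) ^ 2 - κ * S s ^ 2 = 1 := by exact_mod_cast P.sq s
  simp only [flow, flowVel, Complex.real_smul]
  push_cast at *
  constructor
  · linear_combination C s * e1 + S s * e2 - z s * e3
  · linear_combination κ * S s * e1 + C s * e2 - v s * e3

end Propagator

/-! ### Uniform exit and entrance of families of paths -/

/-- A family of paths leaving transversally into an open set `U` stays in it for a while. -/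
lemma tube {X : Type*} [TopologicalSpace X] {F : X → ℝ → ℂ} {x₀ : X} {a b : ℝ} {U : Set ℂ}
    (hF : Continuous fun y : X × ℝ => F y.1 y.2) (hU : IsOpen U)
    (h : ∀ s ∈ Icc a b, F x₀ s ∈ U) : ∀ᶠ x in 𝓝 x₀, ∀ s ∈ Icc a b, F x s ∈ U := by
  refine isCompact_Icc.eventually_forall_of_forall_eventually ?_
  intro s hs
  exact (hF.tendsto (x₀, s)).eventually (hU.mem_nhds (h s hs))

/-- Continuity of hitting times: `Adm x T` means that `T` is the hitting time of the path `F x`. -/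
lemma hitting_time_continuous {X : Type*} [TopologicalSpace X] {F : X → ℝ → ℂ} {U : Set ℂ}
    (hF : Continuous fun y : X × ℝ => F y.1 y.2) (hU : IsOpen U) {x₀ : X} {T₀ : ℝ}
    (hT₀ : 0 < T₀) (hin : ∀ s ∈ Ioo 0 T₀, F x₀ s ∈ U)
    (hstart : ∃ δ > 0, ∀ᶠ x in 𝓝 x₀, ∀ s ∈ Ioo 0 δ, F x s ∈ U)
    (hexit : ∃ᶠ s in 𝓝[>] T₀, F x₀ s ∈ interior Uᶜ) {ε : ℝ} (hε : 0 < ε) :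
    ∀ᶠ x in 𝓝 x₀, ∀ T, 0 < T → (∀ s ∈ Ioo 0 T, F x s ∈ U) → F x T ∉ U → |T - T₀| < ε := by
  obtain ⟨δ, hδ, hstart⟩ := hstart
  -- The time `s₁`, slightly after `T₀`, at which the reference path is strictly outside `U`, bounds
  -- the nearby hitting times from above. The uniform start together with the tube bounds them from
  -- below.
  obtain ⟨s₁, hs₁, hs₁'⟩ := (hexit.and_eventually (Ioo_mem_nhdsGT (show T₀ < T₀ + ε by linarith))).exists
  have h1 : ∀ᶠ x in 𝓝 x₀, F x s₁ ∈ interior Uᶜ := by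
    have : Continuous fun x => F x s₁ := hF.comp (by fun_prop : Continuous fun x : X => (x, s₁))
    exact (this.tendsto x₀).eventually (isOpen_interior.mem_nhds hs₁)
  have h2 : ∀ᶠ x in 𝓝 x₀, ∀ s ∈ Icc (δ / 2) (T₀ - ε / 2), F x s ∈ U :=
    tube hF hU fun s hs => hin s ⟨by linarith [hs.1], by linarith [hs.2]⟩
  filter_upwards [hstart, h1, h2] with x hx1 hx2 hx3 T hT hTin hTU
  rw [abs_lt]
  constructor
  · by_contra hc
    push Not at hc
    rcases lt_or_ge T δ with h | h
    · exact hTU (hx1 T ⟨hT, h⟩)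
    · exact hTU (hx3 T ⟨by linarith, by linarith⟩)
  · by_contra hc
    push Not at hc
    exact interior_subset hx2 (hTin s₁ ⟨by linarith [hs₁'.1], by linarith [hs₁'.2]⟩)

end RefractionBilliard

namespace RefractionBilliard

/-! ### Levi-Civita regularization -/

lemma eq_of_hasDerivWithinAt_zero {T : ℝ} {f : ℝ → ℂ}
    (hf : ∀ t ∈ Icc 0 T, HasDerivWithinAt f 0 (Icc 0 T) t) {s : ℝ} (hs : s ∈ Icc 0 T) :
    f s = f 0 := by
  have h0 : (0 : ℝ) ∈ Icc 0 T := ⟨le_rfl, hs.1.trans hs.2⟩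
  have := (convex_Icc 0 T).norm_image_sub_le_of_norm_hasDerivWithin_le (C := 0) hf
    (by simp) h0 hs
  simpa [sub_eq_zero] using this

/-- The symmetric square of the linear flow, in a new time `σ` with `dσ = dt / r`. -/
lemma Propagator.eq_symmetric_square {κ : ℝ} {C S : ℝ → ℝ} (P : Propagator κ C S) {T : ℝ}
    {Y₀ Y₁ Y₂ : ℝ → ℂ} {r σ : ℝ → ℝ} (hσ0 : σ 0 = 0)
    (hσ : ∀ t ∈ Icc 0 T, HasDerivWithinAt σ (1 / r t) (Icc 0 T) t)
    (h0 : ∀ t ∈ Icc 0 T, HasDerivWithinAt Y₀ (2 * Y₁ t / r t) (Icc 0 T) t)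
    (h1 : ∀ t ∈ Icc 0 T, HasDerivWithinAt Y₁ ((Y₂ t + κ * Y₀ t) / r t) (Icc 0 T) t)
    (h2 : ∀ t ∈ Icc 0 T, HasDerivWithinAt Y₂ (2 * κ * Y₁ t / r t) (Icc 0 T) t)
    {s : ℝ} (hs : s ∈ Icc 0 T) :
    Y₀ s = C (σ s) ^ 2 * Y₀ 0 + 2 * C (σ s) * S (σ s) * Y₁ 0 + S (σ s) ^ 2 * Y₂ 0 := by
  have dC : ∀ t ∈ Icc 0 T, HasDerivWithinAt (fun t => (C (σ t) : ℂ))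
      (((κ * S (σ t)) * (1 / r t) : ℝ) : ℂ) (Icc 0 T) t := fun t ht =>
    ((P.derivC (σ t)).comp_hasDerivWithinAt t (hσ t ht)).ofReal_comp
  have dS : ∀ t ∈ Icc 0 T, HasDerivWithinAt (fun t => (S (σ t) : ℂ))
      ((C (σ t) * (1 / r t) : ℝ) : ℂ) (Icc 0 T) t := fun t ht =>
    ((P.derivS (σ t)).comp_hasDerivWithinAt t (hσ t ht)).ofReal_comp
  -- The triple `(Y₀, Y₁, Y₂)` obeys the equations of `(w ^ 2, w w', w' ^ 2)`. The functions in
  -- `k0`, `k1`, `k2` are its components after applying the inverse of the symmetric square of the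
  -- fundamental matrix.
  have k0 : ∀ t ∈ Icc 0 T, HasDerivWithinAt (fun t => (C (σ t) : ℂ) * C (σ t) * Y₀ t -
      2 * (C (σ t) * S (σ t)) * Y₁ t + S (σ t) * S (σ t) * Y₂ t) 0 (Icc 0 T) t := by
    intro t ht
    refine ((((((dC t ht).mul (dC t ht)).mul (h0 t ht)).sub
      ((((dC t ht).mul (dS t ht)).const_mul 2).mul (h1 t ht))).add
      (((dS t ht).mul (dS t ht)).mul (h2 t ht)))).congr_deriv ?_
    simp only [Pi.mul_apply]
    push_cast
    ring
  have k1 : ∀ t ∈ Icc 0 T, HasDerivWithinAt (fun t => -(κ * (C (σ t) * S (σ t))) * Y₀ t +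
      ((C (σ t) : ℂ) * C (σ t) + κ * (S (σ t) * S (σ t))) * Y₁ t -
      C (σ t) * S (σ t) * Y₂ t) 0 (Icc 0 T) t := by
    intro t ht
    refine ((((((dC t ht).mul (dS t ht)).const_mul (κ : ℂ)).neg.mul (h0 t ht)).add
      ((((dC t ht).mul (dC t ht)).add (((dS t ht).mul (dS t ht)).const_mul (κ : ℂ))).mul
        (h1 t ht))).sub (((dC t ht).mul (dS t ht)).mul (h2 t ht))).congr_deriv ?_
    simp only [Pi.mul_apply, Pi.add_apply, Pi.neg_apply]
    push_cast
    ring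
  have k2 : ∀ t ∈ Icc 0 T, HasDerivWithinAt (fun t => (κ : ℂ) ^ 2 * (S (σ t) * S (σ t)) * Y₀ t -
      2 * κ * (C (σ t) * S (σ t)) * Y₁ t + C (σ t) * C (σ t) * Y₂ t) 0 (Icc 0 T) t := by
    intro t ht
    refine ((((((dS t ht).mul (dS t ht)).const_mul ((κ : ℂ) ^ 2)).mul (h0 t ht)).sub
      ((((dC t ht).mul (dS t ht)).const_mul (2 * (κ : ℂ))).mul (h1 t ht))).add
      (((dC t ht).mul (dC t ht)).mul (h2 t ht))).congr_deriv ?_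
    simp only [Pi.mul_apply]
    push_cast
    ring
  have e0 := eq_of_hasDerivWithinAt_zero k0 hs
  have e1 := eq_of_hasDerivWithinAt_zero k1 hs
  have e2 := eq_of_hasDerivWithinAt_zero k2 hs
  have e3 : (C (σ s) : ℂ) ^ 2 - κ * S (σ s) ^ 2 = 1 := by exact_mod_cast P.sq (σ s)
  simp only [hσ0, P.C_zero, P.S_zero] at e0 e1 e2
  push_cast at e0 e1 e2
  linear_combination (C (σ s) : ℂ) ^ 2 * e0 + 2 * C (σ s) * S (σ s) * e1 + S (σ s) ^ 2 * e2
    - Y₀ s * (C (σ s) ^ 2 - κ * S (σ s) ^ 2 + 1) * e3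

/-- The physical time along a path in the Levi-Civita plane. -/
def lcTime (w : ℝ → ℂ) (τ : ℝ) : ℝ := ∫ s in (0 : ℝ)..τ, ‖w s‖ ^ 2

lemma lcTime_zero (w : ℝ → ℂ) : lcTime w 0 = 0 := by simp [lcTime]

lemma hasDerivAt_lcTime {w : ℝ → ℂ} (hw : Continuous w) (τ : ℝ) :
    HasDerivAt (lcTime w) (‖w τ‖ ^ 2) τ :=
  ((hw.norm.pow 2).integral_hasStrictDerivAt 0 τ).hasDerivAt

variable (B : RefractionBilliard)

/-- The propagator constant of the regularized inner problem. -/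
def innerκ (h : ℝ) : ℝ := (B.E + h) / 2

variable {B}

/-- The Kepler energy relation, multiplied by `‖w₁‖ ^ 2 = ‖z 0‖`, loses its singularity. The value
`μ / 2` is positive, so position and velocity never vanish together in the Levi-Civita plane. -/
lemma IsInnerSolution.energy_lc {h T : ℝ} {z v : ℝ → ℂ} (hz : B.IsInnerSolution h T z v)
    (hT : 0 ≤ T) (hz0 : z 0 ≠ 0) {w₁ : ℂ} (hw₁ : w₁ ^ 2 = z 0) :
    ‖v 0 * (starRingEnd ℂ) w₁ / 2‖ ^ 2 - B.innerκ h * ‖w₁‖ ^ 2 = B.μ / 2 := by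
  have h1 := hz.conservation 0 ⟨le_rfl, hT⟩ hz0
  have h2 : ‖w₁‖ ^ 2 = ‖z 0‖ := by rw [← hw₁, norm_pow]
  have h3 : ‖z 0‖ ≠ 0 := norm_ne_zero_iff.2 hz0
  rw [norm_div, norm_mul, RCLike.norm_conj, div_pow, mul_pow, h2]
  rw [innerPotential] at h1
  have h4 : ‖v 0‖ ^ 2 = 2 * (B.E + h + B.μ / ‖z 0‖) := by linarith
  rw [h4, innerκ]
  simp
  field_simp
  ring

/-- A classical inner solution without collisions is the square of a linear flow. -/
lemma IsInnerSolution.exists_lc_of_ne_zero {h T : ℝ} {z v : ℝ → ℂ}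
    (hz : B.IsInnerSolution h T z v) (hne : ∀ s ∈ Icc 0 T, z s ≠ 0) {C S : ℝ → ℝ}
    (P : Propagator (B.innerκ h) C S) {w₁ : ℂ} (hw₁ : w₁ ^ 2 = z 0) :
    ∀ t ∈ Icc 0 T, ∃ τ, 0 ≤ τ ∧ lcTime (flow C S w₁ (v 0 * (starRingEnd ℂ) w₁ / 2)) τ = t ∧
      z t = flow C S w₁ (v 0 * (starRingEnd ℂ) w₁ / 2) τ ^ 2 := by
  intro t₀ ht₀
  have hT : 0 ≤ T := ht₀.1.trans ht₀.2
  have h0T : (0 : ℝ) ∈ Icc 0 T := ⟨le_rfl, hT⟩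
  set q := v 0 * (starRingEnd ℂ) w₁ / 2 with hq
  set w := flow C S w₁ q with hw
  have hwc : Continuous w := P.continuous_flow _ _
  -- The projection extends the integrand continuously to all times, so that its primitive is
  -- differentiable also at the ends of the interval.
  set ρ : ℝ → ℝ := fun t => 1 / ‖z (projIcc 0 T hT t)‖ with hρ
  have hρc : Continuous ρ := by
    have h1 : Continuous fun t => z (projIcc 0 T hT t) :=
      hz.continuousOn.comp_continuous (continuous_subtype_val.comp continuous_projIcc)
        fun t => (projIcc 0 T hT t).2
    exact continuous_const.div h1.norm fun t =>
      norm_ne_zero_iff.2 (hne _ (projIcc 0 T hT t).2)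
  set σ : ℝ → ℝ := fun t => ∫ s in (0 : ℝ)..t, ρ s with hσ
  have hσd : ∀ t ∈ Icc 0 T, HasDerivWithinAt σ (1 / ‖z t‖) (Icc 0 T) t := by
    intro t ht
    have h1 := (hρc.integral_hasStrictDerivAt 0 t).hasDerivAt
    have h2 : ρ t = 1 / ‖z t‖ := by simp only [hρ, projIcc_of_mem hT ht]
    rw [h2] at h1
    exact h1.hasDerivWithinAt
  have hσ0 : σ 0 = 0 := by simp [hσ]
  have dr : ∀ t ∈ Icc 0 T, HasDerivWithinAt (fun t => ‖z t‖) (inner ℝ (z t) (v t) / ‖z t‖)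
      (Icc 0 T) t := by
    intro t ht
    have h1 := ((hz.hasDeriv t ht (hne t ht)).norm_sq).sqrt
      (pow_ne_zero 2 (norm_ne_zero_iff.2 (hne t ht)))
    simp only [Real.sqrt_sq (norm_nonneg _)] at h1
    refine h1.congr_deriv ?_
    have := norm_ne_zero_iff.2 (hne t ht)
    field_simp
  have dconj : ∀ t ∈ Icc 0 T, HasDerivWithinAt (fun t => (starRingEnd ℂ) (z t))
      ((starRingEnd ℂ) (v t)) (Icc 0 T) t := fun t ht => (hz.hasDeriv t ht (hne t ht)).star
  have facts : ∀ t ∈ Icc 0 T, (‖z t‖ : ℂ) ≠ 0 ∧ (‖z t‖ : ℂ) ^ 2 = z t * (starRingEnd ℂ) (z t) ∧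
      ((inner ℝ (z t) (v t) : ℝ) : ℂ) =
        ((starRingEnd ℂ) (z t) * v t + z t * (starRingEnd ℂ) (v t)) / 2 ∧
      v t * (starRingEnd ℂ) (v t) * ‖z t‖ = 2 * ((B.E + h) * ‖z t‖ + B.μ) := by
    intro t ht
    refine ⟨?_, ?_, ?_, ?_⟩
    · exact_mod_cast norm_ne_zero_iff.2 (hne t ht)
    · rw [Complex.mul_conj, Complex.normSq_eq_norm_sq]; push_cast; rfl
    · rw [Complex.inner, Complex.re_eq_add_conj]
      simp
      ring
    · have h1 := hz.conservation t ht (hne t ht)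
      rw [innerPotential] at h1
      have h2 := norm_ne_zero_iff.2 (hne t ht)
      have h3 : ‖v t‖ ^ 2 * ‖z t‖ = 2 * ((B.E + h) * ‖z t‖ + B.μ) := by
        field_simp at h1
        linarith
      rw [Complex.mul_conj, Complex.normSq_eq_norm_sq]
      exact_mod_cast h3
  have key : ∀ t ∈ Icc 0 T, z t = w (σ t) ^ 2 := by
    intro t ht
    -- These three quantities are `w ^ 2`, `w w'` and `w' ^ 2` written in terms of position and
    -- velocity; no continuous branch of the square root of `z` has to be chosen.
    have h3 := P.eq_symmetric_square (Y₀ := z) (Y₁ := fun t => ‖z t‖ * v t / 2)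
      (Y₂ := fun t => v t ^ 2 * (starRingEnd ℂ) (z t) / 4) (r := fun t => ‖z t‖) hσ0 hσd
      ?_ ?_ ?_ ht
    · rw [h3]
      obtain ⟨f1, f2, f3, f4⟩ := facts 0 h0T
      have e1 : (‖z 0‖ : ℂ) = w₁ * (starRingEnd ℂ) w₁ := by
        rw [Complex.mul_conj, Complex.normSq_eq_norm_sq, ← hw₁, norm_pow]
      simp only [hw, flow, Complex.real_smul, hq]
      rw [e1, ← hw₁, map_pow]
      ring
    · intro t ht
      obtain ⟨f1, f2, f3, f4⟩ := facts t ht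
      refine (hz.hasDeriv t ht (hne t ht)).congr_deriv ?_
      field_simp
    · intro t ht
      obtain ⟨f1, f2, f3, f4⟩ := facts t ht
      have d1 := (((dr t ht).ofReal_comp).mul (hz.equation t ht (hne t ht))).div_const 2
      refine d1.congr_deriv ?_
      simp only [Complex.real_smul]
      push_cast
      rw [f3, innerκ]
      push_cast
      field_simp
      linear_combination 4 * z t * f4
    · intro t ht
      obtain ⟨f1, f2, f3, f4⟩ := facts t ht
      have d1 := (((hz.equation t ht (hne t ht)).pow 2).mul (dconj t ht)).div_const 4
      refine d1.congr_deriv ?_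
      simp only [Complex.real_smul, Pi.pow_apply, innerκ]
      push_cast
      field_simp
      linear_combination 2 * ‖z t‖ ^ 2 * v t * f4 + 4 * B.μ * v t * f2
  refine ⟨σ t₀, ?_, ?_, key t₀ ht₀⟩
  · exact intervalIntegral.integral_nonneg ht₀.1 fun s _ => by positivity
  -- Since `‖w (σ t)‖ ^ 2 = ‖z t‖`, the two changes of time are inverse to each other.
  · have h1 : ∀ t ∈ Icc 0 T, HasDerivWithinAt (fun t => ((lcTime w (σ t) - t : ℝ) : ℂ)) 0
        (Icc 0 T) t := by
      intro t ht
      have h2 := (((hasDerivAt_lcTime hwc (σ t)).comp_hasDerivWithinAt t (hσd t ht)).sub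
        (hasDerivWithinAt_id t (Icc 0 T))).ofReal_comp
      refine h2.congr_deriv ?_
      have h3 : ‖w (σ t)‖ ^ 2 = ‖z t‖ := by rw [key t ht, norm_pow]
      have := norm_ne_zero_iff.2 (hne t ht)
      rw [h3]
      field_simp
      simp
    have h2 := eq_of_hasDerivWithinAt_zero h1 ht₀
    simp only [hσ0, lcTime_zero] at h2
    have h3 := Complex.ofReal_injective h2
    linarith

end RefractionBilliard

namespace RefractionBilliard

/-! ### Physical time along linear flows, and passage through collisions. -/

lemma add_mul_le_of_le_deriv {f f' : ℝ → ℝ} (hf : ∀ t, HasDerivAt f (f' t) t) {a c : ℝ}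
    (hc : ∀ t, a ≤ t → c ≤ f' t) {t : ℝ} (ht : a ≤ t) : f a + c * (t - a) ≤ f t := by
  have := (convex_Icc a t).mul_sub_le_image_sub_of_le_deriv (f := f) (C := c)
    (fun x _ => (hf x).continuousAt.continuousWithinAt)
    (fun x _ => (hf x).differentiableAt.differentiableWithinAt)
    (fun x hx => by
      rw [(hf x).deriv]
      exact hc x (interior_subset hx).1) a (left_mem_Icc.2 ht) t (right_mem_Icc.2 ht) ht
  linarith

namespace Propagator

variable {κ : ℝ} {C S : ℝ → ℝ} (P : Propagator κ C S)

include P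

/-- The derivative `‖w‖ ^ 2` is nonnegative. Were the time constant on an interval, `w` and hence
its velocity would vanish there, contradicting the positive energy. -/
lemma strictMono_lcTime {p q : ℂ} (he : 0 < ‖q‖ ^ 2 - κ * ‖p‖ ^ 2) :
    StrictMono (lcTime (flow C S p q)) := by
  have hd := hasDerivAt_lcTime (P.continuous_flow p q)
  have hmono : Monotone (lcTime (flow C S p q)) :=
    monotone_of_deriv_nonneg (fun t => (hd t).differentiableAt) fun t => by
      rw [(hd t).deriv]; positivity
  refine hmono.strictMono_of_injective ?_
  have key : ∀ a b, a < b → lcTime (flow C S p q) a ≠ lcTime (flow C S p q) b := by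
    intro a b hab heq
    have hconst : ∀ t ∈ Icc a b, lcTime (flow C S p q) t = lcTime (flow C S p q) a :=
      fun t ht => le_antisymm ((hmono ht.2).trans heq.ge) (hmono ht.1)
    have hzero : ∀ t ∈ Ioo a b, flow C S p q t = 0 := by
      intro t ht
      have h1 : lcTime (flow C S p q) =ᶠ[𝓝 t] fun _ => lcTime (flow C S p q) a := by
        filter_upwards [Icc_mem_nhds ht.1 ht.2] with s hs using hconst s hs
      have h2 := ((hasDerivAt_const t (lcTime (flow C S p q) a)).congr_of_eventuallyEq h1).unique
        (hd t)
      have h3 : ‖flow C S p q t‖ = 0 := by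
        have := h2.symm
        simpa using this
      exact norm_eq_zero.1 h3
    obtain ⟨t, ht⟩ := exists_between hab
    have h1 : flow C S p q =ᶠ[𝓝 t] fun _ => 0 := by
      filter_upwards [Ioo_mem_nhds ht.1 ht.2] with s hs using hzero s hs
    have h2 := ((hasDerivAt_const t (0 : ℂ)).congr_of_eventuallyEq h1).unique (P.hasDerivAt_flow p q t)
    have h3 := P.energy p q t
    rw [← h2, hzero t ht] at h3
    simp at h3
    linarith
  intro a b hab
  by_contra hne
  rcases lt_or_gt_of_ne hne with h | h
  · exact key a b h hab
  · exact key b a h hab.symm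

/-- The inner product `⟨w, w'⟩` has derivative at least the energy, so it eventually exceeds one.
Then `‖w‖ ^ 2` exceeds one, and physical time grows at least linearly; the intermediate value
theorem concludes. -/
lemma exists_lcTime_eq {p q : ℂ} (hκ : 0 ≤ κ) (he : 0 < ‖q‖ ^ 2 - κ * ‖p‖ ^ 2) {t : ℝ} (ht : 0 ≤ t) :
    ∃ τ, 0 ≤ τ ∧ lcTime (flow C S p q) τ = t := by
  set w := flow C S p q with hw
  set w' := flowVel κ C S p q with hw'
  set e := ‖q‖ ^ 2 - κ * ‖p‖ ^ 2 with hedef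
  have hd := hasDerivAt_lcTime (P.continuous_flow p q)
  have hdw := P.hasDerivAt_flow p q
  have hdw' := P.hasDerivAt_flowVel p q
  have hg : ∀ t, HasDerivAt (fun t => inner ℝ (w t) (w' t)) (κ * ‖w t‖ ^ 2 + ‖w' t‖ ^ 2) t := by
    intro t
    refine ((hdw t).inner ℝ (hdw' t)).congr_deriv ?_
    rw [inner_smul_right, real_inner_self_eq_norm_sq, real_inner_self_eq_norm_sq]
  have hf : ∀ t, HasDerivAt (fun t => ‖w t‖ ^ 2) (2 * inner ℝ (w t) (w' t)) t :=
    fun t => (hdw t).norm_sq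
  have hen : ∀ t, ‖w' t‖ ^ 2 - κ * ‖w t‖ ^ 2 = e := P.energy p q
  set g0 := inner ℝ (w 0) (w' 0)
  set τ₀ := (|g0| + 1) / e with hτ₀
  have hτ₀0 : 0 < τ₀ := by positivity
  have b1 : ∀ t, τ₀ ≤ t → 1 ≤ inner ℝ (w t) (w' t) := by
    intro t ht
    have h1 := add_mul_le_of_le_deriv hg (a := 0) (c := e) (fun t _ => by
      have := hen t
      have h2 : 0 ≤ κ * ‖w t‖ ^ 2 := by positivity
      linarith) (hτ₀0.le.trans ht)
    have h2 : e * τ₀ = |g0| + 1 := by rw [hτ₀]; field_simp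
    have h3 : e * τ₀ ≤ e * t := by gcongr
    have h4 := neg_abs_le g0
    simp only [sub_zero] at h1
    linarith
  have b2 : ∀ t, τ₀ + 1 ≤ t → 1 ≤ ‖w t‖ ^ 2 := by
    intro t ht
    have h1 := add_mul_le_of_le_deriv hf (a := τ₀) (c := 1) (fun t ht => by linarith [b1 t ht])
      (by linarith : τ₀ ≤ t)
    have : 0 ≤ ‖w τ₀‖ ^ 2 := by positivity
    linarith
  have hΘ0 : 0 ≤ lcTime w (τ₀ + 1) := by
    have h1 := (P.strictMono_lcTime he).monotone (show (0 : ℝ) ≤ τ₀ + 1 by linarith)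
    rwa [lcTime_zero] at h1
  have b3 := add_mul_le_of_le_deriv hd (a := τ₀ + 1) (c := 1) b2
    (by linarith : τ₀ + 1 ≤ τ₀ + 1 + t)
  have hcont : Continuous (lcTime w) :=
    continuous_iff_continuousAt.2 fun t => (hd t).continuousAt
  have hivt := intermediate_value_Icc (show (0 : ℝ) ≤ τ₀ + 1 + t by linarith) hcont.continuousOn
  obtain ⟨τ, hτ, hτ'⟩ := hivt (show t ∈ _ from ⟨by rw [lcTime_zero]; exact ht, by
    simp only [add_sub_cancel_left, one_mul] at b3; linarith⟩)
  exact ⟨τ, hτ.1, hτ'⟩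

/-- A linear motion is odd about a zero, so its square is even: smooth passage through zero in the
Levi-Civita plane is reflection at a collision in the physical plane. -/
lemma flow_add_eq_neg_of_zero {p q : ℂ} {τ : ℝ} (h : flow C S p q τ = 0) (σ : ℝ) :
    flow C S p q (τ + σ) = -flow C S p q (τ - σ) := by
  rw [sub_eq_add_neg, P.flow_add, P.flow_add, h]
  simp [flow, (P.neg σ).2]

lemma lcTime_add_sub_of_zero {p q : ℂ} {τ : ℝ} (h : flow C S p q τ = 0) (σ : ℝ) :
    lcTime (flow C S p q) (τ + σ) - lcTime (flow C S p q) τ =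
      lcTime (flow C S p q) τ - lcTime (flow C S p q) (τ - σ) := by
  have hd := hasDerivAt_lcTime (P.continuous_flow p q)
  have h1 : ∀ s, HasDerivAt (fun s => lcTime (flow C S p q) (τ + s) +
      lcTime (flow C S p q) (τ - s)) 0 s := by
    intro s
    refine (((hd (τ + s)).comp_const_add τ s).add ((hd (τ - s)).comp_const_sub τ s)).congr_deriv ?_
    rw [P.flow_add_eq_neg_of_zero h, norm_neg]
    ring
  have h2 := is_const_of_deriv_eq_zero (fun s => (h1 s).differentiableAt) (fun s => (h1 s).deriv) σ 0
  simp only [add_zero, sub_zero] at h2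
  linarith

end Propagator

variable {B : RefractionBilliard}

lemma IsInnerSolution.restrict {h T T' : ℝ} {z v : ℝ → ℂ} (hz : B.IsInnerSolution h T z v)
    (hT' : T' ≤ T) : B.IsInnerSolution h T' z v where
  continuousOn := hz.continuousOn.mono (Icc_subset_Icc_right hT')
  hasDeriv s hs hne := (hz.hasDeriv s (Icc_subset_Icc_right hT' hs) hne).mono (Icc_subset_Icc_right hT')
  equation s hs hne := (hz.equation s (Icc_subset_Icc_right hT' hs) hne).mono (Icc_subset_Icc_right hT')
  conservation s hs hne := hz.conservation s (Icc_subset_Icc_right hT' hs) hne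
  reflection s hs h0 τ h1 h2 := hz.reflection s (Icc_subset_Icc_right hT' hs) h0 τ
    (Icc_subset_Icc_right hT' h1) (Icc_subset_Icc_right hT' h2)

/-- A regularized inner solution which does not come back to its starting point before the final
time is, in the Levi-Civita plane, the square of a linear flow. -/
lemma IsInnerSolution.exists_lc {h T : ℝ} {z v : ℝ → ℂ} (hz : B.IsInnerSolution h T z v)
    (hT : 0 < T) (hz0 : z 0 ≠ 0) (hret : ∀ s ∈ Ioo 0 T, z s ≠ z 0) (hκ : 0 < B.innerκ h)
    {C S : ℝ → ℝ} (P : Propagator (B.innerκ h) C S) {w₁ q : ℂ} (hw₁ : w₁ ^ 2 = z 0)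
    (hq : q = v 0 * (starRingEnd ℂ) w₁ / 2) :
    ∃ τ₁, 0 < τ₁ ∧ lcTime (flow C S w₁ q) τ₁ = T ∧
      (∀ τ ∈ Icc 0 τ₁, lcTime (flow C S w₁ q) τ ∈ Icc 0 T) ∧
      ∀ τ ∈ Icc 0 τ₁, z (lcTime (flow C S w₁ q) τ) = flow C S w₁ q τ ^ 2 := by
  have he : 0 < ‖q‖ ^ 2 - B.innerκ h * ‖w₁‖ ^ 2 := by
    rw [hq, hz.energy_lc hT.le hz0 hw₁]
    exact half_pos B.μ_pos
  have hmono := P.strictMono_lcTime he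
  obtain ⟨τ₁, hτ₁, hτ₁T⟩ := P.exists_lcTime_eq hκ.le he hT.le
  have hτ₁' : 0 < τ₁ := by
    rcases hτ₁.lt_or_eq with h | h
    · exact h
    · rw [← h, lcTime_zero] at hτ₁T; exact absurd hτ₁T hT.ne
  set w := flow C S w₁ q with hw
  have hrange : ∀ τ ∈ Icc 0 τ₁, lcTime w τ ∈ Icc 0 T := fun τ hτ => by
    constructor
    · rw [← lcTime_zero w]; exact hmono.monotone hτ.1
    · rw [← hτ₁T]; exact hmono.monotone hτ.2
  refine ⟨τ₁, hτ₁', hτ₁T, hrange, ?_⟩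
  -- the identity before collisions
  have before : ∀ T' ≤ T, (∀ s ∈ Icc 0 T', z s ≠ 0) → ∀ τ, 0 ≤ τ → lcTime w τ ∈ Icc 0 T' →
      z (lcTime w τ) = w τ ^ 2 := by
    intro T' hT' hne τ hτ hτT
    obtain ⟨τ', h1, h2, h3⟩ :=
      (hz.restrict hT').exists_lc_of_ne_zero hne P hw₁ _ hτT
    rw [← hq] at h2 h3
    rw [h3, hmono.injective h2]
  by_cases hcol : ∀ s ∈ Icc 0 T, z s ≠ 0
  · exact fun τ hτ => before T le_rfl hcol τ hτ.1 (hrange τ hτ)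
  push Not at hcol
  -- the first collision
  set Z := {s | s ∈ Icc 0 T ∧ z s = 0} with hZ
  have hZc : IsCompact Z := by
    have h1 : IsClosed (Icc 0 T ∩ z ⁻¹' {0}) :=
      hz.continuousOn.preimage_isClosed_of_isClosed isClosed_Icc isClosed_singleton
    exact isCompact_Icc.of_isClosed_subset h1 inter_subset_left
  obtain ⟨sc, ⟨hscT, hsc0⟩, hscmin⟩ := hZc.exists_isLeast hcol
  have hsc : 0 < sc := by
    rcases hscT.1.lt_or_eq with h | h
    · exact h
    · exact absurd (h ▸ hsc0) hz0
  -- Were there more time, the reflection at the first collision would bring the solution back to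
  -- its starting point before the final time.
  have hT2 : T ≤ 2 * sc := by
    by_contra hc
    push Not at hc
    have h1 := hz.reflection sc hscT hsc0 sc (by simp [hT.le]) ⟨by linarith, by linarith⟩
    rw [sub_self] at h1
    exact hret (sc + sc) ⟨by linarith, by linarith⟩ h1
  have hlt : ∀ τ, 0 ≤ τ → lcTime w τ < sc → z (lcTime w τ) = w τ ^ 2 := by
    intro τ hτ hτs
    refine before (lcTime w τ) (hτs.le.trans hscT.2) (fun s hs h0 => ?_) τ hτ ⟨?_, le_rfl⟩
    · have := hscmin ⟨⟨hs.1, hs.2.trans (hτs.le.trans hscT.2)⟩, h0⟩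
      linarith [hs.2]
    · rw [← lcTime_zero w]; exact hmono.monotone hτ
  obtain ⟨τc, hτc, hτcs⟩ := P.exists_lcTime_eq hκ.le he hsc.le
  have hτc0 : 0 < τc := by
    rcases hτc.lt_or_eq with h | h
    · exact h
    · rw [← h, lcTime_zero] at hτcs; exact absurd hτcs hsc.ne
  have hwc : Continuous w := P.continuous_flow _ _
  have hΘc : Continuous (lcTime w) :=
    continuous_iff_continuousAt.2 fun t => (hasDerivAt_lcTime hwc t).continuousAt
  -- The identity `z = w ^ 2` holds strictly before the collision and passes to the limit from the
  -- left.
  have hwτc : w τc = 0 := by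
    have h1 : Tendsto (fun τ => z (lcTime w τ)) (𝓝[<] τc) (𝓝 (z sc)) := by
      have h2 : Tendsto (lcTime w) (𝓝[<] τc) (𝓝[Icc 0 T] sc) := by
        refine tendsto_nhdsWithin_iff.2 ⟨?_, ?_⟩
        · rw [← hτcs]; exact hΘc.continuousAt.mono_left nhdsWithin_le_nhds
        · filter_upwards [Ioo_mem_nhdsLT hτc0] with τ hτ
          constructor
          · rw [← lcTime_zero w]; exact hmono.monotone hτ.1.le
          · exact ((hmono hτ.2).le.trans hτcs.le).trans hscT.2
      exact (hz.continuousOn sc hscT).tendsto.comp h2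
    have h3 : Tendsto (fun τ => w τ ^ 2) (𝓝[<] τc) (𝓝 (w τc ^ 2)) :=
      ((hwc.pow 2).continuousAt (x := τc)).mono_left nhdsWithin_le_nhds
    have h4 : (fun τ => z (lcTime w τ)) =ᶠ[𝓝[<] τc] fun τ => w τ ^ 2 := by
      filter_upwards [Ioo_mem_nhdsLT hτc0] with τ hτ
      exact hlt τ hτ.1.le ((hmono hτ.2).trans_eq hτcs)
    have h5 := tendsto_nhds_unique (h1.congr' h4) h3
    rw [hsc0] at h5
    simpa using h5.symm
  intro τ hτ
  rcases lt_trichotomy τ τc with hc | hc | hc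
  · exact hlt τ hτ.1 ((hmono hc).trans_eq hτcs)
  · rw [hc, hτcs, hsc0, hwτc]; simp
  -- After the collision both sides are mirror images of their values at `τ' = 2 τc - τ`, for `z` by
  -- the reflection rule and for `w ^ 2` by oddness of `w`.
  · have h1 := P.lcTime_add_sub_of_zero hwτc (τ - τc)
    have h2 := P.flow_add_eq_neg_of_zero hwτc (τ - τc)
    rw [add_sub_cancel] at h1 h2
    rw [← hw] at h1 h2
    set τ' := τc - (τ - τc) with hτ'
    have hτ'lt : τ' < τc := by rw [hτ']; linarith
    have h3 : lcTime w τ ≤ T := (hrange τ hτ).2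
    have h4 : 0 ≤ lcTime w τ' := by linarith
    have h5 : 0 ≤ τ' := by
      by_contra hneg
      push Not at hneg
      have := hmono hneg
      rw [lcTime_zero] at this
      linarith
    have h6 := hz.reflection sc hscT hsc0 (lcTime w τ - sc)
      ⟨by linarith, by linarith [(hrange τ hτ).1, hscT.2, hmono hc]⟩
      ⟨by linarith [(hrange τ hτ).1], by linarith⟩
    rw [add_sub_cancel] at h6
    rw [h6, show sc - (lcTime w τ - sc) = lcTime w τ' by linarith,
      hlt τ' h5 ((hmono hτ'lt).trans_eq hτcs), h2, neg_sq]

/-- The velocity of a regularized solution in the Levi-Civita plane. -/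
lemma IsInnerSolution.velocity_lc {h T : ℝ} {z v : ℝ → ℂ} (hz : B.IsInnerSolution h T z v)
    {κ : ℝ} {C S : ℝ → ℝ} (P : Propagator κ C S) {w₁ q : ℂ} {τ₁ : ℝ} (hτ₁ : 0 < τ₁)
    (hrange : ∀ τ ∈ Icc 0 τ₁, lcTime (flow C S w₁ q) τ ∈ Icc 0 T)
    (heq : ∀ τ ∈ Icc 0 τ₁, z (lcTime (flow C S w₁ q) τ) = flow C S w₁ q τ ^ 2)
    {τ : ℝ} (hτ : τ ∈ Icc 0 τ₁) (hne : flow C S w₁ q τ ≠ 0) :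
    v (lcTime (flow C S w₁ q) τ) * (starRingEnd ℂ) (flow C S w₁ q τ) =
      2 * flowVel κ C S w₁ q τ := by
  set w := flow C S w₁ q with hw
  have hz0 : z (lcTime w τ) ≠ 0 := by rw [heq τ hτ]; exact pow_ne_zero 2 hne
  have h1 := HasDerivWithinAt.scomp τ (hz.hasDeriv _ (hrange τ hτ) hz0)
    ((hasDerivAt_lcTime (P.continuous_flow w₁ q) τ).hasDerivWithinAt (s := Icc 0 τ₁)) hrange
  have h2 : HasDerivWithinAt (fun τ => w τ ^ 2) (2 * w τ * flowVel κ C S w₁ q τ) (Icc 0 τ₁) τ := by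
    refine ((P.hasDerivAt_flow w₁ q τ).pow 2).hasDerivWithinAt.congr_deriv ?_
    simp [hw]
  have h3 : HasDerivWithinAt (fun τ => w τ ^ 2) (‖w τ‖ ^ 2 • v (lcTime w τ)) (Icc 0 τ₁) τ :=
    h1.congr (fun x hx => (heq x hx).symm) (heq τ hτ).symm
  have h4 := (uniqueDiffOn_Icc hτ₁ τ hτ).eq_deriv _ h3 h2
  have h5 : ((‖w τ‖ ^ 2 : ℝ) : ℂ) = w τ * (starRingEnd ℂ) (w τ) := by
    rw [Complex.mul_conj, Complex.normSq_eq_norm_sq]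
  rw [Complex.real_smul, h5] at h4
  have h6 : w τ * (v (lcTime w τ) * (starRingEnd ℂ) (w τ) - 2 * flowVel κ C S w₁ q τ) = 0 := by
    linear_combination h4
  rcases mul_eq_zero.1 h6 with h7 | h7
  · exact absurd h7 hne
  · exact sub_eq_zero.1 h7

end RefractionBilliard

namespace RefractionBilliard

/-! ### First hits of the boundary -/

/-- A relation which is the graph of a continuous function on its domain. -/
def ContRel {α β : Type*} [TopologicalSpace α] [TopologicalSpace β] (R : α → β → Prop) : Prop :=
  ∀ x y, R x y → ∀ V ∈ 𝓝 y, ∀ᶠ x' in 𝓝 x, ∀ y', R x' y' → y' ∈ V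

/-- Single-valuedness is continuity tested at `x' = x` against the complement of `y'`. -/
lemma ContRel.unique {α β : Type*} [TopologicalSpace α] [TopologicalSpace β] [T1Space β]
    {R : α → β → Prop} (hR : ContRel R) {x : α} {y y' : β} (h : R x y) (h' : R x y') : y' = y := by
  by_contra hne
  exact (hR x y h _ (isOpen_compl_singleton.mem_nhds (Ne.symm hne : y ≠ y'))).self_of_nhds y' h' rfl

lemma ContRel.mono {α β : Type*} [TopologicalSpace α] [TopologicalSpace β]
    {R R' : α → β → Prop} (hR : ContRel R) (h : ∀ x y, R' x y → R x y) : ContRel R' :=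
  fun x y hxy V hV => (hR x y (h _ _ hxy) V hV).mono fun _ hx' y' hy' => hx' y' (h _ _ hy')

lemma ContRel.comp {α β δ : Type*} [TopologicalSpace α] [TopologicalSpace β] [TopologicalSpace δ]
    {R : α → β → Prop} {R' : β → δ → Prop} (hR : ContRel R) (hR' : ContRel R') :
    ContRel fun x z => ∃ y, R x y ∧ R' y z := by
  rintro x z ⟨y, hxy, hyz⟩ V hV
  have h1 := hR x y hxy _ (hR' y z hyz V hV)
  filter_upwards [h1] with x' hx' z' ⟨y', hxy', hyz'⟩
  exact hx' y' hxy' z' hyz'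

/-- Conjugating by the velocity reversal transfers continuity from a reversible relation to its
converse. -/
lemma ContRel.conj {α β : Type*} [TopologicalSpace α] [TopologicalSpace β]
    {R : α → β → Prop} (hR : ContRel R) {f : α → α} {g : β → β} (hf : Continuous f)
    (hg : Continuous g) (hgg : ∀ y, g (g y) = y) :
    ContRel fun x y => R (f x) (g y) := by
  intro x y hxy V hV
  have h1 := hR _ _ hxy (g ⁻¹' V) (hg.continuousAt.preimage_mem_nhds (by rwa [hgg]))
  filter_upwards [hf.continuousAt.eventually h1] with x' hx' y' hy'
  have h2 := hx' _ hy'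
  rwa [mem_preimage, hgg] at h2

/-- Paths depending continuously on position and velocity at time `0`: `F` is the position, `G` the
velocity, and `c` the speed of the time parameter. -/
structure PathFamily (F G : ℂ × ℂ → ℝ → ℂ) (c : ℂ → ℝ) : Prop where
  continuous : Continuous fun y : (ℂ × ℂ) × ℝ => F y.1 y.2
  continuousAt : ∀ x τ, F x τ ≠ 0 → ContinuousAt (fun y : (ℂ × ℂ) × ℝ => G y.1 y.2) (x, τ)
  pos : ∀ p, p ≠ 0 → 0 < c p
  hasDerivAt : ∀ x τ, F x τ ≠ 0 → HasDerivAt (F x) (c (F x τ) • G x τ) τ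
  exists_slope : ∃ W : (ℂ × ℂ) × ℝ → ℂ, Continuous W ∧ (∀ x τ, F x τ = x.1 + τ • W (x, τ)) ∧
    ∀ x, W (x, 0) = c x.1 • x.2

variable (B : RefractionBilliard)

/-- `U` is the side of the boundary towards which `s n` points. -/
structure IsSide (s : ℝ) (U : Set ℂ) : Prop where
  isOpen : IsOpen U
  notMem : ∀ ξ, B.γ ξ ∉ U
  cone : ∀ {ξ₀ : ℝ} {w₀ : ℂ}, 0 < s * inner ℝ (B.normal ξ₀) w₀ →
    ∀ᶠ x : ℝ × ℂ × ℝ in 𝓝 ξ₀ ×ˢ 𝓝 w₀ ×ˢ 𝓝[>] 0, B.γ x.1 + x.2.2 • x.2.1 ∈ U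
  cone' : ∀ {ξ₀ : ℝ} {w₀ : ℂ}, s * inner ℝ (B.normal ξ₀) w₀ < 0 →
    ∀ᶠ x : ℝ × ℂ × ℝ in 𝓝 ξ₀ ×ˢ 𝓝 w₀ ×ˢ 𝓝[>] 0, B.γ x.1 + x.2.2 • x.2.1 ∈ interior Uᶜ

lemma isSide_outer : B.IsSide 1 (closure B.D)ᶜ where
  isOpen := isClosed_closure.isOpen_compl
  notMem ξ h := h (B.γ_mem_closure ξ)
  cone h := B.eventually_cone_notMem (by linarith)
  cone' h := (B.eventually_cone_mem (by linarith)).mono fun x hx => by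
    rw [compl_compl]
    exact interior_mono subset_closure (B.isOpen.interior_eq.symm ▸ hx)

lemma isSide_inner : B.IsSide (-1) B.D where
  isOpen := B.isOpen
  notMem ξ := B.γ_notMem ξ
  cone h := B.eventually_cone_mem (by linarith)
  cone' h := (B.eventually_cone_notMem (by linarith)).mono fun x hx => by
    rwa [interior_compl]

variable {B}

/-- A path crossing the boundary transversally lies on the expected side just after. -/
lemma eventually_after {U : Set ℂ}
    {f : ℝ → ℂ} {ζ T : ℝ} {w₀ : ℂ} (hcone : ∀ᶠ x : ℝ × ℂ × ℝ in 𝓝 ζ ×ˢ 𝓝 w₀ ×ˢ 𝓝[>] 0,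
      B.γ x.1 + x.2.2 • x.2.1 ∈ U) (hf : HasDerivAt f w₀ T) (hfT : f T = B.γ ζ) :
    ∀ᶠ τ in 𝓝[>] T, f τ ∈ U := by
  have h1 : Tendsto (slope f T) (𝓝[>] T) (𝓝 w₀) :=
    (hasDerivAt_iff_tendsto_slope.1 hf).mono_left (nhdsWithin_mono _ fun x hx => ne_of_gt hx)
  have h2 : Tendsto (fun τ => τ - T) (𝓝[>] T) (𝓝[>] 0) := by
    refine tendsto_nhdsWithin_iff.2 ⟨?_, ?_⟩
    · have : Continuous fun τ : ℝ => τ - T := by fun_prop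
      have h3 := this.tendsto T
      rw [sub_self] at h3
      exact h3.mono_left nhdsWithin_le_nhds
    · filter_upwards [self_mem_nhdsWithin] with τ hτ
      exact sub_pos.2 (mem_Ioi.1 hτ)
  have h3 := (tendsto_const_nhds (x := ζ)).prodMk (h1.prodMk h2)
  filter_upwards [h3.eventually hcone, self_mem_nhdsWithin] with τ hτ hτT
  have h4 : B.γ ζ + (τ - T) • slope f T τ = f τ := by
    rw [sub_smul_slope, ← hfT]; simp
  rwa [h4] at hτ

/-- Paths starting transversally towards a side stay on it for a while, uniformly. -/
lemma PathFamily.eventually_start {F G : ℂ × ℂ → ℝ → ℂ} {c : ℂ → ℝ} (hF : PathFamily F G c)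
    {s : ℝ} {U : Set ℂ} (hU : B.IsSide s U) {x : ℝ × ℂ}
    (hx : 0 < s * inner ℝ (B.normal x.1) x.2) :
    ∃ δ > 0, ∀ᶠ x' in 𝓝 x, ∀ τ ∈ Ioo 0 δ, F (B.γ x'.1, x'.2) τ ∈ U := by
  obtain ⟨W, hWc, hFW, hW0⟩ := hF.exists_slope
  have h1 := hU.cone (ξ₀ := x.1) (w₀ := W ((B.γ x.1, x.2), 0)) (by
    rw [hW0, inner_smul_right]
    have := hF.pos _ (B.γ_ne_zero x.1)
    have h2 : 0 < c (B.γ x.1) * (s * inner ℝ (B.normal x.1) x.2) := by positivity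
    simp only
    linarith)
  have hγ := B.continuous_γ
  have h2 : Tendsto (fun y : (ℝ × ℂ) × ℝ => (y.1.1, W ((B.γ y.1.1, y.1.2), y.2), y.2))
      (𝓝 x ×ˢ 𝓝[>] 0) (𝓝 x.1 ×ˢ 𝓝 (W ((B.γ x.1, x.2), 0)) ×ˢ 𝓝[>] 0) := by
    refine Tendsto.prodMk ?_ (Tendsto.prodMk ?_ tendsto_snd)
    · exact continuous_fst.continuousAt.tendsto.comp tendsto_fst
    · have h3 : Continuous fun y : (ℝ × ℂ) × ℝ => W ((B.γ y.1.1, y.1.2), y.2) := by fun_prop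
      have h4 := h3.tendsto (x, 0)
      exact h4.mono_left ((Filter.prod_mono (le_refl (𝓝 x)) nhdsWithin_le_nhds).trans
        nhds_prod_eq.ge)
  have h3 := h2.eventually h1
  rw [Filter.eventually_iff, mem_prod_iff] at h3
  obtain ⟨A, hA, I, hI, hAI⟩ := h3
  obtain ⟨δ, hδ, hδI⟩ := mem_nhdsGT_iff_exists_Ioo_subset.1 hI
  refine ⟨δ, hδ, ?_⟩
  filter_upwards [hA] with x' hx' τ hτ
  have h4 : (x', τ) ∈ A ×ˢ I := ⟨hx', hδI hτ⟩
  have h5 := hAI h4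
  rw [hFW]
  exact h5

/-- An injective continuous map on a compact set is a homeomorphism onto its image, so closeness of
boundary points gives closeness of parameters. -/
lemma exists_nhds_γ {K : Set ℝ} (hK : IsCompact K) (hinj : InjOn B.γ K) {ξ₀ : ℝ} (hξ₀ : ξ₀ ∈ K)
    {N : Set ℝ} (hN : N ∈ 𝓝 ξ₀) : ∃ V ∈ 𝓝 (B.γ ξ₀), ∀ ξ ∈ K, B.γ ξ ∈ V → ξ ∈ N := by
  have h1 : IsClosed (B.γ '' (K \ interior N)) :=
    ((hK.diff isOpen_interior).image B.continuous_γ).isClosed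
  refine ⟨_, h1.isOpen_compl.mem_nhds ?_, ?_⟩
  · rintro ⟨ξ, hξ, he⟩
    exact hξ.2 (hinj hξ.1 hξ₀ he ▸ mem_interior_iff_mem_nhds.2 hN)
  · intro ξ hξ hξV
    by_contra hc
    exact hξV ⟨ξ, ⟨hξ, fun h => hc (interior_subset h)⟩, rfl⟩

variable (B) in
/-- From the boundary state `x`, with velocity pointing to the side `U`, the path stays in `U` until
it crosses the boundary at the state `y`. -/
def Hit (F G : ℂ × ℂ → ℝ → ℂ) (s : ℝ) (U : Set ℂ) (K : Set ℝ) (x y : ℝ × ℂ) : Prop :=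
  x.1 ∈ K ∧ y.1 ∈ K ∧ 0 < s * inner ℝ (B.normal x.1) x.2 ∧ s * inner ℝ (B.normal y.1) y.2 < 0 ∧
    ∃ T, 0 < T ∧ (∀ τ ∈ Ioo 0 T, F (B.γ x.1, x.2) τ ∈ U) ∧ F (B.γ x.1, x.2) T = B.γ y.1 ∧
      G (B.γ x.1, x.2) T = y.2

/-- Transversality at the start and at the end makes the hitting time continuous. The state at that
time is then continuous too, because the velocity is singular only at the origin, which is not on
the boundary. -/
lemma PathFamily.contRel_hit {F G : ℂ × ℂ → ℝ → ℂ} {c : ℂ → ℝ} (hF : PathFamily F G c)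
    {s : ℝ} {U : Set ℂ} (hU : B.IsSide s U) {K : Set ℝ} (hK : IsCompact K) (hinj : InjOn B.γ K) :
    ContRel (B.Hit F G s U K) := by
  rintro x y ⟨hxK, hyK, hxs, hys, T, hT, hin, hhit, hvel⟩ V hV
  have hγ := B.continuous_γ
  have hFc : Continuous fun y : (ℝ × ℂ) × ℝ => F (B.γ y.1.1, y.1.2) y.2 :=
    hF.continuous.comp (by fun_prop : Continuous fun y : (ℝ × ℂ) × ℝ => ((B.γ y.1.1, y.1.2), y.2))
  have hne : F (B.γ x.1, x.2) T ≠ 0 := by rw [hhit]; exact B.γ_ne_zero _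
  have hexit : ∀ᶠ τ in 𝓝[>] T, F (B.γ x.1, x.2) τ ∈ interior Uᶜ := by
    refine eventually_after (hU.cone' (ξ₀ := y.1) ?_) (hF.hasDerivAt _ T hne) hhit
    rw [inner_smul_right, hvel]
    have := hF.pos _ hne
    have h2 : c (F (B.γ x.1, x.2) T) * (s * inner ℝ (B.normal y.1) y.2) < 0 :=
      mul_neg_of_pos_of_neg this hys
    linarith
  have htime := fun ε (hε : 0 < ε) => hitting_time_continuous
    (F := fun x : ℝ × ℂ => F (B.γ x.1, x.2)) hFc hU.isOpen hT hin (hF.eventually_start hU hxs)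
    hexit.frequently hε
  obtain ⟨N, hN, V₂, hV₂, hNV⟩ := mem_nhds_prod_iff.1 (show V ∈ 𝓝 (y.1, y.2) from hV)
  obtain ⟨V₁, hV₁, hV₁N⟩ := exists_nhds_γ hK hinj hyK hN
  have hc1 : ContinuousAt (fun z : (ℝ × ℂ) × ℝ => F (B.γ z.1.1, z.1.2) z.2) (x, T) :=
    hFc.continuousAt
  have hc2 : ContinuousAt (fun z : (ℝ × ℂ) × ℝ => G (B.γ z.1.1, z.1.2) z.2) (x, T) := by
    have h1 := hF.continuousAt _ _ hne
    have h2 : ContinuousAt (fun z : (ℝ × ℂ) × ℝ => ((B.γ z.1.1, z.1.2), z.2)) (x, T) := by fun_prop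
    exact ContinuousAt.comp (f := fun z : (ℝ × ℂ) × ℝ => ((B.γ z.1.1, z.1.2), z.2)) h1 h2
  have h1 := (hc1.eventually (show V₁ ∈ 𝓝 (F (B.γ x.1, x.2) T) by rwa [hhit])).and
    (hc2.eventually (show V₂ ∈ 𝓝 (G (B.γ x.1, x.2) T) by rwa [hvel]))
  rw [nhds_prod_eq, Filter.eventually_iff, mem_prod_iff] at h1
  obtain ⟨A, hA, I, hI, hAI⟩ := h1
  obtain ⟨ε, hε, hεI⟩ := Metric.mem_nhds_iff.1 hI
  filter_upwards [hA, htime ε hε] with x' hx' hx'T y' ⟨_, hyK', _, _, T', hT', hin', hhit', hvel'⟩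
  have h2 := hx'T T' hT' hin' (by rw [hhit']; exact hU.notMem _)
  have h3 : (x', T') ∈ A ×ˢ I := ⟨hx', hεI (by rwa [Metric.mem_ball, Real.dist_eq])⟩
  have h4 := hAI h3
  have h5 : F (B.γ x'.1, x'.2) T' ∈ V₁ ∧ G (B.γ x'.1, x'.2) T' ∈ V₂ := h4
  rw [hhit', hvel'] at h5
  exact hNV ⟨hV₁N _ hyK' h5.1, h5.2⟩

/-! ### The outer and the inner path families -/

/-- The difference quotients extend continuously to time zero. Short paths thereby become rays whose
direction is close to the initial velocity, to which the cone condition applies. -/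
lemma Propagator.exists_slope {κ : ℝ} {C S : ℝ → ℝ} (P : Propagator κ C S) :
    ∃ c s : ℝ → ℝ, Continuous c ∧ Continuous s ∧ (∀ t, C t = 1 + t * c t) ∧ (∀ t, S t = t * s t) ∧
      c 0 = 0 ∧ s 0 = 1 := by
  refine ⟨dslope C 0, dslope S 0, ?_, ?_, fun t => ?_, fun t => ?_, ?_, ?_⟩
  · rw [continuous_iff_continuousAt]
    intro t
    rcases eq_or_ne t 0 with rfl | h
    · exact continuousAt_dslope_same.2 (P.derivC 0).differentiableAt
    · exact (continuousAt_dslope_of_ne h).2 P.continuousC.continuousAt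
  · rw [continuous_iff_continuousAt]
    intro t
    rcases eq_or_ne t 0 with rfl | h
    · exact continuousAt_dslope_same.2 (P.derivS 0).differentiableAt
    · exact (continuousAt_dslope_of_ne h).2 P.continuousS.continuousAt
  · have := sub_smul_dslope C 0 t
    rw [P.C_zero, sub_zero, smul_eq_mul] at this
    linarith
  · have := sub_smul_dslope S 0 t
    rw [P.S_zero, sub_zero, smul_eq_mul] at this
    linarith
  · rw [dslope_same, (P.derivC 0).deriv, P.S_zero, mul_zero]
  · rw [dslope_same, (P.derivS 0).deriv, P.C_zero]

lemma Propagator.pathFamily_flow {κ : ℝ} {C S : ℝ → ℝ} (P : Propagator κ C S) :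
    PathFamily (fun x => flow C S x.1 x.2) (fun x => flowVel κ C S x.1 x.2) (fun _ => 1) where
  continuous := P.continuous_flow_uncurry
  continuousAt _ _ _ := P.continuous_flowVel_uncurry.continuousAt
  pos _ _ := one_pos
  hasDerivAt x τ _ := by simpa using P.hasDerivAt_flow x.1 x.2 τ
  exists_slope := by
    obtain ⟨c, s, hc, hs, hC, hS, hc0, hs0⟩ := P.exists_slope
    refine ⟨fun y => c y.2 • y.1.1 + s y.2 • y.1.2, by fun_prop, fun x τ => ?_, fun x => ?_⟩
    · simp only [flow, hC, hS, Complex.real_smul]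
      push_cast; ring
    · simp [hc0, hs0]

/-- The regularized Kepler motion, as a function of the Levi-Civita time. -/
def keplerPath (C S : ℝ → ℝ) (x : ℂ × ℂ) (τ : ℝ) : ℂ :=
  (C τ) ^ 2 * x.1 + C τ * S τ * (‖x.1‖ * x.2) + (S τ) ^ 2 * (x.2 ^ 2 * (starRingEnd ℂ) x.1 / 4)

/-- The derivative of `keplerPath`. -/
def keplerDer (κ : ℝ) (C S : ℝ → ℝ) (x : ℂ × ℂ) (τ : ℝ) : ℂ :=
  2 * κ * (C τ * S τ) * x.1 + (C τ ^ 2 + κ * S τ ^ 2) * (‖x.1‖ * x.2) +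
    2 * (C τ * S τ) * (x.2 ^ 2 * (starRingEnd ℂ) x.1 / 4)

/-- The velocity of the regularized Kepler motion. -/
def keplerVel (κ : ℝ) (C S : ℝ → ℝ) (x : ℂ × ℂ) (τ : ℝ) : ℂ :=
  keplerDer κ C S x τ / ‖keplerPath C S x τ‖

/-- The coefficients of `keplerPath` are `w₁ ^ 2`, `2 w₁ q` and `q ^ 2`, which do not change when
both `w₁` and `q` change sign. Hence the path depends continuously on the physical data, although
the square root does not. -/
lemma keplerPath_eq_sq {C S : ℝ → ℝ} {p v w₁ : ℂ} (hw₁ : w₁ ^ 2 = p) (τ : ℝ) :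
    keplerPath C S (p, v) τ = flow C S w₁ (v * (starRingEnd ℂ) w₁ / 2) τ ^ 2 := by
  have e1 : (‖p‖ : ℂ) = w₁ * (starRingEnd ℂ) w₁ := by
    rw [Complex.mul_conj, Complex.normSq_eq_norm_sq, ← hw₁, norm_pow]
  subst hw₁
  simp only [keplerPath, flow, e1, map_pow, Complex.real_smul]
  ring

lemma keplerDer_eq {κ : ℝ} {C S : ℝ → ℝ} {p v w₁ : ℂ} (hw₁ : w₁ ^ 2 = p) (τ : ℝ) :
    keplerDer κ C S (p, v) τ = 2 * flow C S w₁ (v * (starRingEnd ℂ) w₁ / 2) τ *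
      flowVel κ C S w₁ (v * (starRingEnd ℂ) w₁ / 2) τ := by
  have e1 : (‖p‖ : ℂ) = w₁ * (starRingEnd ℂ) w₁ := by
    rw [Complex.mul_conj, Complex.normSq_eq_norm_sq, ← hw₁, norm_pow]
  subst hw₁
  simp only [keplerDer, flow, flowVel, e1, map_pow, Complex.real_smul]
  push_cast
  ring

lemma keplerVel_mul_conj {κ : ℝ} {C S : ℝ → ℝ} {p v w₁ : ℂ} (hw₁ : w₁ ^ 2 = p) {τ : ℝ}
    (hne : flow C S w₁ (v * (starRingEnd ℂ) w₁ / 2) τ ≠ 0) :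
    keplerVel κ C S (p, v) τ * (starRingEnd ℂ) (flow C S w₁ (v * (starRingEnd ℂ) w₁ / 2) τ) =
      2 * flowVel κ C S w₁ (v * (starRingEnd ℂ) w₁ / 2) τ := by
  rw [keplerVel, keplerDer_eq hw₁, keplerPath_eq_sq hw₁]
  set w := flow C S w₁ (v * (starRingEnd ℂ) w₁ / 2) τ
  have e1 : ((‖w ^ 2‖ : ℝ) : ℂ) = w * (starRingEnd ℂ) w := by
    rw [Complex.mul_conj, Complex.normSq_eq_norm_sq, norm_pow]
  have h2 : (starRingEnd ℂ) w ≠ 0 := by simpa using hne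
  rw [e1]
  field_simp

lemma Propagator.hasDerivAt_keplerPath {κ : ℝ} {C S : ℝ → ℝ} (P : Propagator κ C S) (x : ℂ × ℂ)
    (τ : ℝ) : HasDerivAt (keplerPath C S x) (keplerDer κ C S x τ) τ := by
  have dC := (P.derivC τ).ofReal_comp
  have dS := (P.derivS τ).ofReal_comp
  refine ((((dC.pow 2).mul_const x.1).add ((dC.mul dS).mul_const (‖x.1‖ * x.2))).add
    ((dS.pow 2).mul_const (x.2 ^ 2 * (starRingEnd ℂ) x.1 / 4))).congr_deriv ?_
  simp only [keplerDer]
  push_cast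
  ring

lemma Propagator.continuous_keplerPath {κ : ℝ} {C S : ℝ → ℝ} (P : Propagator κ C S) :
    Continuous fun y : (ℂ × ℂ) × ℝ => keplerPath C S y.1 y.2 := by
  have := P.continuousC
  have := P.continuousS
  have := Complex.continuous_conj
  unfold keplerPath
  fun_prop

lemma Propagator.continuous_keplerDer {κ : ℝ} {C S : ℝ → ℝ} (P : Propagator κ C S) :
    Continuous fun y : (ℂ × ℂ) × ℝ => keplerDer κ C S y.1 y.2 := by
  have := P.continuousC
  have := P.continuousS
  have := Complex.continuous_conj
  unfold keplerDer
  fun_prop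

lemma Propagator.pathFamily_kepler {κ : ℝ} {C S : ℝ → ℝ} (P : Propagator κ C S) :
    PathFamily (keplerPath C S) (keplerVel κ C S) (fun p => ‖p‖) where
  continuous := P.continuous_keplerPath
  continuousAt x τ hne := by
    refine P.continuous_keplerDer.continuousAt.div ?_ ?_
    · exact (Complex.continuous_ofReal.comp P.continuous_keplerPath.norm).continuousAt
    · simpa using hne
  pos p hp := norm_pos_iff.2 hp
  hasDerivAt x τ hne := by
    refine (P.hasDerivAt_keplerPath x τ).congr_deriv ?_
    have : (‖keplerPath C S x τ‖ : ℂ) ≠ 0 := by simpa using hne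
    rw [keplerVel, Complex.real_smul]
    field_simp
  exists_slope := by
    obtain ⟨c, s, hc, hs, hC, hS, hc0, hs0⟩ := P.exists_slope
    have := Complex.continuous_conj
    refine ⟨fun y => κ * y.2 * s y.2 ^ 2 * y.1.1 + (1 + y.2 * c y.2) * s y.2 * (‖y.1.1‖ * y.1.2) +
      y.2 * s y.2 ^ 2 * (y.1.2 ^ 2 * (starRingEnd ℂ) y.1.1 / 4), by fun_prop, fun x τ => ?_,
      fun x => ?_⟩
    · have h1 : (C τ : ℂ) ^ 2 = 1 + κ * S τ ^ 2 := by
        have h2 : (C τ : ℂ) ^ 2 - κ * S τ ^ 2 = 1 := by exact_mod_cast P.sq τ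
        linear_combination h2
      have h2 : (C τ : ℂ) = 1 + τ * c τ := by exact_mod_cast hC τ
      have h3 : (S τ : ℂ) = τ * s τ := by exact_mod_cast hS τ
      rw [keplerPath, h1, h2, h3, Complex.real_smul]
      ring
    · simp [hs0]

end RefractionBilliard

namespace RefractionBilliard

/-! ### Propagators of the billiard and time reversal -/

variable (B : RefractionBilliard)

/-- The cosine-like fundamental solution of the outer problem. -/
def oC (t : ℝ) : ℝ := Real.cos (B.ω * t)

/-- The sine-like fundamental solution of the outer problem. -/
def oS (t : ℝ) : ℝ := Real.sin (B.ω * t) / B.ω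

lemma outerPropagator : Propagator (-B.ω ^ 2) B.oC B.oS := propagator_cos B.ω_pos.ne'

/-- The cosine-like fundamental solution of the regularized inner problem. -/
def iC (h t : ℝ) : ℝ := Real.cosh (√(B.innerκ h) * t)

/-- The sine-like fundamental solution of the regularized inner problem. -/
def iS (h t : ℝ) : ℝ := Real.sinh (√(B.innerκ h) * t) / √(B.innerκ h)

lemma innerκ_pos {h : ℝ} (hh : 0 < h) : 0 < B.innerκ h := by
  have := B.E_pos
  unfold innerκ; positivity

lemma innerPropagator {h : ℝ} (hh : 0 < h) : Propagator (B.innerκ h) (B.iC h) (B.iS h) := by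
  have h1 := B.innerκ_pos hh
  have h2 := propagator_cosh (Real.sqrt_pos.2 h1).ne'
  rwa [Real.sq_sqrt h1.le] at h2

/-- The reversal of the velocity. -/
def rev (x : ℝ × ℂ) : ℝ × ℂ := (x.1, -x.2)

lemma continuous_rev : Continuous rev := by unfold rev; fun_prop

lemma rev_rev (x : ℝ × ℂ) : rev (rev x) = x := by simp [rev]

variable {B}

/-- Reversing the velocity at the end runs the path backwards and exchanges the transversality
conditions at its two ends. -/
lemma Hit.reverse {F G : ℂ × ℂ → ℝ → ℂ} {s : ℝ} {U : Set ℂ} {K : Set ℝ} {x y : ℝ × ℂ}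
    (hrev : ∀ (p v : ℂ) (T τ : ℝ), p ≠ 0 → F (p, v) T ≠ 0 →
      F (F (p, v) T, -G (p, v) T) τ = F (p, v) (T - τ) ∧
      G (F (p, v) T, -G (p, v) T) T = -v ∧ F (p, v) 0 = p)
    (h : B.Hit F G s U K x y) : B.Hit F G s U K (rev y) (rev x) := by
  obtain ⟨hxK, hyK, hxs, hys, T, hT, hin, hhit, hvel⟩ := h
  have hne : F (B.γ x.1, x.2) T ≠ 0 := by rw [hhit]; exact B.γ_ne_zero _
  have h1 := fun τ => hrev (B.γ x.1) x.2 T τ (B.γ_ne_zero _) hne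
  rw [hhit, hvel] at h1
  refine ⟨hyK, hxK, ?_, ?_, T, hT, ?_, ?_, ?_⟩
  · simp only [rev, inner_neg_right]; linarith
  · simp only [rev, inner_neg_right]; linarith
  · intro τ hτ
    simp only [rev]
    rw [(h1 τ).1]
    exact hin _ ⟨by linarith [hτ.2], by linarith [hτ.1]⟩
  · simp only [rev]
    rw [(h1 T).1, sub_self, (h1 T).2.2]
  · simp only [rev]
    rw [(h1 T).2.1]

lemma Propagator.flow_hrev {κ : ℝ} {C S : ℝ → ℝ} (P : Propagator κ C S) (p v : ℂ) (T τ : ℝ) :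
    flow C S (flow C S p v T) (-flowVel κ C S p v T) τ = flow C S p v (T - τ) ∧
      flowVel κ C S (flow C S p v T) (-flowVel κ C S p v T) T = -v ∧ flow C S p v 0 = p := by
  refine ⟨P.flow_reverse p v T τ, ?_, P.flow_zero p v⟩
  rw [P.flowVel_reverse, sub_self, P.flowVel_zero]

lemma exists_sq_eq (p : ℂ) : ∃ w : ℂ, w ^ 2 = p := IsAlgClosed.exists_pow_nat_eq p two_pos

lemma Propagator.kepler_hrev {κ : ℝ} {C S : ℝ → ℝ} (P : Propagator κ C S) (p v : ℂ) (T τ : ℝ)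
    (hp : p ≠ 0) (hne : keplerPath C S (p, v) T ≠ 0) :
    keplerPath C S (keplerPath C S (p, v) T, -keplerVel κ C S (p, v) T) τ =
        keplerPath C S (p, v) (T - τ) ∧
      keplerVel κ C S (keplerPath C S (p, v) T, -keplerVel κ C S (p, v) T) T = -v ∧
      keplerPath C S (p, v) 0 = p := by
  obtain ⟨w₁, hw₁⟩ := exists_sq_eq p
  set q := v * (starRingEnd ℂ) w₁ / 2 with hq
  have e0 : ∀ τ, keplerPath C S (p, v) τ = flow C S w₁ q τ ^ 2 := fun τ => keplerPath_eq_sq hw₁ τ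
  have hwT : flow C S w₁ q T ≠ 0 := by
    intro h
    rw [e0, h] at hne
    simp at hne
  have e1 : -keplerVel κ C S (p, v) T * (starRingEnd ℂ) (flow C S w₁ q T) / 2 =
      -flowVel κ C S w₁ q T := by
    rw [neg_mul, keplerVel_mul_conj hw₁ hwT]; ring
  have hw1 : w₁ ≠ 0 := by rintro rfl; simp at hw₁; exact hp hw₁.symm
  refine ⟨?_, ?_, ?_⟩
  · rw [keplerPath_eq_sq (e0 T).symm, e1, P.flow_reverse, ← e0]
  · have h1 := keplerVel_mul_conj (κ := κ) (C := C) (S := S) (v := -keplerVel κ C S (p, v) T)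
      (e0 T).symm (τ := T)
    rw [e1, P.flow_reverse, P.flowVel_reverse, sub_self, P.flow_zero, P.flowVel_zero] at h1
    have h2 := h1 hw1
    have h3 : (starRingEnd ℂ) w₁ ≠ 0 := by simpa using hw1
    have h4 : (keplerVel κ C S (keplerPath C S (p, v) T, -keplerVel κ C S (p, v) T) T + v) *
        (starRingEnd ℂ) w₁ = 0 := by
      rw [add_mul, h2, hq]; ring
    have h5 := (mul_eq_zero.1 h4).resolve_right h3
    exact eq_neg_of_add_eq_zero_left h5
  · rw [e0, P.flow_zero, hw₁]

variable (B)

/-- The outer crossing relation between states on `K`. -/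
def OuterHit (K : Set ℝ) : ℝ × ℂ → ℝ × ℂ → Prop :=
  B.Hit (fun x => flow B.oC B.oS x.1 x.2) (fun x => flowVel (-B.ω ^ 2) B.oC B.oS x.1 x.2) 1
    (closure B.D)ᶜ K

/-- The inner crossing relation between states (with their inner velocities) on `K`. -/
def InnerHit (h : ℝ) (K : Set ℝ) : ℝ × ℂ → ℝ × ℂ → Prop :=
  B.Hit (keplerPath (B.iC h) (B.iS h)) (keplerVel (B.innerκ h) (B.iC h) (B.iS h)) (-1) B.D K

variable {B}

lemma OuterHit.reverse {K : Set ℝ} {x y : ℝ × ℂ} (h : B.OuterHit K x y) :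
    B.OuterHit K (rev y) (rev x) :=
  Hit.reverse (fun p v T τ _ _ => B.outerPropagator.flow_hrev p v T τ) h

lemma InnerHit.reverse {h : ℝ} (hh : 0 < h) {K : Set ℝ} {x y : ℝ × ℂ} (hxy : B.InnerHit h K x y) :
    B.InnerHit h K (rev y) (rev x) :=
  Hit.reverse (fun p v T τ hp hne => (B.innerPropagator hh).kepler_hrev p v T τ hp hne) hxy

lemma contRel_outerHit {K : Set ℝ} (hK : IsCompact K) (hinj : InjOn B.γ K) :
    ContRel (B.OuterHit K) :=
  B.outerPropagator.pathFamily_flow.contRel_hit B.isSide_outer hK hinj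

lemma contRel_innerHit {h : ℝ} (hh : 0 < h) {K : Set ℝ} (hK : IsCompact K) (hinj : InjOn B.γ K) :
    ContRel (B.InnerHit h K) :=
  (B.innerPropagator hh).pathFamily_kepler.contRel_hit B.isSide_inner hK hinj

/-- By reversibility, the converse relation is contained in the conjugate of the relation by `rev`.
-/
lemma contRel_outerHit_flip {K : Set ℝ} (hK : IsCompact K) (hinj : InjOn B.γ K) :
    ContRel fun y x => B.OuterHit K x y :=
  ((contRel_outerHit hK hinj).conj continuous_rev continuous_rev rev_rev).mono
    fun _ _ h => OuterHit.reverse h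

lemma contRel_innerHit_flip {h : ℝ} (hh : 0 < h) {K : Set ℝ} (hK : IsCompact K)
    (hinj : InjOn B.γ K) : ContRel fun y x => B.InnerHit h K x y :=
  ((contRel_innerHit hh hK hinj).conj continuous_rev continuous_rev rev_rev).mono
    fun _ _ hxy => InnerHit.reverse hh hxy

/-! ### Refraction -/

variable (B)

lemma inner_normal_self (ξ : ℝ) : inner ℝ (B.normal ξ) (B.normal ξ) = (1 : ℝ) := by
  rw [real_inner_self_eq_norm_sq, B.norm_normal]; norm_num

lemma inner_tangent_self (ξ : ℝ) : inner ℝ (B.tangent ξ) (B.tangent ξ) = (1 : ℝ) := by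
  rw [real_inner_self_eq_norm_sq, B.norm_tangent]; norm_num

lemma inner_comb_tangent (ξ x y : ℝ) :
    inner ℝ (x • B.tangent ξ + y • B.normal ξ) (B.tangent ξ) = x := by
  rw [inner_add_left, real_inner_smul_left, real_inner_smul_left, B.inner_normal_tangent,
    B.inner_tangent_self]
  ring

lemma inner_comb_normal (ξ x y : ℝ) :
    inner ℝ (x • B.tangent ξ + y • B.normal ξ) (B.normal ξ) = y := by
  rw [inner_add_left, real_inner_smul_left, real_inner_smul_left, real_inner_comm,
    B.inner_normal_tangent, B.inner_normal_self]
  ring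

/-- The energy shell of the potential `V` at the boundary point `γ ξ`, with normal sign `σ`,
reconstructed from the tangential component. -/
lemma eq_of_tangential {ξ : ℝ} {v : ℂ} {V σ : ℝ} (hσ : σ = 1 ∨ σ = -1)
    (hv : ‖v‖ ^ 2 / 2 - V = 0) (hs : 0 < σ * inner ℝ (B.normal ξ) v) :
    v = inner ℝ v (B.tangent ξ) • B.tangent ξ +
      (σ * √(2 * V - inner ℝ v (B.tangent ξ) ^ 2)) • B.normal ξ := by
  have h1 := B.norm_sq_decomp ξ v
  have h2 : 2 * V - inner ℝ v (B.tangent ξ) ^ 2 = inner ℝ v (B.normal ξ) ^ 2 := by linarith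
  nth_rewrite 1 [B.decomp ξ v]
  rw [h2, Real.sqrt_sq_eq_abs]
  rw [real_inner_comm] at hs
  congr 2
  rcases hσ with rfl | rfl
  · rw [abs_of_pos (by linarith)]; ring
  · rw [abs_of_neg (by linarith)]; ring

lemma outerPotential_le_innerPotential {h : ℝ} (hh : 0 < h) (z : ℂ) :
    B.outerPotential z < B.innerPotential h z := by
  unfold outerPotential innerPotential
  have h1 : 0 ≤ B.ω ^ 2 / 2 * ‖z‖ ^ 2 := by positivity
  have h2 : 0 ≤ B.μ / ‖z‖ := div_nonneg B.μ_pos.le (norm_nonneg _)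
  linarith

/-- The inner potential exceeds the outer one for positive `h`, so the tangential component never
exhausts the inner speed and total reflection does not occur. -/
lemma refract_radicand_pos {h : ℝ} (hh : 0 < h) {ξ : ℝ} {v : ℂ}
    (hv : ‖v‖ ^ 2 / 2 - B.outerPotential (B.γ ξ) = 0) :
    0 < 2 * B.innerPotential h (B.γ ξ) - inner ℝ v (B.tangent ξ) ^ 2 := by
  have h1 := B.norm_sq_decomp ξ v
  have h2 := B.outerPotential_le_innerPotential hh (B.γ ξ)
  nlinarith [sq_nonneg (inner ℝ v (B.normal ξ))]

lemma refract_eq {h ξ : ℝ} {v : ℂ} {σ : ℝ} (hσ : σ = 1 ∨ σ = -1)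
    (hs : 0 < σ * inner ℝ (B.normal ξ) v) :
    B.refract h ξ v = inner ℝ v (B.tangent ξ) • B.tangent ξ +
      (σ * √(2 * B.innerPotential h (B.γ ξ) - inner ℝ v (B.tangent ξ) ^ 2)) • B.normal ξ := by
  rw [refract]
  rw [real_inner_comm] at hs
  rcases hσ with rfl | rfl
  · rw [Real.sign_of_pos (by linarith)]
  · rw [Real.sign_of_neg (by linarith)]

/-- The shell map with energy `V ξ` and normal sign `σ`. -/
def shellMap (V : ℂ → ℝ) (σ : ℝ) (x : ℝ × ℂ) : ℝ × ℂ :=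
  (x.1, inner ℝ x.2 (B.tangent x.1) • B.tangent x.1 +
    (σ * √(2 * V (B.γ x.1) - inner ℝ x.2 (B.tangent x.1) ^ 2)) • B.normal x.1)

lemma continuous_shellMap {V : ℂ → ℝ} (hV : Continuous fun ξ => V (B.γ ξ)) (σ : ℝ) :
    Continuous (B.shellMap V σ) := by
  have h1 := B.continuous_tangent
  have h2 := B.continuous_normal
  unfold shellMap
  have h3 : Continuous fun x : ℝ × ℂ => V (B.γ x.1) := hV.comp continuous_fst
  have h4 : Continuous fun x : ℝ × ℂ => inner ℝ x.2 (B.tangent x.1) :=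
    continuous_snd.inner (h1.comp continuous_fst)
  exact continuous_fst.prodMk ((h4.smul (h1.comp continuous_fst)).add
    ((continuous_const.mul ((continuous_const.mul h3).sub (h4.pow 2)).sqrt).smul
      (h2.comp continuous_fst)))

lemma continuous_outerPotential_γ : Continuous fun ξ => B.outerPotential (B.γ ξ) := by
  have := B.continuous_γ
  unfold outerPotential
  fun_prop

lemma continuous_innerPotential_γ (h : ℝ) : Continuous fun ξ => B.innerPotential h (B.γ ξ) := by
  have := B.continuous_γ
  unfold innerPotential
  refine continuous_const.add (continuous_const.div this.norm fun ξ => ?_)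
  exact norm_ne_zero_iff.2 (B.γ_ne_zero ξ)

/-- The outer energy shell with normal sign `σ`. -/
def OuterShell (σ : ℝ) (x : ℝ × ℂ) : Prop :=
  ‖x.2‖ ^ 2 / 2 - B.outerPotential (B.γ x.1) = 0 ∧ 0 < σ * inner ℝ (B.normal x.1) x.2

variable {B}

/-- Refraction keeps the tangential component, which together with the sign of the normal one
determines a velocity on an energy shell. Hence the outer shell map inverts it. -/
lemma shellMap_refract {h : ℝ} {x : ℝ × ℂ} {σ : ℝ} (hσ : σ = 1 ∨ σ = -1)
    (hx : B.OuterShell σ x) : B.shellMap B.outerPotential σ (x.1, B.refract h x.1 x.2) = x := by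
  have h1 := B.eq_of_tangential hσ hx.1 hx.2
  rw [B.refract_eq hσ hx.2, shellMap]
  simp only
  rw [B.inner_comb_tangent, ← h1]

/-- The sign in Snell's law is discontinuous, but on a shell of fixed sign refraction coincides with
a continuous shell map. -/
lemma contRel_refract {h : ℝ} {σ : ℝ} (hσ : σ = 1 ∨ σ = -1) :
    ContRel fun x y : ℝ × ℂ => B.OuterShell σ x ∧ y = (x.1, B.refract h x.1 x.2) := by
  rintro x y ⟨hx, rfl⟩ V hV
  have h1 := (B.continuous_shellMap (B.continuous_innerPotential_γ h) σ).continuousAt (x := x)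
  have h2 : ∀ x, B.OuterShell σ x →
      (x.1, B.refract h x.1 x.2) = B.shellMap (B.innerPotential h) σ x := by
    intro x hx
    rw [B.refract_eq hσ hx.2, shellMap]
  rw [h2 x hx] at hV
  filter_upwards [h1.eventually hV] with x' hx' y' ⟨hx1, hy'⟩
  rw [hy', h2 x' hx1]
  exact hx'

lemma contRel_refract_flip {h : ℝ} {σ : ℝ} (hσ : σ = 1 ∨ σ = -1) :
    ContRel fun y x : ℝ × ℂ => B.OuterShell σ x ∧ y = (x.1, B.refract h x.1 x.2) := by
  rintro y x ⟨hx, rfl⟩ V hV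
  have h1 := (B.continuous_shellMap B.continuous_outerPotential_γ σ).continuousAt
    (x := (x.1, B.refract h x.1 x.2))
  have h3 := h1.eventually (show V ∈ 𝓝 _ by rwa [shellMap_refract hσ hx])
  filter_upwards [h3] with y' hy' x' ⟨hx', he⟩
  subst he
  rwa [← shellMap_refract hσ hx']

lemma inner_normal_refract {h : ℝ} (hh : 0 < h) {x : ℝ × ℂ} {σ : ℝ} (hσ : σ = 1 ∨ σ = -1)
    (hx : B.OuterShell σ x) : 0 < σ * inner ℝ (B.normal x.1) (B.refract h x.1 x.2) := by
  rw [B.refract_eq hσ hx.2, real_inner_comm, B.inner_comb_normal]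
  have h1 := Real.sqrt_pos.2 (B.refract_radicand_pos hh hx.1)
  rcases hσ with rfl | rfl <;> linarith

/-! ### The first return relation is a continuous partial bijection -/

variable (B)

/-- The composition of the outer crossing, refraction, inner crossing and refraction. -/
def ReturnChain (h : ℝ) (K : Set ℝ) (x y : ℝ × ℂ) : Prop :=
  ∃ x₁, B.OuterHit K x x₁ ∧ ∃ X₁, (B.OuterShell (-1) x₁ ∧ X₁ = (x₁.1, B.refract h x₁.1 x₁.2)) ∧
    ∃ Y, B.InnerHit h K X₁ Y ∧ (B.OuterShell 1 y ∧ Y = (y.1, B.refract h y.1 y.2))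

variable {B}

lemma contRel_returnChain {h : ℝ} (hh : 0 < h) {K : Set ℝ} (hK : IsCompact K)
    (hinj : InjOn B.γ K) : ContRel (B.ReturnChain h K) :=
  (contRel_outerHit hK hinj).comp ((contRel_refract (Or.inr rfl)).comp
    ((contRel_innerHit hh hK hinj).comp (contRel_refract_flip (Or.inl rfl))))

lemma contRel_returnChain_flip {h : ℝ} (hh : 0 < h) {K : Set ℝ} (hK : IsCompact K)
    (hinj : InjOn B.γ K) : ContRel fun y x => B.ReturnChain h K x y := by
  refine ((((contRel_refract (B := B) (h := h) (Or.inl rfl)).comp (contRel_innerHit_flip hh hK hinj)).comp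
    (contRel_refract_flip (B := B) (h := h) (Or.inr rfl))).comp (contRel_outerHit_flip hK hinj)).mono ?_
  rintro y x ⟨x₁, h1, X₁, h2, Y, h3, h4⟩
  exact ⟨x₁, ⟨X₁, ⟨Y, h4, h3⟩, h2⟩, h1⟩

/-- Uniqueness for the outer equation and the Levi-Civita description of the inner one identify the
abstract motions with explicit path families. Only this implication is needed, because continuity
and uniqueness pass to smaller relations. -/
lemma Returns.chain {m : ℕ} {a b α β : Fin m → ℝ} {h : ℝ} (hh : 0 < h) {K : Set ℝ}
    (hK : ∀ i, Icc (α i) (β i) ⊆ K) {x y : ℝ × ℂ} (hxy : B.Returns a b α β h x y) :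
    B.ReturnChain h K x y := by
  obtain ⟨i, j, -, hx, hy, ξ₁, s₁, zE, vE, s₂, zI, vI, hs₁, hE, hE0, hvE0, hEout, hEs, hEin, hs₂,
    hI, hI0, hvI0, hIin, hIs, hvIs⟩ := hxy
  have P := B.outerPropagator
  have Q := B.innerPropagator hh
  have hflow := P.eq_flow (T := s₁) hE.hasDeriv (fun s hs => by
    simpa [neg_smul] using hE.equation s hs)
  rw [hE0, hvE0] at hflow
  have hy1 : B.OuterShell 1 y := ⟨hy.2.1, by simpa using hy.2.2⟩
  have hx1 : B.OuterShell (-1) (ξ₁, vE s₁) := ⟨hEin.2.1, by have := hEin.2.2; simp only at *; linarith⟩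
  refine ⟨(ξ₁, vE s₁), ⟨hK i hx.1, hK i hEin.1, by simpa using hx.2.2, by simpa using hEin.2.2,
    s₁, hs₁, ?_, ?_, ?_⟩, _, ⟨hx1, rfl⟩, (y.1, B.refract h y.1 y.2), ⟨hK i hEin.1, hK j hy.1, ?_, ?_, ?_⟩,
    hy1, rfl⟩
  · intro τ hτ
    have h1 := hEout τ hτ
    rwa [(hflow τ ⟨hτ.1.le, hτ.2.le⟩).1] at h1
  · rw [← hEs, (hflow s₁ ⟨hs₁.le, le_rfl⟩).1]
  · exact (hflow s₁ ⟨hs₁.le, le_rfl⟩).2.symm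
  · exact inner_normal_refract hh (Or.inr rfl) hx1
  · have := inner_normal_refract hh (Or.inl rfl) hy1
    simp only at *
    linarith
  · obtain ⟨w₁, hw₁⟩ := exists_sq_eq (zI 0)
    have hz0 : zI 0 ≠ 0 := by rw [hI0]; exact B.γ_ne_zero _
    obtain ⟨τ₁, hτ₁, hτT, hrange, heq⟩ := hI.exists_lc hs₂ hz0 (fun s hs h0 => by
      have := hIin s hs
      rw [h0, hI0] at this
      exact B.γ_notMem _ this) (B.innerκ_pos hh) Q hw₁ rfl
    have hkp : ∀ τ, keplerPath (B.iC h) (B.iS h) (B.γ ξ₁, B.refract h ξ₁ (vE s₁)) τ =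
        flow (B.iC h) (B.iS h) w₁ (vI 0 * (starRingEnd ℂ) w₁ / 2) τ ^ 2 := fun τ => by
      rw [← hvI0]; exact keplerPath_eq_sq (hw₁.trans hI0) τ
    have he : 0 < ‖vI 0 * (starRingEnd ℂ) w₁ / 2‖ ^ 2 - B.innerκ h * ‖w₁‖ ^ 2 := by
      rw [hI.energy_lc hs₂.le hz0 hw₁]
      exact half_pos B.μ_pos
    have hmono := Q.strictMono_lcTime he
    have hτ₁mem : τ₁ ∈ Icc 0 τ₁ := ⟨hτ₁.le, le_rfl⟩
    refine ⟨τ₁, hτ₁, ?_, ?_, ?_⟩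
    · intro τ hτ
      simp only
      rw [hkp, ← heq τ ⟨hτ.1.le, hτ.2.le⟩]
      refine hIin _ ⟨?_, ?_⟩
      · have := hmono hτ.1
        rwa [lcTime_zero] at this
      · rw [← hτT]; exact hmono hτ.2
    · simp only
      rw [hkp, ← heq τ₁ hτ₁mem, hτT, hIs]
    · have hwT : flow (B.iC h) (B.iS h) w₁ (vI 0 * (starRingEnd ℂ) w₁ / 2) τ₁ ≠ 0 := by
        intro h0
        have h1 := heq τ₁ hτ₁mem
        rw [h0, hτT, hIs] at h1
        exact B.γ_ne_zero _ (by simpa using h1)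
      have h1 := hI.velocity_lc Q hτ₁ hrange heq hτ₁mem hwT
      have h2 := keplerVel_mul_conj (κ := B.innerκ h) (hw₁.trans hI0) hwT
      rw [← h1, hτT, hvI0, hvIs] at h2
      simp only
      exact mul_right_cancel₀ (by rw [← hvI0]; simpa using hwT) h2

end RefractionBilliard

namespace RefractionBilliard

/-! ### Differentiability of lengths -/

/-- A local inverse of `f` recovers `T` from `f ∘ T`; continuity of `T` keeps its values on the
right branch. -/
lemma differentiableAt_of_comp {f T : ℝ → ℝ} {f' x : ℝ} (hf : HasStrictDerivAt f f' (T x))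
    (hf' : f' ≠ 0) (hT : ContinuousAt T x) (hfT : DifferentiableAt ℝ (fun y => f (T y)) x) :
    DifferentiableAt ℝ T x := by
  have h1 := hT.eventually (hf.eventually_left_inverse hf')
  have h2 := (hf.to_localInverse hf').hasDerivAt.differentiableAt
  have h3 : DifferentiableAt ℝ (fun y => hf.localInverse f f' (T x) hf' (f (T y))) x :=
    DifferentiableAt.comp x h2 hfT
  exact h3.congr_of_eventuallyEq (h1.mono fun y hy => hy.symm)

/-- The derivative of the length of an arc of energy `e` of a linear flow, joining endpoints with
sum of squared norms `N` and inner product `m` in time `T`. -/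
lemma Propagator.hasDerivAt_length {κ : ℝ} {C S : ℝ → ℝ} (P : Propagator κ C S) (hκ : κ ≠ 0) {e : ℝ}
    (he : e ≠ 0) {N m T : ℝ → ℝ} {N' m' x : ℝ} (hN : HasDerivAt N N' x) (hm : HasDerivAt m m' x)
    (hT : ContinuousAt T x) (heq : ∀ᶠ y in 𝓝 x, N y - 2 * C (T y) * m y = e * S (T y) ^ 2)
    (hS : S (T x) ≠ 0) (hg : e * C (T x) + κ * m x ≠ 0) :
    HasDerivAt (fun y => e * T y / 2 + (C (T y) * N y - 2 * m y) / (2 * S (T y)))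
      ((C (T x) * N' - 2 * m') / (2 * S (T x))) x := by
  have strictC : ∀ t, HasStrictDerivAt C (κ * S t) t := fun t =>
    hasStrictDerivAt_of_hasDerivAt_of_continuousAt (f' := fun t => κ * S t)
      (Eventually.of_forall P.derivC) (P.continuousS.const_mul κ).continuousAt
  have hCT : ContinuousAt (fun y => C (T y)) x := P.continuousC.continuousAt.comp hT
  -- the function `g` with `g ^ 2` differentiable
  have hgd : DifferentiableAt ℝ (fun y => e * C (T y) + κ * m y) x := by
    -- By the time equation and `C ^ 2 - κ S ^ 2 = 1`, the square equals `e ^ 2 + e κ N + κ ^ 2 m ^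
    -- 2`, from which `T` has disappeared. Since `g` does not vanish at `x`, the square root
    -- preserves differentiability.
    have h1 : DifferentiableAt ℝ (fun y => (e * C (T y) + κ * m y) ^ 2) x := by
      have h2 : DifferentiableAt ℝ (fun y => e ^ 2 + e * κ * N y + κ ^ 2 * m y ^ 2) x := by
        have := hN.differentiableAt
        have := hm.differentiableAt
        fun_prop
      refine h2.congr_of_eventuallyEq ?_
      filter_upwards [heq] with y hy
      have h3 := P.sq (T y)
      linear_combination e ^ 2 * h3 - κ * e * hy
    refine differentiableAt_of_comp (f := fun t => t ^ 2)
      (f' := 2 * (e * C (T x) + κ * m x)) ?_ (mul_ne_zero two_ne_zero hg) ?_ h1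
    · have := hasStrictDerivAt_pow 2 (e * C (T x) + κ * m x)
      simpa using this
    · exact (hCT.const_mul e).add (hm.continuousAt.const_mul κ)
  have hCTd : DifferentiableAt ℝ (fun y => C (T y)) x := by
    have h1 : DifferentiableAt ℝ (fun y => ((e * C (T y) + κ * m y) - κ * m y) / e) x := by
      have := hm.differentiableAt
      fun_prop
    refine h1.congr_of_eventuallyEq (Eventually.of_forall fun y => ?_)
    simp only
    field_simp
    ring
  have hTd : DifferentiableAt ℝ T x :=
    differentiableAt_of_comp (strictC (T x)) (mul_ne_zero hκ hS) hT hCTd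
  have dT := hTd.hasDerivAt
  have dC := (P.derivC (T x)).comp x dT
  have dS := (P.derivS (T x)).comp x dT
  have hd := ((dT.const_mul e).div_const 2).add (((dC.mul hN).sub (hm.const_mul 2)).div
    (dS.const_mul 2) (by simpa using hS))
  refine hd.congr_deriv ?_
  -- The terms with the derivative of `T` cancel by the time equation: the length is stationary in
  -- the duration, and only the endpoints contribute.
  have h0 := heq.self_of_nhds
  have h3 := P.sq (T x)
  simp only [Function.comp_apply, Pi.sub_apply, Pi.mul_apply]
  field_simp
  linear_combination (-deriv T x) * h0 + (-deriv T x * N x) * h3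

/-! ### Curves in a circle -/

/-- Along a continuous injective curve in a circle, increments point to both sides. -/
lemma exists_filter_of_circle {q : ℝ → ℂ} {c d η₀ r : ℝ} (hη₀ : η₀ ∈ Ioo c d)
    (hq : ContinuousOn q (Ioo c d)) (hinj : InjOn q (Ioo c d)) (hr : 0 < r)
    (hnorm : ∀ η ∈ Ioo c d, ‖q η‖ = r) {n : ℂ} (hn : inner ℝ n (Complex.I * q η₀) ≠ 0) :
    ∃ F : Filter ℝ, F.NeBot ∧ F ≤ 𝓝 η₀ ∧ ∃ (τ : ℝ → ℝ) (w : ℝ → ℂ) (w₀ : ℂ),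
      Tendsto τ F (𝓝[>] 0) ∧ Tendsto w F (𝓝 w₀) ∧ inner ℝ n w₀ < 0 ∧
      ∀ᶠ η in F, q η = q η₀ + τ η • w η := by
  -- Normalization to the unit circle, based at `1`. In the right half-plane a point of the circle
  -- is determined by its imaginary part, which is therefore injective, hence monotone, along the
  -- curve.
  set u : ℝ → ℂ := fun η => q η / q η₀ with hu
  have hq0 : q η₀ ≠ 0 := by
    rw [← norm_ne_zero_iff, hnorm η₀ hη₀]; exact hr.ne'
  have huc : ContinuousOn u (Ioo c d) := hq.div_const _
  have hu1 : ∀ η ∈ Ioo c d, ‖u η‖ = 1 := fun η hη => by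
    rw [hu]; simp only [norm_div, hnorm η hη, hnorm η₀ hη₀]; field_simp
  have hu0 : u η₀ = 1 := div_self hq0
  have hcont : ContinuousAt u η₀ := huc.continuousAt (Ioo_mem_nhds hη₀.1 hη₀.2)
  have hre : ∀ᶠ η in 𝓝 η₀, 0 < (u η).re := by
    have h1 : ContinuousAt (fun η => (u η).re) η₀ := Complex.continuous_re.continuousAt.comp hcont
    exact h1.eventually (lt_mem_nhds (by simp only [hu0]; norm_num))
  obtain ⟨c', d', hη', hsub⟩ := mem_nhds_iff_exists_Ioo_subset.1
    (inter_mem hre (Ioo_mem_nhds hη₀.1 hη₀.2))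
  have hc'd' : c' < d' := hη'.1.trans hη'.2
  have hsq : ∀ η ∈ Ioo c d, (u η).re ^ 2 + (u η).im ^ 2 = 1 := fun η hη => by
    have := Complex.sq_norm (u η)
    rw [hu1 η hη, Complex.normSq_apply] at this
    linarith
  have hmono := ContinuousOn.strictMonoOn_of_injOn_Ioo (f := fun η => (u η).im) hc'd'
    (Complex.continuous_im.comp_continuousOn (huc.mono fun η hη => (hsub hη).2)) (by
      intro x hx y hy hxy
      have hx1 := hsq x (hsub hx).2
      have hy1 := hsq y (hsub hy).2
      have hx2 : 0 < (u x).re := (hsub hx).1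
      have hy2 : 0 < (u y).re := (hsub hy).1
      simp only at hxy
      have h1 : (u x).re = (u y).re := by
        rw [hxy] at hx1
        nlinarith
      have h2 : u x = u y := Complex.ext h1 hxy
      refine hinj (hsub hx).2 (hsub hy).2 ?_
      simp only [hu] at h2
      field_simp at h2
      exact h2)
  have him0 : (u η₀).im = 0 := by rw [hu0]; simp
  -- both signs occur
  have hfreq : ∀ ε : ℝ, ε = 1 ∨ ε = -1 → ∃ᶠ η in 𝓝 η₀, 0 < ε * (u η).im := by
    have hr : ∃ᶠ η in 𝓝 η₀, η ∈ Ioo η₀ d' := by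
      have h1 : ∀ᶠ η in 𝓝[>] η₀, η ∈ Ioo η₀ d' := Ioo_mem_nhdsGT hη'.2
      exact h1.frequently.filter_mono nhdsWithin_le_nhds
    have hl : ∃ᶠ η in 𝓝 η₀, η ∈ Ioo c' η₀ := by
      have h1 : ∀ᶠ η in 𝓝[<] η₀, η ∈ Ioo c' η₀ := Ioo_mem_nhdsLT hη'.1
      exact h1.frequently.filter_mono nhdsWithin_le_nhds
    rintro ε (rfl | rfl) <;> rcases hmono with h | h
    · refine hr.mono fun η hη => ?_
      have := h hη' ⟨hη'.1.trans hη.1, hη.2⟩ hη.1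
      simp only [him0] at this; linarith
    · refine hl.mono fun η hη => ?_
      have := h ⟨hη.1, hη.2.trans hη'.2⟩ hη' hη.2
      simp only [him0] at this; linarith
    · refine hl.mono fun η hη => ?_
      have := h ⟨hη.1, hη.2.trans hη'.2⟩ hη' hη.2
      simp only [him0] at this; linarith
    · refine hr.mono fun η hη => ?_
      have := h hη' ⟨hη'.1.trans hη.1, hη.2⟩ hη.1
      simp only [him0] at this; linarith
  -- `ε` is the sense of rotation along which the tangent direction of the circle has negative
  -- component on `n`.
  obtain ⟨ε, hε, hεn⟩ : ∃ ε : ℝ, (ε = 1 ∨ ε = -1) ∧ ε * inner ℝ n (Complex.I * q η₀) < 0 := by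
    rcases lt_or_gt_of_ne hn with h | h
    · exact ⟨1, Or.inl rfl, by linarith⟩
    · exact ⟨-1, Or.inr rfl, by linarith⟩
  have hε2 : ε * ε = 1 := by rcases hε with rfl | rfl <;> norm_num
  set F : Filter ℝ := 𝓝 η₀ ⊓ 𝓟 {η | 0 < ε * (u η).im} with hF
  have hFle : F ≤ 𝓝 η₀ := inf_le_left
  have hFpos : ∀ᶠ η in F, 0 < ε * (u η).im :=
    (inf_le_right : F ≤ _) (mem_principal_self _)
  have hlim : Tendsto u F (𝓝 1) := by
    have := hcont.tendsto.mono_left hFle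
    rwa [hu0] at this
  -- On the unit circle `u - 1 = i Im u - (Im u) ^ 2 / (1 + Re u)`. Dividing by `τ = ε Im u` gives
  -- the direction `w`, with limit `ε i q η₀`.
  refine ⟨F, frequently_mem_iff_neBot.1 (hfreq ε hε), hFle, fun η => ε * (u η).im,
    fun η => q η₀ * (((-(ε * (u η).im) / (1 + (u η).re) : ℝ) : ℂ) + Complex.I * ε),
    q η₀ * (((-(ε * 0) / (1 + 1) : ℝ) : ℂ) + Complex.I * ε), ?_, ?_, ?_, ?_⟩
  · refine tendsto_nhdsWithin_iff.2 ⟨?_, hFpos⟩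
    have h1 := ((Complex.continuous_im.tendsto 1).comp hlim).const_mul ε
    simpa using h1
  · have h1 := ((Complex.continuous_im.tendsto 1).comp hlim).const_mul ε
    have h2 := ((Complex.continuous_re.tendsto 1).comp hlim).const_add 1
    have h3 := (h1.neg.div h2 (by norm_num))
    have h4 := (Complex.continuous_ofReal.tendsto _).comp h3
    have h5 := (h4.add_const (Complex.I * ε)).const_mul (q η₀)
    simpa using h5
  · have h1 : q η₀ * (((-(ε * 0) / (1 + 1) : ℝ) : ℂ) + Complex.I * ε) =
        ε • (Complex.I * q η₀) := by
      rw [Complex.real_smul]; push_cast; ring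
    rw [h1, inner_smul_right]
    exact hεn
  · filter_upwards [hFpos, hFle hre, hFle (Ioo_mem_nhds hη₀.1 hη₀.2)] with η h1 h2 h3
    have h4 : q η = q η₀ * u η := by simp only [hu]; field_simp
    have h5 : u η = ((u η).re : ℂ) + (u η).im * Complex.I := (Complex.re_add_im _).symm
    have h6 := hsq η h3
    have h7 : (1 : ℝ) + (u η).re ≠ 0 := by
      have h2' : 0 < (u η).re := h2
      linarith
    have h8 : ε * (u η).im * (-(ε * (u η).im) / (1 + (u η).re)) = (u η).re - 1 := by
      field_simp
      linear_combination (-(u η).im ^ 2) * hε2 - h6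
    have h9 : ε * (u η).im * ε = (u η).im := by linear_combination (u η).im * hε2
    rw [h4, Complex.real_smul]
    have h8' : (ε : ℂ) * (u η).im * ((-(ε * (u η).im) / (1 + (u η).re) : ℝ) : ℂ) =
        (u η).re - 1 := by exact_mod_cast h8
    have h9' : (ε : ℂ) * (u η).im * ε = (u η).im := by exact_mod_cast h9
    push_cast at h8' ⊢
    linear_combination q η₀ * h5 - q η₀ * h8' - q η₀ * Complex.I * h9'

end RefractionBilliard

namespace RefractionBilliard

/-! ### Chains of equations with a twist condition -/

/-- By monotonicity, over each `u` there is at most one zero `y`. Let `t'` be the first zero of `g ·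
α`, and `s'` the last zero of `g · β` before it. Between them `g u α ≤ 0 ≤ g u β`, so the zeros form
a graph crossing the rectangle from the top edge to the bottom edge. -/
lemma exists_crossing_path {s t α β : ℝ} (hst : s ≤ t) (hαβ : α ≤ β) {g : ℝ → ℝ → ℝ}
    (hg : ContinuousOn (fun x : ℝ × ℝ => g x.1 x.2) (Icc s t ×ˢ Icc α β))
    (hs : ∀ y ∈ Icc α β, g s y < 0) (ht : ∀ y ∈ Icc α β, 0 < g t y)
    (hmono : ∀ u ∈ Icc s t, StrictMonoOn (g u) (Icc α β)) :
    ∃ s' t', s ≤ s' ∧ s' ≤ t' ∧ t' ≤ t ∧ ∃ Y : ℝ → ℝ, ContinuousOn Y (Icc s' t') ∧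
      (∀ u ∈ Icc s' t', Y u ∈ Icc α β ∧ g u (Y u) = 0) ∧ Y s' = β ∧ Y t' = α := by
  have hα : α ∈ Icc α β := ⟨le_rfl, hαβ⟩
  have hβ : β ∈ Icc α β := ⟨hαβ, le_rfl⟩
  have hgy : ∀ y ∈ Icc α β, ContinuousOn (fun u => g u y) (Icc s t) := fun y hy =>
    hg.comp (f := fun u : ℝ => (u, y)) (by fun_prop) fun u hu => ⟨hu, hy⟩
  have hgu : ∀ u ∈ Icc s t, ContinuousOn (g u) (Icc α β) := fun u hu =>
    hg.comp (f := fun y : ℝ => (u, y)) (by fun_prop) fun y hy => ⟨hu, hy⟩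
  -- first zero of `g · α`
  have hZ1 : IsCompact (Icc s t ∩ (fun u => g u α) ⁻¹' Ici 0) :=
    isCompact_Icc.of_isClosed_subset
      ((hgy α hα).preimage_isClosed_of_isClosed isClosed_Icc isClosed_Ici) inter_subset_left
  obtain ⟨t', ⟨ht'I, ht'0⟩, ht'min⟩ := hZ1.exists_isLeast ⟨t, ⟨hst, le_rfl⟩, (ht α hα).le⟩
  have ht'0 : 0 ≤ g t' α := ht'0
  have hneg : ∀ u ∈ Ico s t', g u α < 0 := fun u hu => by
    by_contra hc
    push Not at hc
    exact absurd (ht'min ⟨⟨hu.1, hu.2.le.trans ht'I.2⟩, hc⟩) (not_le.2 hu.2)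
  have hst' : s < t' := by
    rcases ht'I.1.lt_or_eq with h | h
    · exact h
    · rw [← h] at ht'0; linarith [hs α hα]
  have ht'eq : g t' α = 0 := by
    refine le_antisymm ?_ ht'0
    have h1 : Tendsto (fun u => g u α) (𝓝[Ico s t'] t') (𝓝 (g t' α)) :=
      ((hgy α hα) t' ht'I).mono fun u hu => ⟨hu.1, hu.2.le.trans ht'I.2⟩
    have : (𝓝[Ico s t'] t').NeBot := by
      rw [← mem_closure_iff_nhdsWithin_neBot, closure_Ico hst'.ne]
      exact ⟨hst'.le, le_rfl⟩
    exact le_of_tendsto h1 (eventually_mem_nhdsWithin.mono fun u hu => (hneg u hu).le)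
  -- last zero of `g · β`
  have hsub : Icc s t' ⊆ Icc s t := Icc_subset_Icc_right ht'I.2
  have hZ2 : IsCompact (Icc s t' ∩ (fun u => g u β) ⁻¹' Iic 0) :=
    isCompact_Icc.of_isClosed_subset
      (((hgy β hβ).mono hsub).preimage_isClosed_of_isClosed isClosed_Icc isClosed_Iic)
      inter_subset_left
  obtain ⟨s', ⟨hs'I, hs'0⟩, hs'max⟩ := hZ2.exists_isGreatest ⟨s, ⟨le_rfl, hst'.le⟩, (hs β hβ).le⟩
  have hs'0 : g s' β ≤ 0 := hs'0
  have hpos : ∀ u ∈ Ioc s' t', 0 < g u β := fun u hu => by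
    by_contra hc
    push Not at hc
    exact absurd (hs'max ⟨⟨hs'I.1.trans hu.1.le, hu.2⟩, hc⟩) (not_le.2 hu.1)
  have hs'eq : g s' β = 0 := by
    refine le_antisymm hs'0 ?_
    rcases hs'I.2.lt_or_eq with hlt | heq
    · have h1 : Tendsto (fun u => g u β) (𝓝[Ioc s' t'] s') (𝓝 (g s' β)) :=
        ((hgy β hβ) s' (hsub hs'I)).mono fun u hu => hsub ⟨hs'I.1.trans hu.1.le, hu.2⟩
      have : (𝓝[Ioc s' t'] s').NeBot := by
        rw [← mem_closure_iff_nhdsWithin_neBot, closure_Ioc hlt.ne]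
        exact ⟨le_rfl, hlt.le⟩
      exact ge_of_tendsto h1 (eventually_mem_nhdsWithin.mono fun u hu => (hpos u hu).le)
    · rw [heq, ← ht'eq]
      exact (hmono t' ht'I).monotoneOn hα hβ hαβ
  have hsub' : Icc s' t' ⊆ Icc s t := fun u hu => hsub ⟨hs'I.1.trans hu.1, hu.2⟩
  -- the implicit function
  have hex : ∀ u ∈ Icc s' t', ∃ y ∈ Icc α β, g u y = 0 := by
    intro u hu
    have h1 : g u α ≤ 0 := by
      rcases hu.2.lt_or_eq with h | h
      · exact (hneg u ⟨hs'I.1.trans hu.1, h⟩).le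
      · rw [h, ht'eq]
    have h2 : 0 ≤ g u β := by
      rcases hu.1.lt_or_eq with h | h
      · exact (hpos u ⟨h, hu.2⟩).le
      · rw [← h, hs'eq]
    exact intermediate_value_Icc hαβ (hgu u (hsub' hu)) ⟨h1, h2⟩
  choose! Y hY hY0 using hex
  have huniq : ∀ u ∈ Icc s' t', ∀ y ∈ Icc α β, g u y = 0 → y = Y u := fun u hu y hy h0 =>
    (hmono u (hsub' hu)).injOn hy (hY u hu) (h0.trans (hY0 u hu).symm)
  refine ⟨s', t', hs'I.1, hs'I.2, ht'I.2, Y, ?_, fun u hu => ⟨hY u hu, hY0 u hu⟩,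
    (huniq s' ⟨le_rfl, hs'I.2⟩ β hβ hs'eq).symm, (huniq t' ⟨hs'I.2, le_rfl⟩ α hα ht'eq).symm⟩
  -- Closed graph: every ultrafilter limit of values of `Y` is a zero of `g u`, hence equals `Y u`.
  intro u hu
  rw [ContinuousWithinAt, tendsto_iff_ultrafilter]
  intro F hF
  have hFmem : Icc s' t' ∈ F := hF self_mem_nhdsWithin
  have hFu : (F : Filter ℝ) ≤ 𝓝 u := hF.trans nhdsWithin_le_nhds
  obtain ⟨y, hy, hlim⟩ := isCompact_Icc.ultrafilter_le_nhds (F.map Y)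
    (by
      rw [le_principal_iff, Ultrafilter.mem_coe, Ultrafilter.mem_map]
      exact mem_of_superset hFmem fun u hu => hY u hu)
  have hlim' : Tendsto Y F (𝓝 y) := hlim
  have h1 : Tendsto (fun v => (v, Y v)) F (𝓝[Icc s t ×ˢ Icc α β] (u, y)) := by
    refine tendsto_nhdsWithin_iff.2 ⟨?_, ?_⟩
    · rw [nhds_prod_eq]
      exact Tendsto.prodMk hFu hlim'
    · exact mem_of_superset hFmem fun v hv => ⟨hsub' hv, hY v hv⟩
  have h2 := (hg (u, y) ⟨hsub' hu, hy⟩).tendsto.comp h1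
  have h3 : ((fun x : ℝ × ℝ => g x.1 x.2) ∘ fun v => (v, Y v)) =ᶠ[F] fun _ => 0 :=
    mem_of_superset hFmem fun v hv => hY0 v hv
  have h4 := tendsto_nhds_unique (h2.congr' h3) tendsto_const_nhds
  rw [← huniq u hu y hy h4]
  exact hlim'

/-- Changing the sign of `g` and reflecting `y ↦ α + β - y` reduce all cases to one. Only the fact
that `Y` joins the two ends of its interval matters, not the direction. -/
lemma exists_crossing_path' {s t α β : ℝ} (hst : s ≤ t) (hαβ : α ≤ β) {g : ℝ → ℝ → ℝ}
    (hg : ContinuousOn (fun x : ℝ × ℝ => g x.1 x.2) (Icc s t ×ˢ Icc α β))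
    (hst0 : ((∀ y ∈ Icc α β, g s y < 0) ∧ ∀ y ∈ Icc α β, 0 < g t y) ∨
      ((∀ y ∈ Icc α β, 0 < g s y) ∧ ∀ y ∈ Icc α β, g t y < 0))
    (hmono : (∀ u ∈ Icc s t, StrictMonoOn (g u) (Icc α β)) ∨
      ∀ u ∈ Icc s t, StrictAntiOn (g u) (Icc α β)) :
    ∃ s' t', s ≤ s' ∧ s' ≤ t' ∧ t' ≤ t ∧ ∃ Y : ℝ → ℝ, ContinuousOn Y (Icc s' t') ∧
      (∀ u ∈ Icc s' t', Y u ∈ Icc α β ∧ g u (Y u) = 0) ∧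
      (Y s' = α ∧ Y t' = β ∨ Y s' = β ∧ Y t' = α) := by
  wlog hsign : (∀ y ∈ Icc α β, g s y < 0) ∧ ∀ y ∈ Icc α β, 0 < g t y generalizing g with H
  · have h1 := hst0.resolve_left hsign
    obtain ⟨s', t', h2, h3, h4, Y, h5, h6, h7⟩ := H (g := fun u y => -g u y) hg.neg
      (Or.inl ⟨fun y hy => neg_neg_of_pos (h1.1 y hy), fun y hy => neg_pos_of_neg (h1.2 y hy)⟩)
      (hmono.symm.imp (fun h u hu => (h u hu).neg) (fun h u hu => (h u hu).neg))
      ⟨fun y hy => neg_neg_of_pos (h1.1 y hy), fun y hy => neg_pos_of_neg (h1.2 y hy)⟩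
    exact ⟨s', t', h2, h3, h4, Y, h5, fun u hu => ⟨(h6 u hu).1, neg_eq_zero.1 (h6 u hu).2⟩, h7⟩
  rcases hmono with hmono | hmono
  · obtain ⟨s', t', h2, h3, h4, Y, h5, h6, h7⟩ :=
      exists_crossing_path hst hαβ hg hsign.1 hsign.2 hmono
    exact ⟨s', t', h2, h3, h4, Y, h5, h6, Or.inr h7⟩
  · have hr : ∀ y ∈ Icc α β, α + β - y ∈ Icc α β := fun y hy =>
      ⟨by linarith [hy.2], by linarith [hy.1]⟩
    obtain ⟨s', t', h2, h3, h4, Y, h5, h6, h7⟩ :=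
      exists_crossing_path (g := fun u y => g u (α + β - y)) hst hαβ
        (hg.comp (f := fun x : ℝ × ℝ => (x.1, α + β - x.2)) (by fun_prop)
          fun x hx => ⟨hx.1, hr _ hx.2⟩)
        (fun y hy => hsign.1 _ (hr y hy)) (fun y hy => hsign.2 _ (hr y hy))
        (fun u hu x hx y hy hxy => hmono u hu (hr y hy) (hr x hx) (by linarith))
    refine ⟨s', t', h2, h3, h4, fun u => α + β - Y u, continuousOn_const.sub h5,
      fun u hu => ⟨hr _ (h6 u hu).1, (h6 u hu).2⟩, Or.inl ⟨?_, ?_⟩⟩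
    · simp only [h7.1]; ring
    · simp only [h7.2]; ring

/-- A continuous function of two variables which is injective in the second one is monotone in the
second variable, always in the same direction. -/
lemma strictMono_or_strictAnti {s t α β : ℝ} (hαβ : α < β) {f : ℝ → ℝ → ℝ}
    (hf : ContinuousOn (fun x : ℝ × ℝ => f x.1 x.2) (Icc s t ×ˢ Icc α β))
    (hinj : ∀ u ∈ Icc s t, InjOn (f u) (Icc α β)) :
    (∀ u ∈ Icc s t, StrictMonoOn (f u) (Icc α β)) ∨
      ∀ u ∈ Icc s t, StrictAntiOn (f u) (Icc α β) := by
  have hα : α ∈ Icc α β := ⟨le_rfl, hαβ.le⟩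
  have hβ : β ∈ Icc α β := ⟨hαβ.le, le_rfl⟩
  have hfy : ∀ y ∈ Icc α β, ContinuousOn (fun u => f u y) (Icc s t) := fun y hy =>
    hf.comp (f := fun u : ℝ => (u, y)) (by fun_prop) fun u hu => ⟨hu, hy⟩
  have hfu : ∀ u ∈ Icc s t, ContinuousOn (f u) (Icc α β) := fun u hu =>
    hf.comp (f := fun y : ℝ => (u, y)) (by fun_prop) fun y hy => ⟨hu, hy⟩
  have hd : ContinuousOn (fun u => f u β - f u α) (Icc s t) := (hfy β hβ).sub (hfy α hα)
  have hne : ∀ u ∈ Icc s t, f u β - f u α ≠ 0 := fun u hu h0 =>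
    hαβ.ne ((hinj u hu) hα hβ (by linarith))
  have hcase : (∀ u ∈ Icc s t, 0 < f u β - f u α) ∨ ∀ u ∈ Icc s t, f u β - f u α < 0 := by
    by_contra hc
    push Not at hc
    obtain ⟨⟨u, hu, hu0⟩, v, hv, hv0⟩ := hc
    obtain ⟨w, hw, hw0⟩ := isPreconnected_Icc.intermediate_value hu hv hd ⟨hu0, hv0⟩
    exact hne w hw hw0
  refine hcase.imp (fun h u hu => ?_) (fun h u hu => ?_)
  · exact (hfu u hu).strictMonoOn_of_injOn_Icc hαβ.le (by linarith [h u hu]) (hinj u hu)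
  · exact (hfu u hu).strictAntiOn_of_injOn_Icc hαβ.le (by linarith [h u hu]) (hinj u hu)

/-- Finite chains: the incoming term `f k`, evaluated at the variables `k` and `k + 1`, balances the
outgoing term `g (k + 1)`, evaluated at the variables `k + 1` and `k + 2`. -/
lemma exists_finite_chain {α β : ℕ → ℝ} (hαβ : ∀ k, α k < β k) {f g : ℕ → ℝ → ℝ → ℝ}
    (hf : ∀ k, ContinuousOn (fun x : ℝ × ℝ => f k x.1 x.2)
      (Icc (α k) (β k) ×ˢ Icc (α (k + 1)) (β (k + 1))))
    (hg : ∀ k, ContinuousOn (fun x : ℝ × ℝ => g k x.1 x.2)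
      (Icc (α k) (β k) ×ˢ Icc (α (k + 1)) (β (k + 1))))
    (hinj : ∀ k, ∀ x ∈ Icc (α k) (β k), InjOn (g k x) (Icc (α (k + 1)) (β (k + 1))))
    (hsign : ∀ k, ∀ x ∈ Icc (α k) (β k), ∀ y ∈ Icc (α (k + 2)) (β (k + 2)),
      (f k x (α (k + 1)) + g (k + 1) (α (k + 1)) y) *
        (f k x (β (k + 1)) + g (k + 1) (β (k + 1)) y) < 0) (n : ℕ) :
    ∃ x : ℕ → ℝ, (∀ k, x k ∈ Icc (α k) (β k)) ∧
      ∀ k < n, f k (x k) (x (k + 1)) + g (k + 1) (x (k + 1)) (x (k + 2)) = 0 := by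
  -- Shooting: the induction carries a whole path of solutions of the first `n` equations, whose
  -- variable `n + 1` runs from one end of its interval to the other. The sign condition then makes
  -- the next equation change sign along the path, for every value of the next variable.
  suffices H : ∃ s t : ℝ, s ≤ t ∧ ∃ X : ℕ → ℝ → ℝ, (∀ k, ContinuousOn (X k) (Icc s t)) ∧
      (∀ k, ∀ u ∈ Icc s t, X k u ∈ Icc (α k) (β k)) ∧
      (∀ k < n, ∀ u ∈ Icc s t,
        f k (X k u) (X (k + 1) u) + g (k + 1) (X (k + 1) u) (X (k + 2) u) = 0) ∧
      (X (n + 1) s = α (n + 1) ∧ X (n + 1) t = β (n + 1) ∨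
        X (n + 1) s = β (n + 1) ∧ X (n + 1) t = α (n + 1)) by
    obtain ⟨s, t, hst, X, -, h2, h3, -⟩ := H
    exact ⟨fun k => X k s, fun k => h2 k s ⟨le_rfl, hst⟩, fun k hk => h3 k hk s ⟨le_rfl, hst⟩⟩
  induction n with
  | zero =>
    -- With no equation to satisfy, variable `1` itself is the parameter and the other variables are
    -- frozen.
    refine ⟨α 1, β 1, (hαβ 1).le, Function.update (fun k _ => α k) 1 id, ?_, ?_, by simp, ?_⟩
    · intro k
      rcases eq_or_ne k 1 with rfl | h
      · simpa using continuousOn_id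
      · simpa [h] using continuousOn_const
    · intro k u hu
      rcases eq_or_ne k 1 with rfl | h
      · simpa using hu
      · simpa [h] using (hαβ k).le
    · left; simp
  | succ n ih =>
    obtain ⟨s, t, hst, X, hXc, hXI, hXeq, hXend⟩ := ih
    set φ : ℝ → ℝ → ℝ := fun u y => f n (X n u) (X (n + 1) u) + g (n + 1) (X (n + 1) u) y with hφ
    have hφg : ContinuousOn (fun x : ℝ × ℝ => g (n + 1) (X (n + 1) x.1) x.2)
        (Icc s t ×ˢ Icc (α (n + 2)) (β (n + 2))) := by
      refine (hg (n + 1)).comp (f := fun x : ℝ × ℝ => (X (n + 1) x.1, x.2)) ?_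
        fun x hx => ⟨hXI _ _ hx.1, hx.2⟩
      exact ((hXc _).comp continuousOn_fst fun x hx => hx.1).prodMk continuousOn_snd
    have hφc : ContinuousOn (fun x : ℝ × ℝ => φ x.1 x.2)
        (Icc s t ×ˢ Icc (α (n + 2)) (β (n + 2))) := by
      refine ContinuousOn.add ?_ hφg
      refine (hf n).comp (f := fun x : ℝ × ℝ => (X n x.1, X (n + 1) x.1)) ?_
        fun x hx => ⟨hXI _ _ hx.1, hXI _ _ hx.1⟩
      exact ((hXc _).comp continuousOn_fst fun x hx => hx.1).prodMk
        ((hXc _).comp continuousOn_fst fun x hx => hx.1)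
    have hmono := strictMono_or_strictAnti (hαβ (n + 2)) hφg
      fun u hu => hinj (n + 1) _ (hXI _ u hu)
    have hmono' : (∀ u ∈ Icc s t, StrictMonoOn (φ u) (Icc (α (n + 2)) (β (n + 2)))) ∨
        ∀ u ∈ Icc s t, StrictAntiOn (φ u) (Icc (α (n + 2)) (β (n + 2))) := by
      refine hmono.imp (fun h u hu x hx y hy hxy => ?_) (fun h u hu x hx y hy hxy => ?_)
      · exact add_lt_add_right (h u hu hx hy hxy) _
      · exact add_lt_add_right (h u hu hx hy hxy) _
    -- the signs at the two ends do not depend on the other variables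
    set Q := Icc (α n) (β n) ×ˢ Icc (α (n + 2)) (β (n + 2)) with hQ
    have hQc : IsPreconnected Q := isPreconnected_Icc.prod isPreconnected_Icc
    have hα1 : α (n + 1) ∈ Icc (α (n + 1)) (β (n + 1)) := ⟨le_rfl, (hαβ _).le⟩
    have hβ1 : β (n + 1) ∈ Icc (α (n + 1)) (β (n + 1)) := ⟨(hαβ _).le, le_rfl⟩
    have hcont : ∀ z ∈ Icc (α (n + 1)) (β (n + 1)),
        ContinuousOn (fun x : ℝ × ℝ => f n x.1 z + g (n + 1) z x.2) Q := fun z hz => by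
      refine ContinuousOn.add ?_ ?_
      · exact (hf n).comp (f := fun x : ℝ × ℝ => (x.1, z)) (by fun_prop) fun x hx => ⟨hx.1, hz⟩
      · exact (hg (n + 1)).comp (f := fun x : ℝ × ℝ => (z, x.2)) (by fun_prop)
          fun x hx => ⟨hz, hx.2⟩
    have hsignQ : ∀ z ∈ Icc (α (n + 1)) (β (n + 1)),
        (∀ x ∈ Q, f n x.1 z + g (n + 1) z x.2 ≠ 0) →
        (∀ x ∈ Q, 0 < f n x.1 z + g (n + 1) z x.2) ∨ ∀ x ∈ Q, f n x.1 z + g (n + 1) z x.2 < 0 := by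
      intro z hz hne
      by_contra hc
      push Not at hc
      obtain ⟨⟨u, hu, hu0⟩, v, hv, hv0⟩ := hc
      obtain ⟨w, hw, hw0⟩ := hQc.intermediate_value hu hv (hcont z hz) ⟨hu0, hv0⟩
      exact hne w hw hw0
    have hprod := fun x (hx : x ∈ Q) => hsign n x.1 hx.1 x.2 hx.2
    have hsα := hsignQ _ hα1 fun x hx h0 => by have := hprod x hx; rw [h0] at this; simp at this
    have hx0 : (α n, α (n + 2)) ∈ Q := ⟨⟨le_rfl, (hαβ _).le⟩, ⟨le_rfl, (hαβ _).le⟩⟩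
    have hends : ((∀ x ∈ Q, f n x.1 (α (n + 1)) + g (n + 1) (α (n + 1)) x.2 < 0) ∧
          ∀ x ∈ Q, 0 < f n x.1 (β (n + 1)) + g (n + 1) (β (n + 1)) x.2) ∨
        ((∀ x ∈ Q, 0 < f n x.1 (α (n + 1)) + g (n + 1) (α (n + 1)) x.2) ∧
          ∀ x ∈ Q, f n x.1 (β (n + 1)) + g (n + 1) (β (n + 1)) x.2 < 0) := by
      rcases hsα with h | h
      · right
        refine ⟨h, fun x hx => ?_⟩
        have h1 := h x hx
        have h2 := hprod x hx
        by_contra hc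
        push Not at hc
        exact absurd h2 (not_lt.2 (mul_nonneg h1.le hc))
      · left
        refine ⟨h, fun x hx => ?_⟩
        have h1 := h x hx
        have h2 := hprod x hx
        by_contra hc
        push Not at hc
        exact absurd h2 (not_lt.2 (mul_nonneg_of_nonpos_of_nonpos h1.le hc))
    have hsI : s ∈ Icc s t := ⟨le_rfl, hst⟩
    have htI : t ∈ Icc s t := ⟨hst, le_rfl⟩
    have hφends : ((∀ y ∈ Icc (α (n + 2)) (β (n + 2)), φ s y < 0) ∧
          ∀ y ∈ Icc (α (n + 2)) (β (n + 2)), 0 < φ t y) ∨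
        ((∀ y ∈ Icc (α (n + 2)) (β (n + 2)), 0 < φ s y) ∧
          ∀ y ∈ Icc (α (n + 2)) (β (n + 2)), φ t y < 0) := by
      simp only [hφ]
      rcases hXend with ⟨e1, e2⟩ | ⟨e1, e2⟩ <;> rw [e1, e2] <;> rcases hends with ⟨h1, h2⟩ | ⟨h1, h2⟩
      · exact Or.inl ⟨fun y hy => h1 (_, y) ⟨hXI n s hsI, hy⟩, fun y hy => h2 (_, y) ⟨hXI n t htI, hy⟩⟩
      · exact Or.inr ⟨fun y hy => h1 (_, y) ⟨hXI n s hsI, hy⟩, fun y hy => h2 (_, y) ⟨hXI n t htI, hy⟩⟩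
      · exact Or.inr ⟨fun y hy => h2 (_, y) ⟨hXI n s hsI, hy⟩, fun y hy => h1 (_, y) ⟨hXI n t htI, hy⟩⟩
      · exact Or.inl ⟨fun y hy => h2 (_, y) ⟨hXI n s hsI, hy⟩, fun y hy => h1 (_, y) ⟨hXI n t htI, hy⟩⟩
    obtain ⟨s', t', hs, hs't', ht, Y, hYc, hY, hYend⟩ :=
      -- The twist condition lets variable `n + 2` be solved for continuously on a subinterval of
      -- the parameter, where it sweeps its own interval.
      exists_crossing_path' hst (hαβ (n + 2)).le hφc hφends hmono'
    have hsub : Icc s' t' ⊆ Icc s t := Icc_subset_Icc hs ht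
    refine ⟨s', t', hs't', Function.update X (n + 2) Y, ?_, ?_, ?_, ?_⟩
    · intro k
      rcases eq_or_ne k (n + 2) with rfl | h
      · simpa using hYc
      · simpa [h] using (hXc k).mono hsub
    · intro k u hu
      rcases eq_or_ne k (n + 2) with rfl | h
      · simpa using (hY u hu).1
      · simpa [h] using hXI k u (hsub hu)
    · intro k hk u hu
      have h1 : k ≠ n + 2 := by omega
      have h2 : k + 1 ≠ n + 2 := by omega
      rw [Function.update_of_ne h1, Function.update_of_ne h2]
      rcases Nat.lt_succ_iff_lt_or_eq.1 hk with h | rfl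
      · have h3 : k + 2 ≠ n + 2 := by omega
        rw [Function.update_of_ne h3]
        exact hXeq k h u (hsub hu)
      · rw [Function.update_self]
        exact (hY u hu).2
    · rw [show n + 1 + 1 = n + 2 from rfl, Function.update_self]
      exact hYend

/-- Bi-infinite chains, by compactness. -/
lemma exists_chain {α β : ℤ → ℝ} (hαβ : ∀ k, α k < β k) {f g : ℤ → ℝ → ℝ → ℝ}
    (hf : ∀ k, ContinuousOn (fun x : ℝ × ℝ => f k x.1 x.2)
      (Icc (α k) (β k) ×ˢ Icc (α (k + 1)) (β (k + 1))))
    (hg : ∀ k, ContinuousOn (fun x : ℝ × ℝ => g k x.1 x.2)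
      (Icc (α k) (β k) ×ˢ Icc (α (k + 1)) (β (k + 1))))
    (hinj : ∀ k, ∀ x ∈ Icc (α k) (β k), InjOn (g k x) (Icc (α (k + 1)) (β (k + 1))))
    (hsign : ∀ k, ∀ x ∈ Icc (α k) (β k), ∀ y ∈ Icc (α (k + 2)) (β (k + 2)),
      (f k x (α (k + 1)) + g (k + 1) (α (k + 1)) y) *
        (f k x (β (k + 1)) + g (k + 1) (β (k + 1)) y) < 0) :
    ∃ x : ℤ → ℝ, (∀ k, x k ∈ Icc (α k) (β k)) ∧
      ∀ k, f k (x k) (x (k + 1)) + g (k + 1) (x (k + 1)) (x (k + 2)) = 0 := by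
  set Q : Set (ℤ → ℝ) := univ.pi fun k => Icc (α k) (β k) with hQ
  have hQc : IsCompact Q := isCompact_univ_pi fun k => isCompact_Icc
  set G : ℤ → (ℤ → ℝ) → ℝ := fun k x =>
    f k (x k) (x (k + 1)) + g (k + 1) (x (k + 1)) (x (k + 2)) with hG
  have hGc : ∀ k, ContinuousOn (G k) Q := by
    intro k
    refine ContinuousOn.add ?_ ?_
    · exact (hf k).comp (f := fun x : ℤ → ℝ => (x k, x (k + 1))) (by fun_prop)
        fun x hx => ⟨hx k trivial, hx (k + 1) trivial⟩
    · have h1 := hg (k + 1)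
      rw [show k + 1 + 1 = k + 2 by ring] at h1
      exact h1.comp (f := fun x : ℤ → ℝ => (x (k + 1), x (k + 2))) (by fun_prop)
        fun x hx => ⟨hx (k + 1) trivial, hx (k + 2) trivial⟩
  set A : ℕ → Set (ℤ → ℝ) := fun n => {x | x ∈ Q ∧ ∀ k : ℤ, |k| ≤ n → G k x = 0} with hA
  have hAclosed : ∀ n, IsClosed (A n) := by
    intro n
    have h1 : A n = Q ∩ ⋂ k : ℤ, ⋂ _ : |k| ≤ n, (Q ∩ G k ⁻¹' {0}) := by
      ext x
      simp only [hA, mem_inter_iff, mem_iInter, mem_preimage, mem_singleton_iff]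
      constructor
      · exact fun h => ⟨h.1, fun k hk => ⟨h.1, h.2 k hk⟩⟩
      · exact fun h => ⟨h.1, fun k hk => (h.2 k hk).2⟩
    rw [h1]
    refine hQc.isClosed.inter (isClosed_iInter fun k => isClosed_iInter fun _ => ?_)
    exact (hGc k).preimage_isClosed_of_isClosed hQc.isClosed isClosed_singleton
  have hne : ∀ n, (A n).Nonempty := by
    intro n
    have cast : ∀ k : ℕ, (((k + 1 : ℕ) : ℤ) - n) = (k : ℤ) - n + 1 := fun k => by push_cast; ring
    -- Shifting the indices by `n` turns the `2 n + 1` equations with natural index into those with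
    -- `|k| ≤ n`.
    obtain ⟨x, hx, hxe⟩ := exists_finite_chain (α := fun k => α ((k : ℤ) - n))
      (β := fun k => β ((k : ℤ) - n)) (f := fun k => f ((k : ℤ) - n)) (g := fun k => g ((k : ℤ) - n))
      (fun k => hαβ _) (fun k => by simp only [cast]; exact hf _)
      (fun k => by simp only [cast]; exact hg _) (fun k => by simp only [cast]; exact hinj _)
      (fun k => by
        have h := hsign ((k : ℤ) - n)
        rw [show (k : ℤ) - n + 2 = (k : ℤ) - n + 1 + 1 by ring] at h
        simp only [cast]
        exact h) (2 * n + 1)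
    have hcov : ∀ k : ℤ, ((k + n).toNat : ℤ) - n = if 0 ≤ k + n then k else -n := by
      intro k; split_ifs with h <;> omega
    -- The entries before `-n` occur in none of the required equations, so any admissible value will
    -- do.
    refine ⟨fun k => if 0 ≤ k + n then x (k + n).toNat else α k, fun k _ => ?_, fun k hk => ?_⟩
    · simp only
      split_ifs with h
      · have h1 := hx (k + n).toNat
        simp only [hcov, if_pos h] at h1
        exact h1
      · exact ⟨le_rfl, (hαβ k).le⟩
    · rw [abs_le] at hk
      have h0 : 0 ≤ k + n := by omega
      have h1 : 0 ≤ k + 1 + n := by omega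
      have h2 : 0 ≤ k + 2 + n := by omega
      have h3 := hxe (k + n).toNat (by omega)
      simp only [hG, if_pos h0, if_pos h1, if_pos h2]
      simp only [cast, hcov, if_pos h0] at h3
      rw [show (k + 1 + n).toNat = (k + n).toNat + 1 by omega,
        show (k + 2 + n).toNat = (k + n).toNat + 2 by omega]
      exact h3
  obtain ⟨x, hx⟩ := IsCompact.nonempty_iInter_of_sequence_nonempty_isCompact_isClosed A
    (fun n x hx => ⟨hx.1, fun k hk => hx.2 k (hk.trans (by push_cast; omega))⟩) hne
    (hQc.of_isClosed_subset (hAclosed 0) fun x hx => hx.1) hAclosed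
  rw [mem_iInter] at hx
  exact ⟨x, fun k => (hx 0).1 k trivial, fun k => (hx k.natAbs).2 k (by simp)⟩

end RefractionBilliard

namespace RefractionBilliard

/-! ### Algebra of arcs of linear flows -/

lemma smul_flow_start (C S : ℝ → ℝ) (p q : ℂ) (T : ℝ) : S T • q = flow C S p q T - C T • p := by
  simp [flow]

lemma inner_flowVel {κ : ℝ} {C S : ℝ → ℝ} {p q : ℂ} {T e : ℝ} (he : ‖q‖ ^ 2 - κ * ‖p‖ ^ 2 = e) :
    inner ℝ (flowVel κ C S p q T) q = e * C T + κ * inner ℝ p (flow C S p q T) := by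
  rw [← he]
  simp only [Complex.sq_norm, Complex.normSq_apply, flow, flowVel, Complex.inner]
  simp
  ring

namespace Propagator

variable {κ : ℝ} {C S : ℝ → ℝ} (P : Propagator κ C S)

include P

lemma smul_vel_end (p q : ℂ) (T : ℝ) :
    S T • flowVel κ C S p q T = C T • flow C S p q T - p := by
  have h : (C T : ℂ) ^ 2 - κ * S T ^ 2 = 1 := by exact_mod_cast P.sq T
  simp only [flow, flowVel, Complex.real_smul]
  push_cast
  linear_combination (-p) * h

lemma time_equation {p q : ℂ} {T e : ℝ} (he : ‖q‖ ^ 2 - κ * ‖p‖ ^ 2 = e) :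
    ‖p‖ ^ 2 + ‖flow C S p q T‖ ^ 2 - 2 * C T * inner ℝ p (flow C S p q T) = e * S T ^ 2 := by
  have h := P.sq T
  rw [← he]
  simp only [Complex.sq_norm, Complex.normSq_apply, flow, Complex.inner]
  simp
  linear_combination (-(p.re ^ 2 + p.im ^ 2)) * h

/-- The converse of `time_equation`. -/
lemma energy_of_time_equation {p p₂ : ℂ} {T e : ℝ} (hS : S T ≠ 0)
    (h : ‖p‖ ^ 2 + ‖p₂‖ ^ 2 - 2 * C T * inner ℝ p p₂ = e * S T ^ 2) :
    flow C S p ((1 / S T) • (p₂ - C T • p)) T = p₂ ∧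
      ‖(1 / S T) • (p₂ - C T • p)‖ ^ 2 - κ * ‖p‖ ^ 2 = e := by
  have h3 := P.sq T
  constructor
  · simp only [flow]
    rw [smul_smul, mul_one_div_cancel hS]
    simp
  · rw [norm_smul, mul_pow]
    have h4 : ‖p₂ - C T • p‖ ^ 2 = ‖p₂‖ ^ 2 - 2 * C T * inner ℝ p p₂ + C T ^ 2 * ‖p‖ ^ 2 := by
      rw [norm_sub_sq_real, inner_smul_right, norm_smul, mul_pow, Real.norm_eq_abs, sq_abs,
        real_inner_comm]
      ring
    rw [h4, Real.norm_eq_abs, sq_abs]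
    field_simp
    linear_combination h + ‖p‖ ^ 2 * h3

end Propagator

/-! ### Outer arcs -/

variable (B : RefractionBilliard)

/-- The outer motion. -/
abbrev oflow (p q : ℂ) (s : ℝ) : ℂ := flow B.oC B.oS p q s

/-- The velocity of the outer motion. -/
abbrev ovel (p q : ℂ) (s : ℝ) : ℂ := flowVel (-B.ω ^ 2) B.oC B.oS p q s

/-- An outer arc, given by its duration and its initial velocity. -/
structure OArc (ξ₁ ξ₂ T : ℝ) (q : ℂ) : Prop where
  pos : 0 < T
  energy : ‖q‖ ^ 2 - (-B.ω ^ 2) * ‖B.γ ξ₁‖ ^ 2 = 2 * B.E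
  outside : ∀ s ∈ Ioo 0 T, B.oflow (B.γ ξ₁) q s ∉ B.D
  end_eq : B.oflow (B.γ ξ₁) q T = B.γ ξ₂

variable {B}

lemma IsOuterArc.oArc {ξ₁ ξ₂ T : ℝ} {z v : ℝ → ℂ} (h : B.IsOuterArc ξ₁ ξ₂ T z v) :
    B.OArc ξ₁ ξ₂ T (v 0) ∧
      ∀ s ∈ Icc 0 T, z s = B.oflow (B.γ ξ₁) (v 0) s ∧ v s = B.ovel (B.γ ξ₁) (v 0) s := by
  have hflow := B.outerPropagator.eq_flow (T := T) h.solution.hasDeriv (fun s hs => by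
    simpa [neg_smul] using h.solution.equation s hs)
  rw [h.start_eq] at hflow
  refine ⟨⟨h.pos, ?_, ?_, ?_⟩, hflow⟩
  · have := h.solution.conservation 0 ⟨le_rfl, h.pos.le⟩
    rw [h.start_eq, outerPotential] at this
    linarith
  · intro s hs
    have e := (hflow s ⟨hs.1.le, hs.2.le⟩).1
    exact fun hD => h.outside s hs (e ▸ hD)
  · exact (hflow T ⟨h.pos.le, le_rfl⟩).1.symm.trans h.end_eq

lemma OArc.isOuterArc {ξ₁ ξ₂ T : ℝ} {q : ℂ} (h : B.OArc ξ₁ ξ₂ T q) :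
    B.IsOuterArc ξ₁ ξ₂ T (B.oflow (B.γ ξ₁) q) (B.ovel (B.γ ξ₁) q) where
  pos := h.pos
  solution :=
    { hasDeriv := fun s _ => (B.outerPropagator.hasDerivAt_flow _ _ s).hasDerivWithinAt
      equation := fun s _ => by
        have := (B.outerPropagator.hasDerivAt_flowVel (B.γ ξ₁) q s).hasDerivWithinAt (s := Icc 0 T)
        simpa [neg_smul] using this
      conservation := fun s _ => by
        have h1 := B.outerPropagator.energy (B.γ ξ₁) q s
        rw [h.energy] at h1
        simp only [outerPotential]
        linarith }
  outside := h.outside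
  start_eq := B.outerPropagator.flow_zero _ _
  end_eq := h.end_eq

lemma OArc.reverse {ξ₁ ξ₂ T : ℝ} {q : ℂ} (h : B.OArc ξ₁ ξ₂ T q) :
    B.OArc ξ₂ ξ₁ T (-B.ovel (B.γ ξ₁) q T) where
  pos := h.pos
  energy := by
    rw [← h.end_eq, norm_neg, B.outerPropagator.energy, h.energy]
  outside s hs := by
    rw [← h.end_eq, oflow, B.outerPropagator.flow_reverse]
    exact h.outside _ ⟨by linarith [hs.2], by linarith [hs.1]⟩
  end_eq := by
    rw [← h.end_eq, oflow, B.outerPropagator.flow_reverse, sub_self, B.outerPropagator.flow_zero]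

variable (B)

open Classical in
/-- The duration of the outer arc. -/
def oT (ξ₁ ξ₂ : ℝ) : ℝ :=
  if h : ∃ p : ℝ × ℂ, B.OArc ξ₁ ξ₂ p.1 p.2 then (choose h).1 else 0

open Classical in
/-- The initial velocity of the outer arc. -/
def oq (ξ₁ ξ₂ : ℝ) : ℂ :=
  if h : ∃ p : ℝ × ℂ, B.OArc ξ₁ ξ₂ p.1 p.2 then (choose h).2 else 0

/-- An interval of boundary parameters, without antipodal pairs, with the outer-arc property. -/
structure GoodInterval (a b : ℝ) : Prop where
  injOn : InjOn B.γ (Ioo a b)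
  notAntipodal : ∀ ξ₁ ∈ Ioo a b, ∀ ξ₂ ∈ Ioo a b, (0 : ℂ) ∉ segment ℝ (B.γ ξ₁) (B.γ ξ₂)
  arcs : B.OuterArcProperty a b

variable {B}

lemma oC_two_pi (s : ℝ) : B.oC (s + 2 * Real.pi / B.ω) = B.oC s ∧
    B.oS (s + 2 * Real.pi / B.ω) = B.oS s := by
  have := B.ω_pos.ne'
  have h : B.ω * (s + 2 * Real.pi / B.ω) = B.ω * s + 2 * Real.pi := by field_simp
  simp only [oC, oS, h, Real.cos_add_two_pi, Real.sin_add_two_pi, and_self]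

lemma oflow_two_pi (p q : ℂ) (s : ℝ) : B.oflow p q (s + 2 * Real.pi / B.ω) = B.oflow p q s := by
  simp only [oflow, flow, (oC_two_pi s).1, (oC_two_pi s).2]

/-- If `f` avoids `D` and passes through a boundary point, it is tangent to the boundary there. -/
lemma inner_normal_eq_zero_of_notMem {f : ℝ → ℂ} {w₀ : ℂ} {ζ s₀ : ℝ} (hf : HasDerivAt f w₀ s₀)
    (hf0 : f s₀ = B.γ ζ) (hD : ∀ᶠ s in 𝓝 s₀, f s ∉ B.D) : inner ℝ (B.normal ζ) w₀ = 0 := by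
  by_contra hne
  rcases lt_or_gt_of_ne hne with h | h
  · have h1 := eventually_after (B.eventually_cone_mem h) hf hf0
    obtain ⟨s, hs, hs'⟩ := (h1.and (nhdsWithin_le_nhds hD)).exists
    exact hs' hs
  · have hf' : HasDerivAt (fun s => f (s₀ - s)) (-w₀) 0 := by
      have h2 := (show HasDerivAt f w₀ (s₀ - 0) by simpa using hf).comp_const_sub s₀ 0
      exact h2
    have h1 := eventually_after (ζ := ζ) (B.eventually_cone_mem (w₀ := -w₀) (by
      rw [inner_neg_right]; linarith)) hf' (by simpa using hf0)
    have h3 : Tendsto (fun s => s₀ - s) (𝓝[>] 0) (𝓝 s₀) := by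
      have : Continuous fun s : ℝ => s₀ - s := by fun_prop
      have h4 := this.tendsto 0
      rw [sub_zero] at h4
      exact h4.mono_left nhdsWithin_le_nhds
    obtain ⟨s, hs, hs'⟩ := (h1.and (h3.eventually hD)).exists
    exact hs' hs

lemma zero_mem_segment {p : ℂ} {ρ : ℝ} (hρ : ρ ≤ 0) : (0 : ℂ) ∈ segment ℝ p (ρ • p) := by
  have h : 0 < 1 - ρ := by linarith
  refine ⟨-ρ / (1 - ρ), 1 / (1 - ρ), div_nonneg (by linarith) h.le, by positivity, ?_, ?_⟩
  · field_simp; ring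
  · rw [smul_smul, ← add_smul]
    have : -ρ / (1 - ρ) + 1 / (1 - ρ) * ρ = 0 := by field_simp; ring
    rw [this, zero_smul]

namespace GoodInterval

variable {a b : ℝ} (G : B.GoodInterval a b)

include G

lemma spec {ξ₁ ξ₂ : ℝ} (h₁ : ξ₁ ∈ Ioo a b) (h₂ : ξ₂ ∈ Ioo a b) :
    B.OArc ξ₁ ξ₂ (B.oT ξ₁ ξ₂) (B.oq ξ₁ ξ₂) := by
  obtain ⟨T, z, v, hz, -⟩ := G.arcs ξ₁ h₁ ξ₂ h₂
  have h : ∃ p : ℝ × ℂ, B.OArc ξ₁ ξ₂ p.1 p.2 := ⟨(T, v 0), hz.oArc.1⟩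
  rw [oT, oq, dif_pos h, dif_pos h]
  exact Classical.choose_spec h

/-- Arcs with equal positions have equal derivatives at time zero, so uniqueness of the path
includes that of the initial velocity. -/
lemma unique {ξ₁ ξ₂ T T' : ℝ} {q q' : ℂ} (h₁ : ξ₁ ∈ Ioo a b) (h₂ : ξ₂ ∈ Ioo a b)
    (h : B.OArc ξ₁ ξ₂ T q) (h' : B.OArc ξ₁ ξ₂ T' q') : T' = T ∧ q' = q := by
  obtain ⟨T₀, z₀, v₀, hz, huniq⟩ := G.arcs ξ₁ h₁ ξ₂ h₂
  obtain ⟨e1, e2⟩ := huniq _ _ _ h.isOuterArc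
  obtain ⟨e3, e4⟩ := huniq _ _ _ h'.isOuterArc
  refine ⟨e3.trans e1.symm, ?_⟩
  have hT : 0 < T₀ := hz.pos
  have hEq : EqOn (B.oflow (B.γ ξ₁) q') (B.oflow (B.γ ξ₁) q) (Icc 0 T₀) :=
    fun s hs => (e4 hs).trans (e2 hs).symm
  have h0 : (0 : ℝ) ∈ Icc 0 T₀ := ⟨le_rfl, hT.le⟩
  have d1 := (B.outerPropagator.hasDerivAt_flow (B.γ ξ₁) q 0).hasDerivWithinAt (s := Icc 0 T₀)
  have d2 := (B.outerPropagator.hasDerivAt_flow (B.γ ξ₁) q' 0).hasDerivWithinAt (s := Icc 0 T₀)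
  have d3 := d1.congr hEq (hEq h0)
  have := (uniqueDiffOn_Icc hT 0 h0).eq_deriv _ d2 d3
  rwa [B.outerPropagator.flowVel_zero, B.outerPropagator.flowVel_zero] at this

lemma eq_oT {ξ₁ ξ₂ T : ℝ} {q : ℂ} (h₁ : ξ₁ ∈ Ioo a b) (h₂ : ξ₂ ∈ Ioo a b)
    (h : B.OArc ξ₁ ξ₂ T q) : T = B.oT ξ₁ ξ₂ ∧ q = B.oq ξ₁ ξ₂ :=
  G.unique h₁ h₂ (G.spec h₁ h₂) h

lemma symm {ξ₁ ξ₂ : ℝ} (h₁ : ξ₁ ∈ Ioo a b) (h₂ : ξ₂ ∈ Ioo a b) :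
    B.oT ξ₂ ξ₁ = B.oT ξ₁ ξ₂ ∧
      B.oq ξ₂ ξ₁ = -B.ovel (B.γ ξ₁) (B.oq ξ₁ ξ₂) (B.oT ξ₁ ξ₂) := by
  have := G.eq_oT h₂ h₁ (G.spec h₁ h₂).reverse
  exact ⟨this.1.symm, this.2.symm⟩

lemma oT_pos {ξ₁ ξ₂ : ℝ} (h₁ : ξ₁ ∈ Ioo a b) (h₂ : ξ₂ ∈ Ioo a b) : 0 < B.oT ξ₁ ξ₂ :=
  (G.spec h₁ h₂).pos

/-- The outer flow is periodic. An arc longer than a period could be shortened by one, and an arc of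
exactly one period could be run twice; both contradict uniqueness. -/
lemma oT_lt {ξ₁ ξ₂ : ℝ} (h₁ : ξ₁ ∈ Ioo a b) (h₂ : ξ₂ ∈ Ioo a b) :
    B.ω * B.oT ξ₁ ξ₂ < 2 * Real.pi := by
  by_contra hc
  push Not at hc
  have hω := B.ω_pos
  have hA := G.spec h₁ h₂
  set T := B.oT ξ₁ ξ₂ with hT
  set T₀ := 2 * Real.pi / B.ω with hT₀
  have hT₀pos : 0 < T₀ := by have := Real.pi_pos; positivity
  have hle : T₀ ≤ T := by rw [hT₀, div_le_iff₀ hω]; linarith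
  rcases hle.lt_or_eq with hlt | heq
  · have h' : B.OArc ξ₁ ξ₂ (T - T₀) (B.oq ξ₁ ξ₂) :=
      { pos := by linarith
        energy := hA.energy
        outside := fun s hs => hA.outside s ⟨hs.1, by linarith [hs.2]⟩
        end_eq := by
          rw [← oflow_two_pi, ← hT₀, sub_add_cancel]; exact hA.end_eq }
    have := (G.eq_oT h₁ h₂ h').1
    linarith
  · have hend : B.γ ξ₁ = B.γ ξ₂ := by
      have h1 := hA.end_eq
      rw [← heq, hT₀, ← zero_add (2 * Real.pi / B.ω), oflow_two_pi, oflow,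
        B.outerPropagator.flow_zero] at h1
      exact h1
    have h' : B.OArc ξ₁ ξ₂ (T₀ + T₀) (B.oq ξ₁ ξ₂) :=
      { pos := by linarith
        energy := hA.energy
        outside := fun s hs => by
          rcases lt_trichotomy s T₀ with h | h | h
          · exact hA.outside s ⟨hs.1, by linarith⟩
          · rw [h, heq, hA.end_eq]; exact B.γ_notMem _
          · have h1 := hA.outside (s - T₀) ⟨by linarith, by linarith [hs.2]⟩
            rwa [← oflow_two_pi, ← hT₀, sub_add_cancel] at h1
        end_eq := by
          rw [hT₀, oflow_two_pi, ← hT₀, heq]; exact hA.end_eq }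
    have := (G.eq_oT h₁ h₂ h').1
    linarith

/-- After half a period the oscillator is at the opposite point, which the absence of antipodal
pairs forbids. -/
lemma sin_ne_zero {ξ₁ ξ₂ : ℝ} (h₁ : ξ₁ ∈ Ioo a b) (h₂ : ξ₂ ∈ Ioo a b) :
    Real.sin (B.ω * B.oT ξ₁ ξ₂) ≠ 0 := by
  intro h0
  have hpos : 0 < B.ω * B.oT ξ₁ ξ₂ := mul_pos B.ω_pos (G.oT_pos h₁ h₂)
  have hlt := G.oT_lt h₁ h₂
  have hπ : B.ω * B.oT ξ₁ ξ₂ - Real.pi = 0 := by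
    refine (Real.sin_eq_zero_iff_of_lt_of_lt (by linarith) (by linarith)).1 ?_
    rw [Real.sin_sub_pi, h0, neg_zero]
  have h1 := (G.spec h₁ h₂).end_eq
  have h2 : B.ω * B.oT ξ₁ ξ₂ = Real.pi := by linarith
  simp only [oflow, flow, oC, oS, h2, Real.cos_pi, Real.sin_pi, zero_div, zero_smul, add_zero] at h1
  refine G.notAntipodal ξ₁ h₁ ξ₂ h₂ ?_
  rw [← h1]
  exact zero_mem_segment (by norm_num)

/-- The outer arc from a point to itself is the radial brake orbit. -/
lemma diagonal {ξ : ℝ} (hξ : ξ ∈ Ioo a b) : ∃ y, 0 < y ∧ y < Real.pi / 2 ∧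
    B.ω * B.oT ξ ξ = 2 * y ∧ B.oq ξ ξ = (B.ω * Real.tan y) • B.γ ξ ∧
    (∀ s, B.oflow (B.γ ξ) (B.oq ξ ξ) s = (Real.cos (B.ω * s - y) / Real.cos y) • B.γ ξ) ∧
    B.ω ^ 2 * ‖B.γ ξ‖ ^ 2 = 2 * B.E * Real.cos y ^ 2 := by
  have hω := B.ω_pos
  have hA := G.spec hξ hξ
  have hsin := G.sin_ne_zero hξ hξ
  have hlt := G.oT_lt hξ hξ
  have hTpos := G.oT_pos hξ hξ
  set T := B.oT ξ ξ with hT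
  set q := B.oq ξ ξ with hq
  set p := B.γ ξ with hp
  set y := B.ω * T / 2 with hy
  have hy0 : 0 < y := by positivity
  have hωT : B.ω * T = 2 * y := by rw [hy]; ring
  have hsiny : 0 < Real.sin y := Real.sin_pos_of_pos_of_lt_pi hy0 (by linarith)
  have hcosy : Real.cos y ≠ 0 := by
    intro h; rw [hωT, Real.sin_two_mul, h] at hsin; simp at hsin
  have hq1 : q = (B.ω * Real.tan y) • p := by
    have h1 : B.oS T • q = p - B.oC T • p := by
      have h0 : flow B.oC B.oS p q T = p := hA.end_eq
      rw [smul_flow_start B.oC B.oS p q T, h0]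
    have h2 : B.oS T = 2 * Real.sin y * Real.cos y / B.ω := by
      rw [oS, hωT, Real.sin_two_mul]
    have h3 : B.oC T = 1 - 2 * Real.sin y ^ 2 := by
      rw [oC, hωT, Real.cos_two_mul, Real.cos_sq']; ring
    rw [h2, h3] at h1
    have h4 : (2 * Real.sin y * Real.cos y / B.ω) ≠ 0 := by positivity
    have h5 : q = (2 * Real.sin y * Real.cos y / B.ω)⁻¹ • ((2 * Real.sin y ^ 2) • p) := by
      rw [eq_inv_smul_iff₀ h4, h1, sub_smul, one_smul]; abel
    rw [h5, smul_smul, Real.tan_eq_sin_div_cos]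
    congr 1
    field_simp
  have hflow : ∀ s, B.oflow p q s = (Real.cos (B.ω * s - y) / Real.cos y) • p := by
    intro s
    rw [hq1, oflow, flow, smul_smul, ← add_smul, oC, oS, Real.cos_sub, Real.tan_eq_sin_div_cos]
    congr 1
    field_simp
  -- For larger `y` the radial motion would cross the origin, a point of `D`, at time `(y - π / 2) /
  -- ω`.
  have hylt : y < Real.pi / 2 := by
    by_contra hc
    push Not at hc
    have h1 := hA.outside ((y - Real.pi / 2) / B.ω) ⟨?_, ?_⟩
    · rw [hflow] at h1
      have h2 : B.ω * ((y - Real.pi / 2) / B.ω) - y = -(Real.pi / 2) := by field_simp; ring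
      rw [h2, Real.cos_neg, Real.cos_pi_div_two] at h1
      simp only [zero_div, zero_smul] at h1
      exact h1 B.zero_mem
    · have : y ≠ Real.pi / 2 := by intro h; rw [h, Real.cos_pi_div_two] at hcosy; exact hcosy rfl
      have : 0 < y - Real.pi / 2 := by
        rcases hc.lt_or_eq with h | h
        · linarith
        · exact absurd h.symm this
      positivity
    · rw [div_lt_iff₀ hω]
      have := Real.pi_pos
      linarith
  refine ⟨y, hy0, hylt, hωT, hq1, hflow, ?_⟩
  have h1 := hA.energy
  rw [← hp, hq1, norm_smul, mul_pow, Real.norm_eq_abs, sq_abs, Real.tan_eq_sin_div_cos] at h1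
  field_simp at h1
  have h2 := Real.sin_sq_add_cos_sq y
  linear_combination h1 - B.ω ^ 2 * ‖p‖ ^ 2 * h2

/-- The brake orbit climbs the ray up to the Hill circle and comes back, so it meets every point in
between twice, at phases symmetric about `y`. -/
lemma radial_hits {ξ : ℝ} (hξ : ξ ∈ Ioo a b) {ρ : ℝ} (hρ : 1 < ρ)
    (hH : B.ω ^ 2 * ‖ρ • B.γ ξ‖ ^ 2 < 2 * B.E) : ∃ s₁ s₂, 0 < s₁ ∧ s₁ < s₂ ∧ s₂ < B.oT ξ ξ ∧
      B.oflow (B.γ ξ) (B.oq ξ ξ) s₁ = ρ • B.γ ξ ∧ B.oflow (B.γ ξ) (B.oq ξ ξ) s₂ = ρ • B.γ ξ := by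
  obtain ⟨y, hy0, hy, hT, -, hflow, hp⟩ := G.diagonal hξ
  have hω := B.ω_pos
  have hE := B.E_pos
  have hcos : 0 < Real.cos y := Real.cos_pos_of_mem_Ioo ⟨by linarith, hy⟩
  have hρc : ρ * Real.cos y < 1 := by
    rw [norm_smul, mul_pow, Real.norm_eq_abs, sq_abs] at hH
    have h1 : (ρ * Real.cos y) ^ 2 < 1 := by
      have h2 : 2 * B.E * (ρ * Real.cos y) ^ 2 < 2 * B.E * 1 := by
        calc 2 * B.E * (ρ * Real.cos y) ^ 2 = ρ ^ 2 * (2 * B.E * Real.cos y ^ 2) := by ring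
          _ = B.ω ^ 2 * (ρ ^ 2 * ‖B.γ ξ‖ ^ 2) := by rw [← hp]; ring
          _ < _ := by linarith
      exact lt_of_mul_lt_mul_left h2 (by positivity)
    have h3 : 0 < ρ * Real.cos y := by positivity
    nlinarith
  have hcρ : Real.cos y < ρ * Real.cos y := by nlinarith
  set A := Real.arccos (ρ * Real.cos y) with hA
  have hA0 : 0 < A := Real.arccos_pos.2 hρc
  have hAy : A < y := by
    have h4 := Real.arccos_lt_arccos (by linarith) hcρ hρc.le
    rwa [Real.arccos_cos hy0.le (by linarith)] at h4
  have hcosA : Real.cos A = ρ * Real.cos y := Real.cos_arccos (by nlinarith) hρc.le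
  have hTy : B.oT ξ ξ = 2 * y / B.ω := by field_simp; linarith
  refine ⟨(y - A) / B.ω, (y + A) / B.ω, div_pos (by linarith) hω,
    div_lt_div_of_pos_right (by linarith) hω, ?_, ?_, ?_⟩
  · rw [hTy]; exact div_lt_div_of_pos_right (by linarith) hω
  · rw [hflow, show B.ω * ((y - A) / B.ω) - y = -A by field_simp; ring, Real.cos_neg, hcosA]
    congr 1; field_simp
  · rw [hflow, show B.ω * ((y + A) / B.ω) - y = A by field_simp; ring, hcosA]
    congr 1; field_simp

/-- The radial cone over the interval does not meet the domain. -/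
lemma smul_notMem {ξ : ℝ} (hξ : ξ ∈ Ioo a b) {ρ : ℝ} (hρ : 1 ≤ ρ) : ρ • B.γ ξ ∉ B.D := by
  rcases hρ.lt_or_eq with hρ | rfl
  · by_cases hH : B.ω ^ 2 * ‖ρ • B.γ ξ‖ ^ 2 < 2 * B.E
    · obtain ⟨s₁, s₂, h1, h2, h3, h4, -⟩ := G.radial_hits hξ hρ hH
      rw [← h4]
      exact (G.spec hξ hξ).outside s₁ ⟨h1, by linarith⟩
    · intro hD
      have h1 := B.subset_hill hD
      have hω := B.ω_pos
      rw [mem_ball_zero_iff, lt_div_iff₀ hω, Real.lt_sqrt (by positivity)] at h1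
      exact hH (by linarith [mul_pow ‖ρ • B.γ ξ‖ B.ω 2])
  · rw [one_smul]; exact B.γ_notMem ξ

lemma hill {ξ : ℝ} (hξ : ξ ∈ Ioo a b) : B.ω ^ 2 * ‖B.γ ξ‖ ^ 2 < 2 * B.E := by
  obtain ⟨y, hy0, hy, hT, -, -, hp⟩ := G.diagonal hξ
  have hE := B.E_pos
  have hs : 0 < Real.sin y := Real.sin_pos_of_pos_of_lt_pi hy0 (by linarith)
  have h2 := Real.sin_sq_add_cos_sq y
  rw [hp]
  nlinarith [mul_pos hE (pow_pos hs 2)]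

/-- Truncating the brake orbit at either of its two passages would give two different arcs with the
same endpoints. -/
lemma ne_smul {ξ₁ ξ₂ : ℝ} (h₁ : ξ₁ ∈ Ioo a b) (h₂ : ξ₂ ∈ Ioo a b) {ρ : ℝ} (hρ : 1 < ρ) :
    B.γ ξ₂ ≠ ρ • B.γ ξ₁ := by
  intro he
  obtain ⟨s₁, s₂, h1, h2, h3, h4, h5⟩ := G.radial_hits h₁ hρ (by rw [← he]; exact G.hill h₂)
  have hA := G.spec h₁ h₁
  have key : ∀ s, 0 < s → s < B.oT ξ₁ ξ₁ → B.oflow (B.γ ξ₁) (B.oq ξ₁ ξ₁) s = ρ • B.γ ξ₁ →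
      B.OArc ξ₁ ξ₂ s (B.oq ξ₁ ξ₁) := fun s hs hsT he' =>
    ⟨hs, hA.energy, fun s' hs' => hA.outside s' ⟨hs'.1, hs'.2.trans hsT⟩, he'.trans he.symm⟩
  have := (G.unique h₁ h₂ (key s₁ h1 (h2.trans h3) h4) (key s₂ (h1.trans h2) h3 h5)).1
  linarith

/-- Distinct points of the interval lie on distinct lines through the origin. -/
lemma cross_ne_zero {ξ₁ ξ₂ : ℝ} (h₁ : ξ₁ ∈ Ioo a b) (h₂ : ξ₂ ∈ Ioo a b) (hne : ξ₁ ≠ ξ₂) :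
    ((starRingEnd ℂ) (B.γ ξ₁) * B.γ ξ₂).im ≠ 0 := by
  intro h0
  set p := B.γ ξ₁ with hp
  have hp0 : p ≠ 0 := B.γ_ne_zero ξ₁
  set ρ : ℝ := ((starRingEnd ℂ) p * B.γ ξ₂).re / ‖p‖ ^ 2 with hρ
  have hpn : ‖p‖ ^ 2 ≠ 0 := by positivity
  have h1 : B.γ ξ₂ = ρ • p := by
    have h2 : ((starRingEnd ℂ) p * B.γ ξ₂) = ((ρ * ‖p‖ ^ 2 : ℝ) : ℂ) := by
      apply Complex.ext
      · rw [Complex.ofReal_re, hρ]; field_simp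
      · rw [Complex.ofReal_im, h0]
    have h3 : ((‖p‖ ^ 2 : ℝ) : ℂ) = p * (starRingEnd ℂ) p := by
      rw [Complex.mul_conj, Complex.normSq_eq_norm_sq]
    have h4 : (starRingEnd ℂ) p ≠ 0 := by simpa using hp0
    have h5 : (starRingEnd ℂ) p * B.γ ξ₂ = (starRingEnd ℂ) p * (ρ • p) := by
      rw [h2, Complex.ofReal_mul, h3, Complex.real_smul]; ring
    exact mul_left_cancel₀ h4 h5
  rcases le_or_gt ρ 0 with h | h
  · exact G.notAntipodal ξ₁ h₁ ξ₂ h₂ (h1 ▸ zero_mem_segment h)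
  rcases lt_trichotomy ρ 1 with h' | h' | h'
  · refine G.ne_smul h₂ h₁ (ρ := ρ⁻¹) ((one_lt_inv₀ h).2 h') ?_
    rw [h1, smul_smul, inv_mul_cancel₀ h.ne', one_smul]
  · rw [h', one_smul] at h1
    exact hne (G.injOn h₁ h₂ h1.symm)
  · exact G.ne_smul h₁ h₂ h' h1

/-- At a parameter where the boundary is transversal to the rays, the open radial cone does not meet
the closure of the domain. -/
lemma smul_notMem_closure {ξ : ℝ} (hξ : ξ ∈ Ioo a b)
    (htr : ((starRingEnd ℂ) (B.γ ξ) * B.tangent ξ).im ≠ 0) {ρ : ℝ} (hρ : 1 < ρ) :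
    ρ • B.γ ξ ∉ closure B.D := by
  intro hcl
  obtain ⟨ζ, hζ⟩ := B.exists_γ_eq hcl (G.smul_notMem hξ hρ.le)
  -- A contact point can be moved both along the dilated boundary and along the ray without entering
  -- `D`. Both directions are then tangent to the boundary at `γ ζ`, which is impossible since they
  -- are independent.
  have e1 : inner ℝ (B.normal ζ) (ρ • B.tangent ξ) = 0 := by
    refine inner_normal_eq_zero_of_notMem (f := fun s => ρ • B.γ s) (s₀ := ξ)
      ((B.hasDerivAt_γ ξ).const_smul ρ) hζ.symm ?_
    filter_upwards [Ioo_mem_nhds hξ.1 hξ.2] with s hs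
    exact G.smul_notMem hs hρ.le
  have e2 : inner ℝ (B.normal ζ) (B.γ ξ) = 0 := by
    refine inner_normal_eq_zero_of_notMem (f := fun s : ℝ => s • B.γ ξ) (s₀ := ρ) ?_ hζ.symm ?_
    · simpa using (hasDerivAt_id ρ).smul_const (B.γ ξ)
    · filter_upwards [lt_mem_nhds hρ] with s hs
      exact G.smul_notMem hξ hs.le
  rw [inner_smul_right] at e1
  have e3 := (mul_eq_zero.1 e1).resolve_left (by linarith)
  have hn := B.norm_normal ζ
  set n := B.normal ζ
  set p := B.γ ξ
  set t := B.tangent ξ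
  simp only [Complex.inner] at e2 e3
  simp at e2 e3 htr
  have k1 : n.re * (p.re * t.im - p.im * t.re) = 0 := by linear_combination t.im * e2 - p.im * e3
  have k2 : n.im * (p.re * t.im - p.im * t.re) = 0 := by linear_combination p.re * e3 - t.re * e2
  have k3 : p.re * t.im - p.im * t.re ≠ 0 := fun h => htr (by linarith)
  have k4 : n = 0 := Complex.ext ((mul_eq_zero.1 k1).resolve_right k3)
    ((mul_eq_zero.1 k2).resolve_right k3)
  rw [k4, norm_zero] at hn
  exact zero_ne_one hn

end GoodInterval

end RefractionBilliard

namespace RefractionBilliard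

variable {B : RefractionBilliard}

/-! ### Limits of outer arcs -/

lemma tendsto_flow {ι : Type*} {l : Filter ι} {C S : ℝ → ℝ} {κ : ℝ} (P : Propagator κ C S)
    {p q : ι → ℂ} {T : ι → ℝ} {p₀ q₀ : ℂ} {T₀ : ℝ} (hp : Tendsto p l (𝓝 p₀))
    (hq : Tendsto q l (𝓝 q₀)) (hT : Tendsto T l (𝓝 T₀)) :
    Tendsto (fun i => flow C S (p i) (q i) (T i)) l (𝓝 (flow C S p₀ q₀ T₀)) :=
  (P.continuous_flow_uncurry.tendsto ((p₀, q₀), T₀)).comp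
    (f := fun i => ((p i, q i), T i)) ((hp.prodMk_nhds hq).prodMk_nhds hT)

lemma tendsto_flowVel {ι : Type*} {l : Filter ι} {C S : ℝ → ℝ} {κ : ℝ} (P : Propagator κ C S)
    {p q : ι → ℂ} {T : ι → ℝ} {p₀ q₀ : ℂ} {T₀ : ℝ} (hp : Tendsto p l (𝓝 p₀))
    (hq : Tendsto q l (𝓝 q₀)) (hT : Tendsto T l (𝓝 T₀)) :
    Tendsto (fun i => flowVel κ C S (p i) (q i) (T i)) l (𝓝 (flowVel κ C S p₀ q₀ T₀)) :=
  (P.continuous_flowVel_uncurry.tendsto ((p₀, q₀), T₀)).comp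
    (f := fun i => ((p i, q i), T i)) ((hp.prodMk_nhds hq).prodMk_nhds hT)

/-- Avoiding the open set `D` is a closed condition, which is why limits of arcs of non-vanishing
duration are again arcs. -/
lemma OArc.of_tendsto {ι : Type*} {l : Filter ι} [l.NeBot] {x₁ x₂ T : ι → ℝ} {q : ι → ℂ}
    {ξ₁ ξ₂ T₀ : ℝ} {q₀ : ℂ} (h₁ : Tendsto x₁ l (𝓝 ξ₁)) (h₂ : Tendsto x₂ l (𝓝 ξ₂))
    (hT : Tendsto T l (𝓝 T₀)) (hq : Tendsto q l (𝓝 q₀))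
    (h : ∀ᶠ i in l, B.OArc (x₁ i) (x₂ i) (T i) (q i)) (hT₀ : 0 < T₀) :
    B.OArc ξ₁ ξ₂ T₀ q₀ := by
  have hp₁ := (B.continuous_γ.tendsto ξ₁).comp h₁
  have hp₂ := (B.continuous_γ.tendsto ξ₂).comp h₂
  refine ⟨hT₀, ?_, fun s hs => ?_, ?_⟩
  · refine tendsto_nhds_unique_of_eventuallyEq
      ((hq.norm.pow 2).sub ((hp₁.norm.pow 2).const_mul (-B.ω ^ 2))) tendsto_const_nhds ?_
    filter_upwards [h] with i hi using hi.energy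
  · refine (B.isOpen.isClosed_compl).mem_of_tendsto
      (tendsto_flow B.outerPropagator hp₁ hq (tendsto_const_nhds (x := s))) ?_
    filter_upwards [h, hT.eventually (lt_mem_nhds hs.2)] with i hi hsi
    exact hi.outside s ⟨hs.1, hsi⟩
  · refine tendsto_nhds_unique_of_eventuallyEq (tendsto_flow B.outerPropagator hp₁ hq hT) hp₂ ?_
    filter_upwards [h] with i hi using hi.end_eq

variable (B) in
/-- The inner product of the final and of the initial velocity of the outer arc. -/
def og (ξ₁ ξ₂ : ℝ) : ℝ :=
  2 * B.E * B.oC (B.oT ξ₁ ξ₂) - B.ω ^ 2 * inner ℝ (B.γ ξ₁) (B.γ ξ₂)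

variable (B) in
/-- The square of `og`. -/
def oΔ (ξ₁ ξ₂ : ℝ) : ℝ :=
  4 * B.E ^ 2 - 2 * B.E * B.ω ^ 2 * (‖B.γ ξ₁‖ ^ 2 + ‖B.γ ξ₂‖ ^ 2) +
    B.ω ^ 4 * inner ℝ (B.γ ξ₁) (B.γ ξ₂) ^ 2

lemma continuous_oΔ : Continuous fun x : ℝ × ℝ => B.oΔ x.1 x.2 := by
  have := B.continuous_γ
  unfold oΔ
  fun_prop

lemma continuousAt_og {x : ℝ × ℝ}
    (h : ContinuousAt (fun y : ℝ × ℝ => (B.oT y.1 y.2, B.oq y.1 y.2)) x) :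
    ContinuousAt (fun y : ℝ × ℝ => B.og y.1 y.2) x := by
  have h1 : ContinuousAt (fun y : ℝ × ℝ => B.oC (B.oT y.1 y.2)) x :=
    B.outerPropagator.continuousC.continuousAt.comp
      (g := B.oC) (f := fun y : ℝ × ℝ => B.oT y.1 y.2) h.fst
  have h2 : Continuous fun y : ℝ × ℝ => B.ω ^ 2 * inner ℝ (B.γ y.1) (B.γ y.2) := by
    have := B.continuous_γ
    fun_prop
  exact (h1.const_mul _).sub h2.continuousAt

namespace GoodInterval

variable {a b : ℝ} (G : B.GoodInterval a b)

include G

lemma time_eq {ξ₁ ξ₂ : ℝ} (h₁ : ξ₁ ∈ Ioo a b) (h₂ : ξ₂ ∈ Ioo a b) :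
    ‖B.γ ξ₁‖ ^ 2 + ‖B.γ ξ₂‖ ^ 2 - 2 * B.oC (B.oT ξ₁ ξ₂) * inner ℝ (B.γ ξ₁) (B.γ ξ₂) =
      2 * B.E * B.oS (B.oT ξ₁ ξ₂) ^ 2 := by
  have hA := G.spec h₁ h₂
  have h := B.outerPropagator.time_equation (T := B.oT ξ₁ ξ₂) hA.energy
  have h0 : flow B.oC B.oS (B.γ ξ₁) (B.oq ξ₁ ξ₂) (B.oT ξ₁ ξ₂) = B.γ ξ₂ := hA.end_eq
  rwa [h0] at h

lemma inner_ovel {ξ₁ ξ₂ : ℝ} (h₁ : ξ₁ ∈ Ioo a b) (h₂ : ξ₂ ∈ Ioo a b) :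
    inner ℝ (B.ovel (B.γ ξ₁) (B.oq ξ₁ ξ₂) (B.oT ξ₁ ξ₂)) (B.oq ξ₁ ξ₂) = B.og ξ₁ ξ₂ := by
  have hA := G.spec h₁ h₂
  have h0 : flow B.oC B.oS (B.γ ξ₁) (B.oq ξ₁ ξ₂) (B.oT ξ₁ ξ₂) = B.γ ξ₂ := hA.end_eq
  rw [ovel, inner_flowVel hA.energy, h0, og]
  ring

lemma og_sq {ξ₁ ξ₂ : ℝ} (h₁ : ξ₁ ∈ Ioo a b) (h₂ : ξ₂ ∈ Ioo a b) :
    B.og ξ₁ ξ₂ ^ 2 = B.oΔ ξ₁ ξ₂ := by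
  have h := G.time_eq h₁ h₂
  have h3 := B.outerPropagator.sq (B.oT ξ₁ ξ₂)
  rw [og, oΔ]
  linear_combination (2 * B.E * B.ω ^ 2) * h + 4 * B.E ^ 2 * h3

lemma og_symm {ξ₁ ξ₂ : ℝ} (h₁ : ξ₁ ∈ Ioo a b) (h₂ : ξ₂ ∈ Ioo a b) : B.og ξ₂ ξ₁ = B.og ξ₁ ξ₂ := by
  rw [og, og, (G.symm h₁ h₂).1, real_inner_comm]

lemma shell_pos {ξ : ℝ} (hξ : ξ ∈ Ioo a b) : 0 < 2 * B.E - B.ω ^ 2 * ‖B.γ ξ‖ ^ 2 := by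
  linarith [G.hill hξ]

lemma norm_sq_oq {ξ₁ ξ₂ : ℝ} (h₁ : ξ₁ ∈ Ioo a b) (h₂ : ξ₂ ∈ Ioo a b) :
    ‖B.oq ξ₁ ξ₂‖ ^ 2 = 2 * B.E - B.ω ^ 2 * ‖B.γ ξ₁‖ ^ 2 := by
  linarith [(G.spec h₁ h₂).energy]

lemma oq_ne_zero {ξ₁ ξ₂ : ℝ} (h₁ : ξ₁ ∈ Ioo a b) (h₂ : ξ₂ ∈ Ioo a b) : B.oq ξ₁ ξ₂ ≠ 0 := by
  intro h
  have h1 := G.norm_sq_oq h₁ h₂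
  have h2 := G.shell_pos h₁
  rw [h, norm_zero] at h1
  linarith

lemma og_diag {ξ : ℝ} (hξ : ξ ∈ Ioo a b) : B.og ξ ξ = -(2 * B.E - B.ω ^ 2 * ‖B.γ ξ‖ ^ 2) := by
  have h := G.symm hξ hξ
  rw [← G.inner_ovel hξ hξ, ← G.norm_sq_oq hξ hξ, ← real_inner_self_eq_norm_sq]
  have h2 : B.ovel (B.γ ξ) (B.oq ξ ξ) (B.oT ξ ξ) = -B.oq ξ ξ := by rw [h.2, neg_neg, ← h.2]
  rw [h2, inner_neg_left]

/-- The outer arc depends continuously on its endpoints, unless its duration tends to zero. -/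
lemma tendsto_arc {x : ℝ × ℝ} (hx : x ∈ Ioo a b ×ˢ Ioo a b)
    (hne : ∀ u : Ultrafilter (ℝ × ℝ), (u : Filter (ℝ × ℝ)) ≤ 𝓝 x →
      Tendsto (fun y : ℝ × ℝ => B.oT y.1 y.2) u (𝓝 0) → B.γ x.1 = B.γ x.2 → False) :
    ContinuousAt (fun y : ℝ × ℝ => (B.oT y.1 y.2, B.oq y.1 y.2)) x := by
  have hev : ∀ᶠ y in 𝓝 x, y ∈ Ioo a b ×ˢ Ioo a b := (isOpen_Ioo.prod isOpen_Ioo).mem_nhds hx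
  rw [ContinuousAt, tendsto_iff_ultrafilter]
  intro u hu
  have hω := B.ω_pos
  have hE := B.E_pos
  -- Durations are bounded by a period and velocities by the energy. Every ultrafilter limit with
  -- positive duration is then an arc, and uniqueness identifies it.
  have hK : IsCompact (Icc 0 (2 * Real.pi / B.ω) ×ˢ Metric.closedBall (0 : ℂ) (√(2 * B.E))) :=
    isCompact_Icc.prod (isCompact_closedBall _ _)
  have hmem : ∀ᶠ y in (u : Filter (ℝ × ℝ)), (B.oT y.1 y.2, B.oq y.1 y.2) ∈
      Icc 0 (2 * Real.pi / B.ω) ×ˢ Metric.closedBall (0 : ℂ) (√(2 * B.E)) := by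
    filter_upwards [hu hev] with y hy
    refine ⟨⟨(G.oT_pos hy.1 hy.2).le, ?_⟩, ?_⟩
    · rw [le_div_iff₀ hω]; linarith [G.oT_lt hy.1 hy.2]
    · rw [mem_closedBall_zero_iff]
      refine Real.le_sqrt_of_sq_le ?_
      rw [G.norm_sq_oq hy.1 hy.2]
      have : 0 ≤ B.ω ^ 2 * ‖B.γ y.1‖ ^ 2 := by positivity
      linarith
  obtain ⟨⟨T₀, q₀⟩, hTq, hlim⟩ := hK.ultrafilter_le_nhds
    (u.map fun y : ℝ × ℝ => (B.oT y.1 y.2, B.oq y.1 y.2)) (le_principal_iff.2 hmem)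
  have hlim' : Tendsto (fun y : ℝ × ℝ => (B.oT y.1 y.2, B.oq y.1 y.2)) u (𝓝 (T₀, q₀)) := hlim
  have hT := (continuous_fst.tendsto (T₀, q₀)).comp hlim'
  have hq := (continuous_snd.tendsto (T₀, q₀)).comp hlim'
  have h1 : Tendsto (fun y : ℝ × ℝ => y.1) u (𝓝 x.1) := (continuous_fst.tendsto x).mono_left hu
  have h2 : Tendsto (fun y : ℝ × ℝ => y.2) u (𝓝 x.2) := (continuous_snd.tendsto x).mono_left hu
  have hT₀ : 0 ≤ T₀ := hTq.1.1
  rcases hT₀.lt_or_eq with hpos | rfl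
  · have h3 := OArc.of_tendsto h1 h2 hT hq (by
      filter_upwards [hu hev] with y hy using G.spec hy.1 hy.2) hpos
    obtain ⟨e1, e2⟩ := G.eq_oT hx.1 hx.2 h3
    rw [← e1, ← e2]
    exact hlim'
  · exfalso
    refine hne u hu hT ?_
    have h3 := tendsto_flow B.outerPropagator ((B.continuous_γ.tendsto x.1).comp h1) hq hT
    have h4 := tendsto_nhds_unique_of_eventuallyEq h3 ((B.continuous_γ.tendsto x.2).comp h2) (by
      filter_upwards [hu hev] with y hy using (G.spec hy.1 hy.2).end_eq)
    rwa [B.outerPropagator.flow_zero] at h4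

lemma continuousAt_of_ne {x : ℝ × ℝ} (hx : x ∈ Ioo a b ×ˢ Ioo a b) (hne : x.1 ≠ x.2) :
    ContinuousAt (fun y : ℝ × ℝ => (B.oT y.1 y.2, B.oq y.1 y.2)) x :=
  G.tendsto_arc hx fun _ _ _ h => hne (G.injOn hx.1 hx.2 h)

/-- There are parameters at which the boundary is transversal to the rays. -/
lemma exists_transversal {c d : ℝ} (hcd : c < d) (hJ : Icc c d ⊆ Ioo a b) :
    ∃ ξ ∈ Ioo c d, ((starRingEnd ℂ) (B.γ ξ) * B.tangent ξ).im ≠ 0 := by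
  by_contra! hc
  set c' := (2 * c + d) / 3
  set d' := (c + 2 * d) / 3
  have hcc : c < c' := by simp only [c']; linarith
  have hcd' : c' < d' := by simp only [c', d']; linarith
  have hdd : d' < d := by simp only [d']; linarith
  have hne : ∀ s, (starRingEnd ℂ) (B.γ s) ≠ 0 := fun s => by simpa using B.γ_ne_zero s
  have hconj : ∀ s, HasDerivAt (fun s => (starRingEnd ℂ) (B.γ s))
      ((starRingEnd ℂ) (B.tangent s)) s := fun s => (B.hasDerivAt_γ s).star
  -- A boundary tangent to the rays throughout an interval would have constant `γ / conj γ`, which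
  -- places two distinct points on a line through the origin.
  have hder : ∀ s ∈ Ioo c d, HasDerivAt (fun s => B.γ s / (starRingEnd ℂ) (B.γ s)) 0 s := by
    intro s hs
    refine ((B.hasDerivAt_γ s).fun_div (hconj s) (hne s)).congr_deriv ?_
    have h1 := hc s hs
    have h2 : B.tangent s * (starRingEnd ℂ) (B.γ s) - B.γ s * (starRingEnd ℂ) (B.tangent s) = 0 := by
      simp only [Complex.mul_im, Complex.conj_re, Complex.conj_im] at h1
      apply Complex.ext <;> simp <;> linarith
    rw [h2, zero_div]
  have h1 := constant_of_has_deriv_right_zero (a := c') (b := d')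
    (f := fun s => B.γ s / (starRingEnd ℂ) (B.γ s))
    (fun s hs => (hder s ⟨by linarith [hs.1], by linarith [hs.2]⟩).continuousAt.continuousWithinAt)
    (fun s hs => (hder s ⟨by linarith [hs.1], by linarith [hs.2]⟩).hasDerivWithinAt)
    d' ⟨hcd'.le, le_rfl⟩
  have h3 : B.γ d' * (starRingEnd ℂ) (B.γ c') = B.γ c' * (starRingEnd ℂ) (B.γ d') := by
    have := hne c'
    have := hne d'
    field_simp at h1
    linear_combination h1
  refine G.cross_ne_zero (ξ₁ := c') (ξ₂ := d') (hJ ⟨hcc.le, by linarith⟩)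
    (hJ ⟨by linarith, hdd.le⟩) hcd'.ne ?_
  have h4 := congrArg Complex.im h3
  simp at h4 ⊢
  linarith

/-- A negative value would let the outgoing ray enter `D`, contrary to `smul_notMem`; the value zero
would make the ray tangent to the boundary. -/
lemma inner_normal_pos_of_transversal {ξ : ℝ} (hξ : ξ ∈ Ioo a b)
    (htr : ((starRingEnd ℂ) (B.γ ξ) * B.tangent ξ).im ≠ 0) : 0 < inner ℝ (B.normal ξ) (B.γ ξ) := by
  by_contra! hc
  rcases hc.lt_or_eq with h | h
  · have hf : HasDerivAt (fun s : ℝ => s • B.γ ξ) (B.γ ξ) 1 := by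
      simpa using (hasDerivAt_id (1 : ℝ)).smul_const (B.γ ξ)
    have h1 := eventually_after (B.eventually_cone_mem h) hf (one_smul _ _)
    obtain ⟨s, hs, hs'⟩ := (h1.and self_mem_nhdsWithin).exists
    exact G.smul_notMem hξ (le_of_lt hs') hs
  · refine htr ?_
    have h1 := B.decomp ξ (B.γ ξ)
    rw [real_inner_comm] at h
    rw [h, zero_smul, add_zero] at h1
    rw [h1]
    simp
    ring

end GoodInterval

/-- Perturbation of an arc which is transversal at its ends and does not touch the boundary. -/
lemma eventually_outside {ξ₁ ξ₂ T : ℝ} {q : ℂ} (hq : 0 < inner ℝ (B.normal ξ₁) q)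
    (hv : inner ℝ (B.normal ξ₂) (B.ovel (B.γ ξ₁) q T) < 0)
    (hout : ∀ s ∈ Ioo 0 T, B.oflow (B.γ ξ₁) q s ∉ closure B.D) {ι : Type*} {l : Filter ι}
    {x₁ x₂ T' : ι → ℝ} {q' : ι → ℂ} (h₁ : Tendsto x₁ l (𝓝 ξ₁)) (h₂ : Tendsto x₂ l (𝓝 ξ₂))
    (hT' : Tendsto T' l (𝓝 T)) (hq' : Tendsto q' l (𝓝 q))
    (hend : ∀ᶠ i in l, B.oflow (B.γ (x₁ i)) (q' i) (T' i) = B.γ (x₂ i)) :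
    ∀ᶠ i in l, ∀ s ∈ Ioo 0 (T' i), B.oflow (B.γ (x₁ i)) (q' i) s ∉ closure B.D := by
  have hp₁ := (B.continuous_γ.tendsto ξ₁).comp h₁
  obtain ⟨δ₁, hδ₁, hs⟩ := B.outerPropagator.pathFamily_flow.eventually_start B.isSide_outer
    (x := (ξ₁, q)) (by simpa using hq)
  obtain ⟨δ₂, hδ₂, he⟩ := B.outerPropagator.pathFamily_flow.eventually_start B.isSide_outer
    (x := (ξ₂, -B.ovel (B.γ ξ₁) q T)) (by
      rw [one_mul, inner_neg_right]; linarith)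
  have hs' := (h₁.prodMk_nhds hq').eventually hs
  have he' := (h₂.prodMk_nhds (tendsto_flowVel B.outerPropagator hp₁ hq' hT').neg).eventually he
  set δ := min δ₁ δ₂ with hδ
  have hδ0 : 0 < δ := lt_min hδ₁ hδ₂
  have hm := tube (F := fun (x : ℂ × ℂ) s => flow B.oC B.oS x.1 x.2 s) (x₀ := (B.γ ξ₁, q))
    (a := δ / 2) (b := T - δ / 2) B.outerPropagator.continuous_flow_uncurry
    (isClosed_closure (s := B.D)).isOpen_compl
    (fun s hs => hout s ⟨by linarith [hs.1], by linarith [hs.2]⟩)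
  have hm' := (hp₁.prodMk_nhds hq').eventually hm
  filter_upwards [hs', he', hm', hend, hT'.eventually (gt_mem_nhds (show T < T + δ / 2 by linarith))]
    with i k1 k2 k3 k4 k5 s hs
  rcases lt_or_ge s δ with h | h
  · exact k1 s ⟨hs.1, h.trans_le (min_le_left _ _)⟩
  rcases lt_or_ge (T' i - s) δ with h' | h'
  · have h6 := k2 (T' i - s) ⟨by linarith [hs.2], h'.trans_le (min_le_right _ _)⟩
    have h7 : flow B.oC B.oS (B.γ (x₂ i))
        (-flowVel (-B.ω ^ 2) B.oC B.oS (B.γ (x₁ i)) (q' i) (T' i)) (T' i - s) =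
        B.oflow (B.γ (x₁ i)) (q' i) s := by
      rw [← k4, oflow, B.outerPropagator.flow_reverse, sub_sub_cancel]
    simp only [Function.comp] at h6
    rw [h7] at h6
    exact h6
  · exact k3 s ⟨by linarith, by linarith⟩

end RefractionBilliard

/-! ### Continuity of outer arcs up to the diagonal. -/

namespace RefractionBilliard

variable {B : RefractionBilliard}

namespace GoodInterval

variable {a b : ℝ} (G : B.GoodInterval a b)

include G

/-- Near a transversal point, short displacements are joined by arcs close to the brake orbit. -/
lemma og_neg_of_transversal {ξ : ℝ} (hξ : ξ ∈ Ioo a b)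
    (htr : ((starRingEnd ℂ) (B.γ ξ) * B.tangent ξ).im ≠ 0) :
    ∀ᶠ x : ℝ × ℝ in 𝓝 (ξ, ξ), B.og x.1 x.2 < 0 := by
  obtain ⟨y, hy0, hy, hTy, hqy, hflow, hp⟩ := G.diagonal hξ
  have hω := B.ω_pos
  have hE := B.E_pos
  have hγ := B.continuous_γ
  have hcos : 0 < Real.cos y := Real.cos_pos_of_mem_Ioo ⟨by linarith, hy⟩
  have hev : ∀ᶠ x in 𝓝 (ξ, ξ), x ∈ Ioo a b ×ˢ Ioo a b :=
    (isOpen_Ioo.prod isOpen_Ioo).mem_nhds (show (ξ, ξ) ∈ Ioo a b ×ˢ Ioo a b from ⟨hξ, hξ⟩)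
  -- the candidate arcs
  set c : ℝ × ℝ → ℝ := fun x =>
    (B.ω ^ 2 * inner ℝ (B.γ x.1) (B.γ x.2) - √(B.oΔ x.1 x.2)) / (2 * B.E) with hc
  set T : ℝ × ℝ → ℝ := fun x => Real.arccos (c x) / B.ω with hT
  set q : ℝ × ℝ → ℂ := fun x => (1 / B.oS (T x)) • (B.γ x.2 - B.oC (T x) • B.γ x.1) with hq
  have hΔ0 : √(B.oΔ ξ ξ) = 2 * B.E - B.ω ^ 2 * ‖B.γ ξ‖ ^ 2 := by
    rw [← G.og_sq hξ hξ, G.og_diag hξ, neg_sq, Real.sqrt_sq (G.shell_pos hξ).le]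
  have hc0 : c (ξ, ξ) = Real.cos (2 * y) := by
    simp only [hc]
    rw [hΔ0, real_inner_self_eq_norm_sq, hp, Real.cos_two_mul]
    field_simp
    ring
  have hT0 : T (ξ, ξ) = B.oT ξ ξ := by
    simp only [hT]
    rw [hc0, Real.arccos_cos (by linarith) (by linarith), ← hTy]
    field_simp
  have hS0 : 0 < B.oS (T (ξ, ξ)) := by
    rw [hT0, oS, hTy]
    exact div_pos (Real.sin_pos_of_pos_of_lt_pi (by linarith) (by linarith)) hω
  have hq0 : q (ξ, ξ) = B.oq ξ ξ := by
    have h1 := smul_flow_start B.oC B.oS (B.γ ξ) (B.oq ξ ξ) (B.oT ξ ξ)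
    have h0 : flow B.oC B.oS (B.γ ξ) (B.oq ξ ξ) (B.oT ξ ξ) = B.γ ξ := (G.spec hξ hξ).end_eq
    simp only [hq]
    rw [hT0] at hS0 ⊢
    rw [h0] at h1
    rw [← h1, smul_smul, one_div_mul_cancel hS0.ne', one_smul]
  have hcc : Continuous c := by
    have := continuous_oΔ (B := B)
    simp only [hc]
    fun_prop
  have hTc : Continuous T := by
    simp only [hT]
    exact (Real.continuous_arccos.comp hcc).div_const _
  have hSc : Continuous fun x => B.oS (T x) := B.outerPropagator.continuousS.comp hTc
  have hCc : Continuous fun x => B.oC (T x) := B.outerPropagator.continuousC.comp hTc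
  have hqc : ContinuousAt q (ξ, ξ) := by
    refine (continuousAt_const.div hSc.continuousAt hS0.ne').smul ?_
    have : Continuous fun x : ℝ × ℝ => B.γ x.2 - B.oC (T x) • B.γ x.1 := by fun_prop
    exact this.continuousAt
  -- they are arcs
  have hc1 : ∀ᶠ x in 𝓝 (ξ, ξ), c x ∈ Ioo (-1) 1 := by
    refine hcc.continuousAt.eventually (Ioo_mem_nhds ?_ ?_) <;> rw [hc0]
    · rw [← Real.cos_pi]
      exact Real.cos_lt_cos_of_nonneg_of_le_pi (by linarith) le_rfl (by linarith)
    · rw [← Real.cos_zero]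
      exact Real.cos_lt_cos_of_nonneg_of_le_pi le_rfl (by linarith) (by linarith)
  have hΔ1 : ∀ᶠ x : ℝ × ℝ in 𝓝 (ξ, ξ), 0 < B.oΔ x.1 x.2 := by
    refine continuous_oΔ.continuousAt.eventually (lt_mem_nhds ?_)
    exact Real.sqrt_pos.1 (hΔ0 ▸ G.shell_pos hξ)
  have hCeq : ∀ᶠ x in 𝓝 (ξ, ξ), B.oC (T x) = c x := by
    filter_upwards [hc1] with x hx
    rw [oC, hT, mul_div_cancel₀ _ hω.ne', Real.cos_arccos hx.1.le hx.2.le]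
  have hfe : ∀ᶠ x in 𝓝 (ξ, ξ), B.oflow (B.γ x.1) (q x) (T x) = B.γ x.2 ∧
      ‖q x‖ ^ 2 - (-B.ω ^ 2) * ‖B.γ x.1‖ ^ 2 = 2 * B.E := by
    filter_upwards [hCeq, hΔ1, hSc.continuousAt.eventually (lt_mem_nhds hS0)] with x h1 h2 h3
    refine B.outerPropagator.energy_of_time_equation h3.ne' ?_
    have h4 := B.outerPropagator.sq (T x)
    -- Of the two roots of the quadratic equation for the cosine, `c` is the one making `og` equal
    -- to `-√oΔ`, the sign it has on the diagonal.
    have h5 : 2 * B.E * c x = B.ω ^ 2 * inner ℝ (B.γ x.1) (B.γ x.2) - √(B.oΔ x.1 x.2) := by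
      simp only [hc]; field_simp
    have h6 := Real.sq_sqrt h2.le
    have h7 : √(B.oΔ x.1 x.2) = B.ω ^ 2 * inner ℝ (B.γ x.1) (B.γ x.2) - 2 * B.E * c x := by linarith
    rw [h7, oΔ] at h6
    rw [h1] at h4 ⊢
    have h8 : B.ω ^ 2 * (2 * B.E) *
        (‖B.γ x.1‖ ^ 2 + ‖B.γ x.2‖ ^ 2 - 2 * c x * inner ℝ (B.γ x.1) (B.γ x.2)) =
        B.ω ^ 2 * (2 * B.E) * (2 * B.E * B.oS (T x) ^ 2) := by
      linear_combination h6 - 4 * B.E ^ 2 * h4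
    exact mul_left_cancel₀ (by positivity) h8
  -- The brake orbit starts and ends transversally and in between runs through the open radial cone,
  -- off `closure D`. Nearby candidates therefore stay outside too, and uniqueness makes them the
  -- true arcs.
  have hnp := G.inner_normal_pos_of_transversal hξ htr
  have hnq : 0 < inner ℝ (B.normal ξ) (B.oq ξ ξ) := by
    rw [hqy, inner_smul_right]
    exact mul_pos (mul_pos hω (Real.tan_pos_of_pos_of_lt_pi_div_two hy0 hy)) hnp
  have hvel : B.ovel (B.γ ξ) (B.oq ξ ξ) (B.oT ξ ξ) = -B.oq ξ ξ := by
    have h := (G.symm hξ hξ).2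
    rw [h, neg_neg, ← h]
  have hout := eventually_outside (B := B) (ξ₁ := ξ) (ξ₂ := ξ) (T := B.oT ξ ξ) (q := B.oq ξ ξ)
    (l := 𝓝 (ξ, ξ)) (x₁ := Prod.fst) (x₂ := Prod.snd) (T' := T) (q' := q) hnq
    (by rw [hvel, inner_neg_right]; linarith) (fun s hs => by
      rw [hflow]
      refine G.smul_notMem_closure hξ htr ((one_lt_div hcos).2 ?_)
      rw [← Real.cos_abs (B.ω * s - y)]
      have h1 := mul_pos hω hs.1
      have h2 := mul_lt_mul_of_pos_left hs.2 hω
      refine Real.cos_lt_cos_of_nonneg_of_le_pi (abs_nonneg _) (by linarith) ?_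
      rw [abs_lt]
      constructor <;> linarith)
    continuous_fst.continuousAt continuous_snd.continuousAt (hT0 ▸ hTc.continuousAt)
    (hq0 ▸ hqc) (hfe.mono fun x hx => hx.1)
  filter_upwards [hev, hout, hfe, hΔ1, hCeq,
    hTc.continuousAt.eventually (lt_mem_nhds (hT0 ▸ G.oT_pos hξ hξ))] with x h1 h2 h3 h4 h5 h6
  have hA : B.OArc x.1 x.2 (T x) (q x) :=
    ⟨h6, h3.2, fun s hs hD => h2 s hs (subset_closure hD), h3.1⟩
  rw [og, ← (G.eq_oT h1.1 h1.2 hA).1, h5]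
  have h7 : 2 * B.E * c x = B.ω ^ 2 * inner ℝ (B.γ x.1) (B.γ x.2) - √(B.oΔ x.1 x.2) := by
    simp only [hc]; field_simp
  rw [h7]
  linarith [Real.sqrt_pos.2 h4]

/-- Near `(ξ, ξ)` the square of `og` is `oΔ > 0`. On the open triangle on one side of the diagonal
`og` is continuous without zeros, so its sign is constant there, and an arbitrarily close
transversal parameter shows it to be negative. Symmetry and the explicit value on the diagonal cover
the rest. -/
lemma og_neg_near_diagonal {ξ : ℝ} (hξ : ξ ∈ Ioo a b) :
    ∀ᶠ x : ℝ × ℝ in 𝓝 (ξ, ξ), B.og x.1 x.2 < 0 := by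
  have hΔ1 : ∀ᶠ x : ℝ × ℝ in 𝓝 (ξ, ξ), 0 < B.oΔ x.1 x.2 := by
    refine continuous_oΔ.continuousAt.eventually (lt_mem_nhds ?_)
    simp only
    rw [← G.og_sq hξ hξ, G.og_diag hξ]
    exact pow_pos (G.shell_pos hξ) 2 |>.trans_eq (neg_sq _).symm
  have hev : ∀ᶠ x in 𝓝 (ξ, ξ), x ∈ Ioo a b ×ˢ Ioo a b :=
    (isOpen_Ioo.prod isOpen_Ioo).mem_nhds (show (ξ, ξ) ∈ Ioo a b ×ˢ Ioo a b from ⟨hξ, hξ⟩)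
  obtain ⟨ε, hε, hball⟩ := Metric.eventually_nhds_iff_ball.1 (hΔ1.and hev)
  have hJ : ∀ x : ℝ × ℝ, x.1 ∈ Ioo (ξ - ε) (ξ + ε) → x.2 ∈ Ioo (ξ - ε) (ξ + ε) →
      0 < B.oΔ x.1 x.2 ∧ x ∈ Ioo a b ×ˢ Ioo a b := fun x h1 h2 => by
    refine hball x ?_
    rw [← ball_prod_same, Real.ball_eq_Ioo]
    exact ⟨h1, h2⟩
  have hsub : Icc (ξ - ε / 2) (ξ + ε / 2) ⊆ Ioo a b := fun s hs =>
    (hJ (s, s) ⟨by linarith [hs.1], by linarith [hs.2]⟩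
      ⟨by linarith [hs.1], by linarith [hs.2]⟩).2.1
  obtain ⟨ξ₀, hξ₀, htr⟩ := G.exists_transversal (by linarith) hsub
  have hneg := G.og_neg_of_transversal (hsub (Ioo_subset_Icc_self hξ₀)) htr
  set tri : Set (ℝ × ℝ) :=
    {x | x.1 ∈ Ioo (ξ - ε) (ξ + ε) ∧ x.2 ∈ Ioo (ξ - ε) (ξ + ε) ∧ x.1 < x.2} with htri
  have hconv : IsPreconnected tri := by
    refine Convex.isPreconnected ?_
    have h1 : Convex ℝ ((Prod.fst : ℝ × ℝ → ℝ) ⁻¹' Ioo (ξ - ε) (ξ + ε)) :=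
      (convex_Ioo _ _).linear_preimage (LinearMap.fst ℝ ℝ ℝ)
    have h2 : Convex ℝ ((Prod.snd : ℝ × ℝ → ℝ) ⁻¹' Ioo (ξ - ε) (ξ + ε)) :=
      (convex_Ioo _ _).linear_preimage (LinearMap.snd ℝ ℝ ℝ)
    have h3 : Convex ℝ {x : ℝ × ℝ | x.1 < x.2} := by
      have h : {x : ℝ × ℝ | x.1 < x.2} =
          (LinearMap.snd ℝ ℝ ℝ - LinearMap.fst ℝ ℝ ℝ : ℝ × ℝ →ₗ[ℝ] ℝ) ⁻¹' Ioi 0 := by ext x; simp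
      rw [h]
      exact (convex_Ioi (0 : ℝ)).linear_preimage _
    exact h1.inter (h2.inter h3)
  have hcont : ContinuousOn (fun x : ℝ × ℝ => B.og x.1 x.2) tri := fun x hx =>
    (continuousAt_og (G.continuousAt_of_ne (hJ x hx.1 hx.2.1).2 hx.2.2.ne)).continuousWithinAt
  have hpt : ∃ x ∈ tri, B.og x.1 x.2 < 0 := by
    have h1 : Tendsto (fun s : ℝ => (ξ₀, ξ₀ + s)) (𝓝[>] 0) (𝓝 (ξ₀, ξ₀)) := by
      have : Continuous fun s : ℝ => (ξ₀, ξ₀ + s) := by fun_prop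
      have h2 := this.tendsto 0
      rw [add_zero] at h2
      exact h2.mono_left nhdsWithin_le_nhds
    obtain ⟨s, hs1, hs2⟩ := ((h1.eventually hneg).and
      (Ioo_mem_nhdsGT (show (0 : ℝ) < ε / 2 by linarith))).exists
    exact ⟨_, ⟨⟨by linarith [hξ₀.1], by linarith [hξ₀.2]⟩,
      ⟨by linarith [hξ₀.1, hs2.1], by linarith [hξ₀.2, hs2.2]⟩, by simp [hs2.1]⟩, hs1⟩
  have htri_neg : ∀ x ∈ tri, B.og x.1 x.2 < 0 := by
    intro x hx
    by_contra hc
    push Not at hc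
    obtain ⟨x', hx', hx'n⟩ := hpt
    obtain ⟨z, hz, hz0⟩ := hconv.intermediate_value hx' hx hcont ⟨hx'n.le, hc⟩
    have h1 := hJ z hz.1 hz.2.1
    have h2 := G.og_sq h1.2.1 h1.2.2
    simp only at hz0
    rw [hz0] at h2
    have := h1.1
    nlinarith
  rw [Metric.eventually_nhds_iff_ball]
  refine ⟨ε, hε, fun x hx => ?_⟩
  rw [← ball_prod_same, Real.ball_eq_Ioo] at hx
  have h1 := (hJ x hx.1 hx.2).2
  rcases lt_trichotomy x.1 x.2 with h | h | h
  · exact htri_neg x ⟨hx.1, hx.2, h⟩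
  · rw [← h, G.og_diag h1.1]
    linarith [G.shell_pos h1.1]
  · rw [← G.og_symm h1.1 h1.2]
    exact htri_neg (x.2, x.1) ⟨hx.2, hx.1, h⟩

/-- The outer arc depends continuously on its endpoints. -/
theorem continuousAt_arc {x : ℝ × ℝ} (hx : x ∈ Ioo a b ×ˢ Ioo a b) :
    ContinuousAt (fun y : ℝ × ℝ => (B.oT y.1 y.2, B.oq y.1 y.2)) x := by
  refine G.tendsto_arc hx fun u hu hT he => ?_
  have hxe := G.injOn hx.1 hx.2 he
  have h1 : x = (x.1, x.1) := Prod.ext rfl hxe.symm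
  -- Along arcs of vanishing duration initial and final velocities would almost agree, and `og`
  -- would tend to `2 E - ω ^ 2 ‖γ‖ ^ 2 > 0`, against its sign near the diagonal.
  have h2 : Tendsto (fun y : ℝ × ℝ => B.og y.1 y.2) u
      (𝓝 (2 * B.E * B.oC 0 - B.ω ^ 2 * inner ℝ (B.γ x.1) (B.γ x.2))) := by
    have h3 : Tendsto (fun y : ℝ × ℝ => B.oC (B.oT y.1 y.2)) u (𝓝 (B.oC 0)) :=
      (B.outerPropagator.continuousC.tendsto 0).comp hT
    have h4 : Continuous fun y : ℝ × ℝ => B.ω ^ 2 * inner ℝ (B.γ y.1) (B.γ y.2) := by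
      have := B.continuous_γ
      fun_prop
    exact (h3.const_mul _).sub ((h4.tendsto x).mono_left hu)
  have h5 : ∀ᶠ y : ℝ × ℝ in u, B.og y.1 y.2 ≤ 0 :=
    hu (by rw [h1]; exact (G.og_neg_near_diagonal hx.1).mono fun y hy => hy.le)
  have h6 := le_of_tendsto h2 h5
  rw [B.outerPropagator.C_zero, ← hxe, real_inner_self_eq_norm_sq] at h6
  linarith [G.shell_pos hx.1]

lemma continuousOn_oT : ContinuousOn (fun x : ℝ × ℝ => B.oT x.1 x.2) (Ioo a b ×ˢ Ioo a b) :=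
  fun _ hx => (G.continuousAt_arc hx).fst.continuousWithinAt

lemma continuousOn_oq : ContinuousOn (fun x : ℝ × ℝ => B.oq x.1 x.2) (Ioo a b ×ˢ Ioo a b) :=
  fun _ hx => (G.continuousAt_arc hx).snd.continuousWithinAt

/-- The bound holds on the diagonal. By continuity on a connected square it could fail only after
the phase equals `π`, where the sine vanishes. -/
lemma oT_lt_pi {ξ₁ ξ₂ : ℝ} (h₁ : ξ₁ ∈ Ioo a b) (h₂ : ξ₂ ∈ Ioo a b) :
    B.ω * B.oT ξ₁ ξ₂ < Real.pi := by
  by_contra! hc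
  obtain ⟨y, hy0, hy, hTy, -⟩ := G.diagonal h₁
  have hconn : IsPreconnected (Ioo a b ×ˢ Ioo a b) := isPreconnected_Ioo.prod isPreconnected_Ioo
  obtain ⟨z, hz, hz0⟩ := hconn.intermediate_value (f := fun x : ℝ × ℝ => B.ω * B.oT x.1 x.2)
    (show (ξ₁, ξ₁) ∈ _ from ⟨h₁, h₁⟩) (show (ξ₁, ξ₂) ∈ _ from ⟨h₁, h₂⟩)
    (G.continuousOn_oT.const_mul _) ⟨show _ ≤ Real.pi by simp only; linarith, hc⟩
  refine G.sin_ne_zero hz.1 hz.2 ?_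
  simp only at hz0
  rw [hz0, Real.sin_pi]

lemma oS_pos {ξ₁ ξ₂ s : ℝ} (h₁ : ξ₁ ∈ Ioo a b) (h₂ : ξ₂ ∈ Ioo a b) (hs : 0 < s)
    (hs' : s ≤ B.oT ξ₁ ξ₂) : 0 < B.oS s := by
  have hω := B.ω_pos
  refine div_pos (Real.sin_pos_of_pos_of_lt_pi (by positivity) ?_) hω
  exact (mul_le_mul_of_nonneg_left hs' hω.le).trans_lt (G.oT_lt_pi h₁ h₂)

end GoodInterval

end RefractionBilliard

/-! ### Transversality and non-conjugacy of outer arcs. -/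

namespace RefractionBilliard

variable {B : RefractionBilliard}

/-- A nonzero vector normal to `n` is not normal to `i n`. -/
lemma inner_I_mul_ne_zero {n q : ℂ} (hn : n ≠ 0) (hq : q ≠ 0) (h : inner ℝ n q = (0 : ℝ)) :
    inner ℝ n (Complex.I * q) ≠ (0 : ℝ) := by
  intro h'
  simp only [Complex.inner] at h h'
  simp at h h'
  have h2 : Complex.normSq n * Complex.normSq q = 0 := by
    simp only [Complex.normSq_apply]
    linear_combination (q.re * n.re + q.im * n.im) * h +
      (q.im * n.re - q.re * n.im) * (-h')
  rcases mul_eq_zero.1 h2 with h3 | h3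
  · exact hn (Complex.normSq_eq_zero.1 h3)
  · exact hq (Complex.normSq_eq_zero.1 h3)

lemma normal_ne_zero (ξ : ℝ) : B.normal ξ ≠ 0 := by
  rw [← norm_ne_zero_iff, B.norm_normal]; exact one_ne_zero

namespace GoodInterval

variable {a b : ℝ} (G : B.GoodInterval a b)

include G

/-- What remains of the longer arc after the end of the shorter one is itself an outer arc, hence
the unique one. -/
lemma arc_tail {ξ₁ η η' : ℝ} (h₁ : ξ₁ ∈ Ioo a b) (h : η ∈ Ioo a b) (h' : η' ∈ Ioo a b)
    (hq : B.oq ξ₁ η = B.oq ξ₁ η') (hT : B.oT ξ₁ η < B.oT ξ₁ η') :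
    B.oT η η' = B.oT ξ₁ η' - B.oT ξ₁ η := by
  have hA := G.spec h₁ h
  have hA' := G.spec h₁ h'
  rw [← hq] at hA'
  have h0 : flow B.oC B.oS (B.γ ξ₁) (B.oq ξ₁ η) (B.oT ξ₁ η) = B.γ η := hA.end_eq
  have hfl : ∀ s, B.oflow (B.γ η) (B.ovel (B.γ ξ₁) (B.oq ξ₁ η) (B.oT ξ₁ η)) s =
      B.oflow (B.γ ξ₁) (B.oq ξ₁ η) (B.oT ξ₁ η + s) := fun s => by
    rw [oflow, oflow, B.outerPropagator.flow_add, h0]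
  refine (G.eq_oT h h' (T := B.oT ξ₁ η' - B.oT ξ₁ η)
    (q := B.ovel (B.γ ξ₁) (B.oq ξ₁ η) (B.oT ξ₁ η)) ⟨by linarith, ?_, fun s hs => ?_, ?_⟩).1.symm
  · rw [← hA.end_eq, B.outerPropagator.energy, hA.energy]
  · rw [hfl]
    exact hA'.outside _ ⟨by linarith [hA.pos, hs.1], by linarith [hs.2]⟩
  · rw [hfl, add_sub_cancel]
    exact hA'.end_eq

/-- Two nearby arcs with the same initial velocity but different durations would leave a short tail,
by continuity of the duration. Arcs joining points near `η₀` last at least half as long as the brake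
orbit, so there is no such tail. -/
lemma exists_injOn {ξ₁ η₀ : ℝ} (h₁ : ξ₁ ∈ Ioo a b) (h₀ : η₀ ∈ Ioo a b) :
    ∃ c d, η₀ ∈ Ioo c d ∧ Ioo c d ⊆ Ioo a b ∧ InjOn (B.oq ξ₁) (Ioo c d) := by
  set τ := B.oT η₀ η₀ with hτ
  have hτ0 : 0 < τ := G.oT_pos h₀ h₀
  have e1 : ∀ᶠ x : ℝ × ℝ in 𝓝 (η₀, η₀), τ / 2 < B.oT x.1 x.2 :=
    (G.continuousAt_arc (x := (η₀, η₀)) ⟨h₀, h₀⟩).fst.eventually (lt_mem_nhds (by simp only; linarith))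
  have e2 : ∀ᶠ η in 𝓝 η₀, |B.oT ξ₁ η - B.oT ξ₁ η₀| < τ / 4 := by
    have h2 : ContinuousAt (fun η => B.oT ξ₁ η) η₀ :=
      ContinuousAt.comp (f := fun η => (ξ₁, η)) (g := fun y : ℝ × ℝ => B.oT y.1 y.2)
        (G.continuousAt_arc (x := (ξ₁, η₀)) ⟨h₁, h₀⟩).fst (by fun_prop)
    exact Metric.tendsto_nhds.1 h2 (τ / 4) (by linarith)
  rw [nhds_prod_eq] at e1
  obtain ⟨U, hU, hUU⟩ := (eventually_prod_self_iff (r := fun u v => τ / 2 < B.oT u v)).1 e1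
  have e4 := (Filter.eventually_of_mem hU fun x hx => hx).and (e2.and (Ioo_mem_nhds h₀.1 h₀.2))
  obtain ⟨c, d, hcd, hsub⟩ := mem_nhds_iff_exists_Ioo_subset.1 e4
  refine ⟨c, d, hcd, fun x hx => (hsub hx).2.2, ?_⟩
  have key : ∀ η ∈ Ioo c d, ∀ η' ∈ Ioo c d, B.oq ξ₁ η = B.oq ξ₁ η' →
      ¬ B.oT ξ₁ η < B.oT ξ₁ η' := by
    intro η hη η' hη' hq hT
    obtain ⟨k1, k2, k3⟩ := hsub hη
    obtain ⟨k1', k2', k3'⟩ := hsub hη'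
    have h3 := G.arc_tail h₁ k3 k3' hq hT
    have h4 := hUU η k1 η' k1'
    rw [abs_lt] at k2 k2'
    linarith [k2.1, k2.2, k2'.1, k2'.2]
  intro η hη η' hη' hq
  have hTT : B.oT ξ₁ η = B.oT ξ₁ η' :=
    le_antisymm (not_lt.1 (key η' hη' η hη hq.symm)) (not_lt.1 (key η hη η' hη' hq))
  refine G.injOn (hsub hη).2.2 (hsub hη').2.2 ?_
  rw [← (G.spec h₁ (hsub hη).2.2).end_eq, ← (G.spec h₁ (hsub hη').2.2).end_eq, hq, hTT]

/-- The initial velocities of the arcs from `ξ₁` fill both sides of each of them. -/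
lemma exists_filter {ξ₁ η₀ : ℝ} (h₁ : ξ₁ ∈ Ioo a b) (h₀ : η₀ ∈ Ioo a b) {n : ℂ}
    (hn : inner ℝ n (Complex.I * B.oq ξ₁ η₀) ≠ (0 : ℝ)) :
    ∃ F : Filter ℝ, F.NeBot ∧ F ≤ 𝓝 η₀ ∧ ∃ (τ : ℝ → ℝ) (w : ℝ → ℂ) (w₀ : ℂ),
      Tendsto τ F (𝓝[>] 0) ∧ Tendsto w F (𝓝 w₀) ∧ inner ℝ n w₀ < (0 : ℝ) ∧
      ∀ᶠ η in F, B.oq ξ₁ η = B.oq ξ₁ η₀ + τ η • w η := by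
  obtain ⟨c, d, hcd, hsub, hinj⟩ := G.exists_injOn h₁ h₀
  refine exists_filter_of_circle (q := B.oq ξ₁) (r := √(2 * B.E - B.ω ^ 2 * ‖B.γ ξ₁‖ ^ 2)) hcd ?_
    hinj (Real.sqrt_pos.2 (G.shell_pos h₁)) (fun η hη => ?_) hn
  · exact G.continuousOn_oq.comp (f := fun η => (ξ₁, η)) (by fun_prop) fun η hη => ⟨h₁, hsub hη⟩
  · rw [← G.norm_sq_oq h₁ (hsub hη), Real.sqrt_sq (norm_nonneg _)]

/-- Outer arcs start transversally. -/
theorem inner_normal_oq_pos {ξ₁ ξ₂ : ℝ} (h₁ : ξ₁ ∈ Ioo a b) (h₂ : ξ₂ ∈ Ioo a b) :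
    0 < inner ℝ (B.normal ξ₁) (B.oq ξ₁ ξ₂) := by
  have hnn : ∀ η ∈ Ioo a b, 0 ≤ inner ℝ (B.normal ξ₁) (B.oq ξ₁ η) := by
    intro η hη
    by_contra! hc
    have hd := B.outerPropagator.hasDerivAt_flow (B.γ ξ₁) (B.oq ξ₁ η) 0
    rw [B.outerPropagator.flowVel_zero] at hd
    have h1 := eventually_after (B.eventually_cone_mem hc) hd (B.outerPropagator.flow_zero _ _)
    obtain ⟨s, hs, hs'⟩ := (h1.and (Ioo_mem_nhdsGT (G.oT_pos h₁ hη))).exists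
    exact (G.spec h₁ hη).outside s hs' hs
  rcases (hnn ξ₂ h₂).lt_or_eq with h | h
  · exact h
  exfalso
  -- A tangential velocity could be rotated to point into `D` while remaining the initial velocity
  -- of an arc, contradicting `hnn`.
  obtain ⟨F, hF, hFle, τ, w, w₀, hτ, hw, hw₀, heq⟩ := G.exists_filter h₁ h₂
    (inner_I_mul_ne_zero (normal_ne_zero ξ₁) (G.oq_ne_zero h₁ h₂) h.symm)
  have h3 : Tendsto (fun η => inner ℝ (B.normal ξ₁) (w η)) F (𝓝 (inner ℝ (B.normal ξ₁) w₀)) :=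
    tendsto_const_nhds.inner hw
  obtain ⟨η, k1, k2, k3, k4⟩ := (heq.and ((h3.eventually (gt_mem_nhds hw₀)).and
    ((hτ.eventually self_mem_nhdsWithin).and (hFle (Ioo_mem_nhds h₂.1 h₂.2))))).exists
  have h5 := hnn η k4
  rw [k1, inner_add_right, ← h, inner_smul_right, zero_add] at h5
  have : τ η * inner ℝ (B.normal ξ₁) (w η) < 0 := mul_neg_of_pos_of_neg k3 k2
  linarith

/-- Outer arcs end transversally. -/
theorem inner_normal_ovel_neg {ξ₁ ξ₂ : ℝ} (h₁ : ξ₁ ∈ Ioo a b) (h₂ : ξ₂ ∈ Ioo a b) :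
    inner ℝ (B.normal ξ₂) (B.ovel (B.γ ξ₁) (B.oq ξ₁ ξ₂) (B.oT ξ₁ ξ₂)) < 0 := by
  have h := G.inner_normal_oq_pos h₂ h₁
  rw [(G.symm h₁ h₂).2, inner_neg_right] at h
  linarith

/-- Rotating the initial velocity `q` displaces the position at time `s` to first order by a
multiple of `S s` times `i q`. If this were transversal to the boundary at the contact, one sense of
rotation would push a neighbouring arc into `D`. -/
lemma inner_I_eq_zero_of_touch {ξ₁ ξ₂ s ζ : ℝ} (h₁ : ξ₁ ∈ Ioo a b) (h₂ : ξ₂ ∈ Ioo a b)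
    (hs : s ∈ Ioo 0 (B.oT ξ₁ ξ₂)) (hζ : B.oflow (B.γ ξ₁) (B.oq ξ₁ ξ₂) s = B.γ ζ) :
    inner ℝ (B.normal ζ) (Complex.I * B.oq ξ₁ ξ₂) = (0 : ℝ) := by
  by_contra hn
  obtain ⟨F, hF, hFle, τ, w, w₀, hτ, hw, hw₀, heq⟩ := G.exists_filter h₁ h₂ hn
  have hS : 0 < B.oS s := G.oS_pos h₁ h₂ hs.1 hs.2.le
  have h1 : Tendsto (fun η => (ζ, B.oS s • w η, τ η)) F
      (𝓝 ζ ×ˢ 𝓝 (B.oS s • w₀) ×ˢ 𝓝[>] 0) :=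
    tendsto_const_nhds.prodMk ((hw.const_smul _).prodMk hτ)
  have h2 := h1.eventually (B.eventually_cone_mem (ξ₀ := ζ) (w₀ := B.oS s • w₀) (by
    rw [inner_smul_right]; exact mul_neg_of_pos_of_neg hS hw₀))
  have h3 : ContinuousAt (fun η => B.oT ξ₁ η) ξ₂ :=
    ContinuousAt.comp (f := fun η => (ξ₁, η)) (g := fun y : ℝ × ℝ => B.oT y.1 y.2)
      (G.continuousAt_arc (x := (ξ₁, ξ₂)) ⟨h₁, h₂⟩).fst (by fun_prop)
  obtain ⟨η, k1, k2, k3, k4⟩ := (heq.and (h2.and (((h3.mono_left hFle).eventually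
    (lt_mem_nhds hs.2)).and (hFle (Ioo_mem_nhds h₂.1 h₂.2))))).exists
  refine (G.spec h₁ k4).outside s ⟨hs.1, k3⟩ ?_
  have h5 : B.oflow (B.γ ξ₁) (B.oq ξ₁ η) s = B.γ ζ + τ η • B.oS s • w η := by
    rw [← hζ, k1]
    simp only [oflow, flow]
    module
  rw [h5]
  exact k2

/-- Outer arcs do not touch the boundary in their interior. -/
theorem notMem_closure {ξ₁ ξ₂ s : ℝ} (h₁ : ξ₁ ∈ Ioo a b) (h₂ : ξ₂ ∈ Ioo a b)
    (hs : s ∈ Ioo 0 (B.oT ξ₁ ξ₂)) : B.oflow (B.γ ξ₁) (B.oq ξ₁ ξ₂) s ∉ closure B.D := by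
  intro hcl
  obtain ⟨ζ, hζ⟩ := B.exists_γ_eq hcl ((G.spec h₁ h₂).outside s hs)
  have e1 := G.inner_I_eq_zero_of_touch h₁ h₂ hs hζ.symm
  have hend : flow B.oC B.oS (B.γ ξ₁) (B.oq ξ₁ ξ₂) (B.oT ξ₁ ξ₂) = B.γ ξ₂ := (G.spec h₁ h₂).end_eq
  obtain ⟨hsT, hsq⟩ := G.symm h₁ h₂
  -- The reversed arc has the same contact, so `i v` at the end is tangent there as well. As the end
  -- velocity combines `γ ξ₁` and `q` with non-zero coefficient on `γ ξ₁`, both endpoints lie on one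
  -- line through the origin.
  have e2 := G.inner_I_eq_zero_of_touch (s := B.oT ξ₁ ξ₂ - s) (ζ := ζ) h₂ h₁
    (by rw [hsT]; exact ⟨by linarith [hs.2], by linarith [hs.1]⟩) (by
      rw [hsq, oflow, ovel, ← hend, B.outerPropagator.flow_reverse, sub_sub_cancel]
      exact hζ.symm)
  rw [hsq, mul_neg, inner_neg_right, neg_eq_zero] at e2
  have hn := normal_ne_zero (B := B) ζ
  have hq := G.oq_ne_zero h₁ h₂
  have hS : 0 < B.oS (B.oT ξ₁ ξ₂) := G.oS_pos h₁ h₂ (G.oT_pos h₁ h₂) le_rfl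
  have hω := B.ω_pos
  -- all velocities and positions are parallel
  have e3 : inner ℝ (B.normal ζ) (Complex.I * B.γ ξ₁) = (0 : ℝ) := by
    have h3 : Complex.I * B.ovel (B.γ ξ₁) (B.oq ξ₁ ξ₂) (B.oT ξ₁ ξ₂) =
        (-B.ω ^ 2 * B.oS (B.oT ξ₁ ξ₂)) • (Complex.I * B.γ ξ₁) +
          B.oC (B.oT ξ₁ ξ₂) • (Complex.I * B.oq ξ₁ ξ₂) := by
      simp only [ovel, flowVel, mul_add, mul_smul_comm]
    rw [h3, inner_add_right, inner_smul_right, inner_smul_right, e1, mul_zero, add_zero] at e2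
    refine (mul_eq_zero.1 e2).resolve_left ?_
    have : 0 < B.ω ^ 2 * B.oS (B.oT ξ₁ ξ₂) := by positivity
    intro h; linarith
  have e4 : inner ℝ (B.normal ζ) (Complex.I * B.γ ξ₂) = (0 : ℝ) := by
    rw [← hend]
    simp only [flow, mul_add, mul_smul_comm]
    rw [inner_add_right, inner_smul_right, inner_smul_right, e1, e3]
    simp
  have hpar : ((starRingEnd ℂ) (B.γ ξ₁) * B.γ ξ₂).im = 0 := by
    simp only [Complex.inner] at e3 e4
    simp at e3 e4 ⊢
    set n := B.normal ζ
    set p := B.γ ξ₁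
    set p' := B.γ ξ₂
    have k1 : n.re * (p.re * p'.im - p.im * p'.re) = 0 := by
      linear_combination p'.re * e3 - p.re * e4
    have k2 : n.im * (p.re * p'.im - p.im * p'.re) = 0 := by
      linear_combination p'.im * e3 - p.im * e4
    rcases mul_eq_zero.1 k1 with h | h
    · rcases mul_eq_zero.1 k2 with h' | h'
      · exact absurd (Complex.ext h h') hn
      · linarith
    · linarith
  have hξ : ξ₁ = ξ₂ := by
    by_contra hne
    exact G.cross_ne_zero h₁ h₂ hne hpar
  subst hξ
  obtain ⟨y, hy0, hy, hTy, hqy, hflow, -⟩ := G.diagonal h₁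
  have hcos : 0 < Real.cos y := Real.cos_pos_of_mem_Ioo ⟨by linarith, hy⟩
  have hρ : 1 < Real.cos (B.ω * s - y) / Real.cos y := by
    refine (one_lt_div hcos).2 ?_
    rw [← Real.cos_abs (B.ω * s - y)]
    have h1 := mul_pos hω hs.1
    have h2 := mul_lt_mul_of_pos_left hs.2 hω
    refine Real.cos_lt_cos_of_nonneg_of_le_pi (abs_nonneg _) (by linarith) ?_
    rw [abs_lt]
    constructor <;> linarith
  rw [hflow] at hζ
  -- A contact of the brake orbit is also a contact of the ray with the boundary, so the normal
  -- would be orthogonal to both `γ ξ₁` and `i γ ξ₁`.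
  refine inner_I_mul_ne_zero hn (B.γ_ne_zero ξ₁) ?_ e3
  refine inner_normal_eq_zero_of_notMem (f := fun s : ℝ => s • B.γ ξ₁) ?_ hζ.symm ?_
  · simpa using (hasDerivAt_id (Real.cos (B.ω * s - y) / Real.cos y)).smul_const (B.γ ξ₁)
  · filter_upwards [lt_mem_nhds hρ] with s hs
    exact G.smul_notMem h₁ hs.le

/-- Distinct outer arcs from the same point have distinct initial velocities. -/
theorem injOn_oq {ξ₁ : ℝ} (h₁ : ξ₁ ∈ Ioo a b) : InjOn (B.oq ξ₁) (Ioo a b) := by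
  have key : ∀ η ∈ Ioo a b, ∀ η' ∈ Ioo a b, B.oq ξ₁ η = B.oq ξ₁ η' →
      ¬ B.oT ξ₁ η < B.oT ξ₁ η' := by
    intro η hη η' hη' hq hT
    -- The end of the shorter arc would be a boundary contact inside the longer one.
    refine G.notMem_closure h₁ hη' ⟨G.oT_pos h₁ hη, hT⟩ ?_
    rw [← hq, (G.spec h₁ hη).end_eq]
    exact B.γ_mem_closure η
  intro η hη η' hη' hq
  have hTT : B.oT ξ₁ η = B.oT ξ₁ η' :=
    le_antisymm (not_lt.1 (key η' hη' η hη hq.symm)) (not_lt.1 (key η hη η' hη' hq))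
  refine G.injOn hη hη' ?_
  rw [← (G.spec h₁ hη).end_eq, ← (G.spec h₁ hη').end_eq, hq, hTT]

/-- Outer arcs are never conjugate. -/
theorem og_ne_zero {ξ₁ ξ₂ : ℝ} (h₁ : ξ₁ ∈ Ioo a b) (h₂ : ξ₂ ∈ Ioo a b) : B.og ξ₁ ξ₂ ≠ 0 := by
  intro h0
  have hE := B.E_pos
  -- At a zero of `og` the function `oΔ = og ^ 2` has a minimum. Its explicit derivative then
  -- vanishes, which says that the initial velocity `q` is orthogonal to the tangent at the end.
  have hmin : IsLocalMin (fun η => B.oΔ ξ₁ η) ξ₂ := by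
    filter_upwards [Ioo_mem_nhds h₂.1 h₂.2] with η hη
    rw [← G.og_sq h₁ h₂, ← G.og_sq h₁ hη, h0, zero_pow two_ne_zero]
    exact sq_nonneg _
  have hγ := B.hasDerivAt_γ ξ₂
  have hm : HasDerivAt (fun η => (inner ℝ (B.γ ξ₁) (B.γ η) : ℝ))
      (inner ℝ (B.γ ξ₁) (B.tangent ξ₂)) ξ₂ := by
    simpa using (hasDerivAt_const ξ₂ (B.γ ξ₁)).inner ℝ hγ
  have hder := ((hγ.norm_sq.const_add (‖B.γ ξ₁‖ ^ 2)).const_mul (2 * B.E * B.ω ^ 2)).const_sub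
    (4 * B.E ^ 2) |>.add ((hm.pow 2).const_mul (B.ω ^ 4))
  have hz := hmin.hasDerivAt_eq_zero hder
  have hend : flow B.oC B.oS (B.γ ξ₁) (B.oq ξ₁ ξ₂) (B.oT ξ₁ ξ₂) = B.γ ξ₂ := (G.spec h₁ h₂).end_eq
  have hsm := smul_flow_start B.oC B.oS (B.γ ξ₁) (B.oq ξ₁ ξ₂) (B.oT ξ₁ ξ₂)
  rw [hend] at hsm
  have hg0 := h0
  rw [og] at h0
  have hS : 0 < B.oS (B.oT ξ₁ ξ₂) := G.oS_pos h₁ h₂ (G.oT_pos h₁ h₂) le_rfl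
  have hω := B.ω_pos
  have hqt : inner ℝ (B.oq ξ₁ ξ₂) (B.tangent ξ₂) = (0 : ℝ) := by
    have h3 : B.oS (B.oT ξ₁ ξ₂) * inner ℝ (B.oq ξ₁ ξ₂) (B.tangent ξ₂) =
        inner ℝ (B.γ ξ₂) (B.tangent ξ₂) -
          B.oC (B.oT ξ₁ ξ₂) * inner ℝ (B.γ ξ₁) (B.tangent ξ₂) := by
      rw [← real_inner_smul_left, hsm, inner_sub_left, real_inner_smul_left]
    have h4 : (4 * B.E * B.ω ^ 2) * (B.oS (B.oT ξ₁ ξ₂) *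
        inner ℝ (B.oq ξ₁ ξ₂) (B.tangent ξ₂)) = 0 := by
      rw [h3]
      rw [show (2 - 1 : ℕ) = 1 from rfl, pow_one] at hz
      push_cast at hz
      linear_combination -hz - 2 * B.ω ^ 2 * inner ℝ (B.γ ξ₁) (B.tangent ξ₂) * h0
    have h5 := (mul_eq_zero.1 h4).resolve_left (by positivity)
    exact (mul_eq_zero.1 h5).resolve_left hS.ne'
  have hgq := G.inner_ovel h₁ h₂
  rw [hg0] at hgq
  have hneg := G.inner_normal_ovel_neg h₁ h₂
  have hnt := B.inner_normal_tangent ξ₂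
  have hq := G.oq_ne_zero h₁ h₂
  set v := B.ovel (B.γ ξ₁) (B.oq ξ₁ ξ₂) (B.oT ξ₁ ξ₂)
  set q := B.oq ξ₁ ξ₂
  set t := B.tangent ξ₂
  set n := B.normal ξ₂
  -- Both the tangent and the final velocity are orthogonal to `q ≠ 0`, hence parallel, against the
  -- transversal arrival.
  have hnv : inner ℝ n v = (0 : ℝ) := by
    have ht := B.norm_tangent ξ₂
    have ht0 : t ≠ 0 := by rw [← norm_ne_zero_iff, ht]; exact one_ne_zero
    simp only [Complex.inner] at hqt hgq hnt ⊢
    simp at hqt hgq hnt ⊢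
    have k0 : q.re * (t.re * v.im - t.im * v.re) = 0 := by
      linear_combination v.im * hqt - t.im * hgq
    have k1 : q.im * (t.re * v.im - t.im * v.re) = 0 := by
      linear_combination t.re * hgq - v.re * hqt
    have k2 : t.re * v.im - t.im * v.re = 0 := by
      rcases mul_eq_zero.1 k0 with h | h
      · rcases mul_eq_zero.1 k1 with h' | h'
        · exact absurd (Complex.ext h h') hq
        · exact h'
      · exact h
    have k3 : t.re * (v.re * n.re + v.im * n.im) = 0 := by
      linear_combination v.re * hnt + n.im * k2
    have k4 : t.im * (v.re * n.re + v.im * n.im) = 0 := by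
      linear_combination v.im * hnt - n.re * k2
    rcases mul_eq_zero.1 k3 with h | h
    · rcases mul_eq_zero.1 k4 with h' | h'
      · exact absurd (Complex.ext h h') ht0
      · exact h'
    · exact h
  rw [hnv] at hneg
  exact lt_irrefl _ hneg

end GoodInterval

end RefractionBilliard

/-! ### Jacobi length of outer arcs. -/

namespace RefractionBilliard

variable {B : RefractionBilliard}

/-- A virial identity: `‖v‖ ^ 2` is the derivative of `e s / 2 + ⟨z, v⟩ / 2`. The boundary terms are
then expressed through the endpoints. -/
lemma Propagator.integral_norm_flowVel_sq {κ : ℝ} {C S : ℝ → ℝ} (P : Propagator κ C S) {p q : ℂ}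
    {T e : ℝ} (he : ‖q‖ ^ 2 - κ * ‖p‖ ^ 2 = e) (hS : S T ≠ 0) :
    ∫ s in (0 : ℝ)..T, ‖flowVel κ C S p q s‖ ^ 2 =
      e * T / 2 + (C T * (‖p‖ ^ 2 + ‖flow C S p q T‖ ^ 2) - 2 * inner ℝ p (flow C S p q T)) /
        (2 * S T) := by
  have hder : ∀ s, HasDerivAt
      (fun s => e * s / 2 + inner ℝ (flow C S p q s) (flowVel κ C S p q s) / 2)
      (‖flowVel κ C S p q s‖ ^ 2) s := by
    intro s
    have h1 := (P.hasDerivAt_flow p q s).inner ℝ (P.hasDerivAt_flowVel p q s)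
    refine ((((hasDerivAt_id' s).const_mul e).div_const 2).add (h1.div_const 2)).congr_deriv ?_
    have h2 := P.energy p q s
    rw [inner_smul_right, real_inner_self_eq_norm_sq, real_inner_self_eq_norm_sq]
    linarith
  have hcont : Continuous fun s => ‖flowVel κ C S p q s‖ ^ 2 := by
    have h1 : Continuous fun s => flowVel κ C S p q s :=
      continuous_iff_continuousAt.2 fun s => (P.hasDerivAt_flowVel p q s).continuousAt
    fun_prop
  rw [intervalIntegral.integral_eq_sub_of_hasDerivAt (fun s _ => hder s)
    (hcont.intervalIntegrable _ _)]
  have h1 := smul_flow_start C S p q T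
  have h2 := P.smul_vel_end p q T
  have h3 : S T * inner ℝ p q = inner ℝ p (flow C S p q T) - C T * ‖p‖ ^ 2 := by
    rw [← inner_smul_right, h1, inner_sub_right, inner_smul_right, real_inner_self_eq_norm_sq]
  have h4 : S T * inner ℝ (flow C S p q T) (flowVel κ C S p q T) =
      C T * ‖flow C S p q T‖ ^ 2 - inner ℝ p (flow C S p q T) := by
    rw [← inner_smul_right, h2, inner_sub_right, inner_smul_right, real_inner_self_eq_norm_sq,
      real_inner_comm p]
  rw [P.flow_zero, P.flowVel_zero]
  field_simp
  linear_combination h4 - h3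

namespace GoodInterval

variable {a b : ℝ} (G : B.GoodInterval a b)

include G

/-- At zero energy `√V = ‖v‖ / √2`, so the Jacobi length is the integral of `‖v‖ ^ 2` divided by
`√2`, a function of the duration and the endpoints only. -/
lemma outerLength_eq {ξ₁ ξ₂ : ℝ} (h₁ : ξ₁ ∈ Ioo a b) (h₂ : ξ₂ ∈ Ioo a b) :
    B.outerLength ξ₁ ξ₂ = (2 * B.E * B.oT ξ₁ ξ₂ / 2 +
      (B.oC (B.oT ξ₁ ξ₂) * (‖B.γ ξ₁‖ ^ 2 + ‖B.γ ξ₂‖ ^ 2) - 2 * inner ℝ (B.γ ξ₁) (B.γ ξ₂)) /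
        (2 * B.oS (B.oT ξ₁ ξ₂))) / √2 := by
  have hA := G.spec h₁ h₂
  have H : ∃ p : ℝ × (ℝ → ℂ) × (ℝ → ℂ), B.IsOuterArc ξ₁ ξ₂ p.1 p.2.1 p.2.2 :=
    ⟨(_, _, _), hA.isOuterArc⟩
  rw [outerLength, dif_pos H]
  have hspec := Classical.choose_spec H
  set T := (Classical.choose H).1
  set z := (Classical.choose H).2.1
  set v := (Classical.choose H).2.2
  obtain ⟨hO, hflow⟩ := hspec.oArc
  obtain ⟨hT, hv⟩ := G.eq_oT h₁ h₂ hO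
  have hend : flow B.oC B.oS (B.γ ξ₁) (B.oq ξ₁ ξ₂) (B.oT ξ₁ ξ₂) = B.γ ξ₂ := hA.end_eq
  have h0 : ∫ s in (0 : ℝ)..T, ‖v s‖ * √(B.outerPotential (z s)) =
      ∫ s in (0 : ℝ)..T, ‖flowVel (-B.ω ^ 2) B.oC B.oS (B.γ ξ₁) (B.oq ξ₁ ξ₂) s‖ ^ 2 / √2 := by
    refine intervalIntegral.integral_congr fun s hs => ?_
    rw [uIcc_of_le hO.pos.le] at hs
    have h3 := hspec.solution.conservation s hs
    have h4 : B.outerPotential (z s) = ‖v s‖ ^ 2 / 2 := by linarith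
    rw [h4, Real.sqrt_div (sq_nonneg _), Real.sqrt_sq (norm_nonneg _), (hflow s hs).2, hv]
    ring
  rw [h0, intervalIntegral.integral_div, hT,
    B.outerPropagator.integral_norm_flowVel_sq hA.energy
      (G.oS_pos h₁ h₂ (G.oT_pos h₁ h₂) le_rfl).ne', hend]

/-- The derivative of the outer length is the tangential component of the final velocity. -/
theorem hasDerivAt_outerLength {ξ₁ ξ₂ : ℝ} (h₁ : ξ₁ ∈ Ioo a b) (h₂ : ξ₂ ∈ Ioo a b) :
    HasDerivAt (fun x => B.outerLength ξ₁ x)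
      (inner ℝ (B.ovel (B.γ ξ₁) (B.oq ξ₁ ξ₂) (B.oT ξ₁ ξ₂)) (B.tangent ξ₂) / √2) ξ₂ := by
  have hγ := B.hasDerivAt_γ ξ₂
  have hm : HasDerivAt (fun η => (inner ℝ (B.γ ξ₁) (B.γ η) : ℝ))
      (inner ℝ (B.γ ξ₁) (B.tangent ξ₂)) ξ₂ := by
    simpa using (hasDerivAt_const ξ₂ (B.γ ξ₁)).inner ℝ hγ
  have hTc : ContinuousAt (fun η => B.oT ξ₁ η) ξ₂ :=
    ContinuousAt.comp (f := fun η => (ξ₁, η)) (g := fun y : ℝ × ℝ => B.oT y.1 y.2)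
      (G.continuousAt_arc (x := (ξ₁, ξ₂)) ⟨h₁, h₂⟩).fst (by fun_prop)
  have hS := G.oS_pos h₁ h₂ (G.oT_pos h₁ h₂) le_rfl
  have hE := B.E_pos
  have hω := B.ω_pos
  have hd := B.outerPropagator.hasDerivAt_length (e := 2 * B.E) (by
      have : 0 < B.ω ^ 2 := by positivity
      linarith) (by positivity)
    (hγ.norm_sq.const_add (‖B.γ ξ₁‖ ^ 2)) hm hTc (by
      filter_upwards [Ioo_mem_nhds h₂.1 h₂.2] with η hη using G.time_eq h₁ hη) hS.ne' (by
      have := G.og_ne_zero h₁ h₂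
      rw [og] at this
      rwa [neg_mul, ← sub_eq_add_neg])
  have hd' := (hd.div_const √2).congr_of_eventuallyEq (f₁ := fun x => B.outerLength ξ₁ x) (by
    filter_upwards [Ioo_mem_nhds h₂.1 h₂.2] with η hη using G.outerLength_eq h₁ hη)
  refine hd'.congr_deriv ?_
  have hend : flow B.oC B.oS (B.γ ξ₁) (B.oq ξ₁ ξ₂) (B.oT ξ₁ ξ₂) = B.γ ξ₂ := (G.spec h₁ h₂).end_eq
  have h3 := B.outerPropagator.smul_vel_end (B.γ ξ₁) (B.oq ξ₁ ξ₂) (B.oT ξ₁ ξ₂)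
  rw [hend] at h3
  have h4 : B.oS (B.oT ξ₁ ξ₂) *
      inner ℝ (B.ovel (B.γ ξ₁) (B.oq ξ₁ ξ₂) (B.oT ξ₁ ξ₂)) (B.tangent ξ₂) =
      B.oC (B.oT ξ₁ ξ₂) * inner ℝ (B.γ ξ₂) (B.tangent ξ₂) -
        inner ℝ (B.γ ξ₁) (B.tangent ξ₂) := by
    rw [← real_inner_smul_left, ovel, h3, inner_sub_left, real_inner_smul_left]
  congr 1
  rw [div_eq_iff (by positivity)]
  linear_combination (-2) * h4

end GoodInterval

end RefractionBilliard

namespace RefractionBilliard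

variable {B : RefractionBilliard}

/-! ### Inner arcs in the Levi-Civita plane -/

/-- A path in an open half-plane not containing the origin is topologically trivial. -/
lemma not_topologicallyNontrivial {T : ℝ} {z : ℝ → ℂ} (hT : 0 ≤ T)
    (hz : ContinuousOn z (Icc 0 T)) {c : ℂ} (hc : ∀ s ∈ Icc 0 T, 0 < (inner ℝ c (z s) : ℝ)) :
    ¬ TopologicallyNontrivial T z := by
  rintro ⟨-, hH⟩
  have hmem : ∀ t : unitInterval, T * t ∈ Icc 0 T := fun t =>
    ⟨mul_nonneg hT t.2.1, mul_le_of_le_one_right hT t.2.2⟩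
  have hzc : Continuous fun t : unitInterval => z (T * t) :=
    hz.comp_continuous (by fun_prop) hmem
  have hl : Continuous fun t : unitInterval => AffineMap.lineMap (z 0) (z T) (t : ℝ) :=
    AffineMap.lineMap_continuous.comp continuous_subtype_val
  refine hH ⟨⟨fun x => (1 - (x.1 : ℝ)) • z (T * x.2) +
    (x.1 : ℝ) • AffineMap.lineMap (z 0) (z T) (x.2 : ℝ), ?_⟩, ?_, ?_, ?_, ?_, ?_⟩
  · exact ((by fun_prop : Continuous fun x : unitInterval × unitInterval => 1 - (x.1 : ℝ)).smul
      (hzc.comp continuous_snd)).add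
      ((by fun_prop : Continuous fun x : unitInterval × unitInterval => (x.1 : ℝ)).smul
        (hl.comp continuous_snd))
  · rintro ⟨u, t⟩ h0
    have hpos : ∀ {x y : ℝ} {t : unitInterval}, 0 < x → 0 < y →
        0 < (1 - (t : ℝ)) * x + t * y := by
      intro x y t hx hy
      have h1 := t.2.1
      have h2 := t.2.2
      rcases h1.lt_or_eq with h | h
      · have := mul_pos h hy
        have := mul_nonneg (sub_nonneg.2 h2) hx.le
        linarith
      · rw [← h]; linarith
    have h1 : 0 < (inner ℝ c (AffineMap.lineMap (z 0) (z T) (t : ℝ)) : ℝ) := by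
      rw [AffineMap.lineMap_apply_module, inner_add_right, inner_smul_right, inner_smul_right]
      exact hpos (hc 0 ⟨le_rfl, hT⟩) (hc T ⟨hT, le_rfl⟩)
    have h2 := hpos (t := u) (hc _ (hmem t)) h1
    have h3 := congrArg (fun x => (inner ℝ c x : ℝ)) h0
    simp only [ContinuousMap.coe_mk, inner_add_right, inner_smul_right, inner_zero_right] at h3
    linarith
  · intro t; simp
  · intro t; simp
  · intro u
    simp [AffineMap.lineMap_apply_module]
    ring
  · intro u
    simp [AffineMap.lineMap_apply_module]
    ring

/-- The half-angle formula: the inner product of square roots is determined by the endpoints up to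
sign. -/
lemma inner_sq_eq (w₁ w₂ : ℂ) : (inner ℝ w₁ w₂ : ℝ) ^ 2 =
    (‖w₁ ^ 2‖ * ‖w₂ ^ 2‖ + inner ℝ (w₁ ^ 2) (w₂ ^ 2)) / 2 := by
  rw [norm_pow, norm_pow, Complex.sq_norm, Complex.sq_norm, Complex.normSq_apply,
    Complex.normSq_apply]
  simp only [Complex.inner, pow_two]
  simp
  ring

/-- The equality case of Cauchy–Schwarz for `p₁` and `-p₂` would put the origin on the segment. -/
lemma norm_mul_add_inner_pos {p₁ p₂ : ℂ} (h : (0 : ℂ) ∉ segment ℝ p₁ p₂) :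
    0 < ‖p₁‖ * ‖p₂‖ + inner ℝ p₁ p₂ := by
  by_contra! hc
  have h1 : inner ℝ p₁ (-p₂) = ‖p₁‖ * ‖-p₂‖ := by
    refine le_antisymm (real_inner_le_norm _ _) ?_
    rw [norm_neg, inner_neg_right]; linarith
  rw [inner_eq_norm_mul_iff_real, norm_neg, smul_neg] at h1
  have hp₁ : p₁ ≠ 0 := fun h0 => h (h0 ▸ left_mem_segment ℝ _ _)
  have hs : 0 < ‖p₁‖ + ‖p₂‖ := by
    have := norm_pos_iff.2 hp₁; positivity
  refine h ⟨‖p₂‖ / (‖p₁‖ + ‖p₂‖), ‖p₁‖ / (‖p₁‖ + ‖p₂‖), by positivity, by positivity, ?_, ?_⟩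
  · field_simp; ring
  · have h2 : (‖p₂‖ / (‖p₁‖ + ‖p₂‖)) • p₁ = (1 / (‖p₁‖ + ‖p₂‖)) • ‖p₂‖ • p₁ := by
      rw [smul_smul]; congr 1; ring
    have h3 : (‖p₁‖ / (‖p₁‖ + ‖p₂‖)) • p₂ = (1 / (‖p₁‖ + ‖p₂‖)) • ‖p₁‖ • p₂ := by
      rw [smul_smul]; congr 1; ring
    rw [h2, h3, h1, smul_neg, neg_add_cancel]

lemma iS_pos {h : ℝ} (hh : 0 < h) {s : ℝ} (hs : 0 < s) : 0 < B.iS h s := by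
  have := Real.sqrt_pos.2 (B.innerκ_pos hh)
  exact div_pos (Real.sinh_pos_iff.2 (by positivity)) this

lemma one_lt_iC {h : ℝ} (hh : 0 < h) {s : ℝ} (hs : 0 < s) : 1 < B.iC h s := by
  have := Real.sqrt_pos.2 (B.innerκ_pos hh)
  exact Real.one_lt_cosh.2 (by positivity)

lemma Propagator.flow_eq_comb {κ : ℝ} {C S : ℝ → ℝ} (P : Propagator κ C S) (p q : ℂ) {τ : ℝ}
    (hS : S τ ≠ 0) (s : ℝ) :
    flow C S p q s = (S (τ - s) / S τ) • p + (S s / S τ) • flow C S p q τ := by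
  have h1 := (P.add τ (-s)).2
  rw [(P.neg s).1, (P.neg s).2, ← sub_eq_add_neg] at h1
  have hS' : (S τ : ℂ) ≠ 0 := by exact_mod_cast hS
  rw [h1]
  simp only [flow, Complex.real_smul]
  push_cast
  field_simp
  ring

/-- In the Levi-Civita plane, inner arcs join opposite square roots of their endpoints. -/
lemma IsInnerArc.exists_lc {h ξ₁ ξ₂ T : ℝ} {z v : ℝ → ℂ} (hA : B.IsInnerArc h ξ₁ ξ₂ T z v)
    (hh : 0 < h) (hseg : (0 : ℂ) ∉ segment ℝ (B.γ ξ₁) (B.γ ξ₂))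
    {w₁ q : ℂ} (hw₁ : w₁ ^ 2 = B.γ ξ₁)
    (hq : q = v 0 * (starRingEnd ℂ) w₁ / 2) :
    ∃ τ, 0 < τ ∧ lcTime (flow (B.iC h) (B.iS h) w₁ q) τ = T ∧
      (∀ s ∈ Icc 0 τ, lcTime (flow (B.iC h) (B.iS h) w₁ q) s ∈ Icc 0 T) ∧
      (∀ s ∈ Icc 0 τ, z (lcTime (flow (B.iC h) (B.iS h) w₁ q) s) =
        flow (B.iC h) (B.iS h) w₁ q s ^ 2) ∧
      flow (B.iC h) (B.iS h) w₁ q τ ^ 2 = B.γ ξ₂ ∧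
      ‖q‖ ^ 2 - B.innerκ h * ‖w₁‖ ^ 2 = B.μ / 2 ∧
      (inner ℝ w₁ (flow (B.iC h) (B.iS h) w₁ q τ) : ℝ) < 0 := by
  have P := B.innerPropagator hh
  have hz0 : z 0 ≠ 0 := by rw [hA.start_eq]; exact B.γ_ne_zero _
  have hw₁' : w₁ ^ 2 = z 0 := by rw [hw₁, hA.start_eq]
  obtain ⟨τ, hτ, hτT, hrange, heq⟩ := hA.solution.exists_lc hA.pos hz0 (fun s hs he =>
    B.γ_notMem ξ₁ (by rw [← hA.start_eq, ← he]; exact hA.inside s hs)) (B.innerκ_pos hh) P hw₁' hq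
  have he : ‖q‖ ^ 2 - B.innerκ h * ‖w₁‖ ^ 2 = B.μ / 2 := by
    rw [hq]; exact hA.solution.energy_lc hA.pos.le hz0 hw₁'
  have hw₂ : flow (B.iC h) (B.iS h) w₁ q τ ^ 2 = B.γ ξ₂ := by
    rw [← heq τ ⟨hτ.le, le_rfl⟩, hτT, hA.end_eq]
  refine ⟨τ, hτ, hτT, hrange, heq, hw₂, he, ?_⟩
  set w := flow (B.iC h) (B.iS h) w₁ q with hw
  set w₂ := w τ with hw₂'
  have hne : (inner ℝ w₁ w₂ : ℝ) ≠ 0 := by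
    intro h0
    have h1 := inner_sq_eq w₁ w₂
    rw [h0, hw₁, hw₂] at h1
    have := norm_mul_add_inner_pos hseg
    linarith
  by_contra hc
  have hpos : 0 < (inner ℝ w₁ w₂ : ℝ) := lt_of_le_of_ne (not_lt.1 hc) hne.symm
  -- A positive inner product is to be excluded. For equal endpoints the roots would coincide, and
  -- the time equation fails because `iC > 1` at positive time.
  by_cases hξ : ξ₁ = ξ₂
  · have h1 : w₂ = w₁ := by
      have h2 : w₂ ^ 2 = w₁ ^ 2 := by rw [hw₂, hw₁, hξ]
      rcases sq_eq_sq_iff_eq_or_eq_neg.1 h2 with h3 | h3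
      · exact h3
      · rw [h3, inner_neg_right, real_inner_self_eq_norm_sq] at hpos
        nlinarith [sq_nonneg ‖w₁‖]
    have h2 := P.time_equation (T := τ) he
    change ‖w₁‖ ^ 2 + ‖w₂‖ ^ 2 - 2 * B.iC h τ * inner ℝ w₁ w₂ = _ at h2
    rw [h1, real_inner_self_eq_norm_sq] at h2
    rw [h1, real_inner_self_eq_norm_sq] at hpos
    have h3 := one_lt_iC (B := B) hh hτ
    have h4 := B.μ_pos
    have h5 : 0 ≤ B.μ / 2 * B.iS h τ ^ 2 := by positivity
    nlinarith
  -- The path is a nonnegative combination of roots `w₁`, `w₂` with positive inner product, so its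
  -- square stays in the open half-plane with normal `w₁ w₂`.
  · refine not_topologicallyNontrivial hA.pos.le hA.solution.continuousOn (c := w₁ * w₂) ?_
      (hA.nontrivial hξ)
    intro s hs
    have hcont : ContinuousOn (lcTime w) (Icc 0 τ) := fun t _ =>
      (hasDerivAt_lcTime (P.continuous_flow w₁ q) t).continuousAt.continuousWithinAt
    obtain ⟨t, ht, rfl⟩ := intermediate_value_Icc hτ.le hcont
      (show s ∈ Icc (lcTime w 0) (lcTime w τ) by rwa [lcTime_zero, hτT])
    rw [heq t ht, hw, P.flow_eq_comb w₁ q (iS_pos hh hτ).ne' t, ← hw, ← hw₂']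
    have hSτ := iS_pos (B := B) hh hτ
    have hA0 : 0 ≤ B.iS h (τ - t) / B.iS h τ := by
      rcases ht.2.lt_or_eq with h1 | h1
      · exact (div_pos (iS_pos hh (by linarith)) hSτ).le
      · rw [h1, sub_self, P.S_zero, zero_div]
    have hB0 : 0 ≤ B.iS h t / B.iS h τ := by
      rcases ht.1.lt_or_eq with h1 | h1
      · exact (div_pos (iS_pos hh h1) hSτ).le
      · rw [← h1, P.S_zero, zero_div]
    have hAB : 0 < B.iS h (τ - t) / B.iS h τ ∨ 0 < B.iS h t / B.iS h τ := by
      rcases ht.1.lt_or_eq with h1 | h1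
      · exact Or.inr (div_pos (iS_pos hh h1) hSτ)
      · left; rw [← h1, sub_zero]; exact div_pos hSτ hSτ
    set A := B.iS h (τ - t) / B.iS h τ
    set A' := B.iS h t / B.iS h τ
    have h1 : w₁ ≠ 0 := by rintro h1; rw [h1, inner_zero_left] at hpos; exact lt_irrefl _ hpos
    have h2 : w₂ ≠ 0 := by rintro h1; rw [h1, inner_zero_right] at hpos; exact lt_irrefl _ hpos
    have h3 : (inner ℝ (w₁ * w₂) ((A • w₁ + A' • w₂) ^ 2) : ℝ) =
        A ^ 2 * (‖w₁‖ ^ 2 * inner ℝ w₁ w₂) + 2 * A * A' * (‖w₁‖ ^ 2 * ‖w₂‖ ^ 2) +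
          A' ^ 2 * (‖w₂‖ ^ 2 * inner ℝ w₁ w₂) := by
      rw [Complex.sq_norm, Complex.sq_norm, Complex.normSq_apply, Complex.normSq_apply]
      simp only [Complex.inner, pow_two]
      simp
      ring
    rw [h3]
    have h4 := norm_pos_iff.2 h1
    have h5 := norm_pos_iff.2 h2
    rcases hAB with h6 | h6 <;> positivity

end RefractionBilliard

namespace RefractionBilliard

variable (B : RefractionBilliard)

/-! ### Explicit inner arcs -/

/-- The inner product of the chosen square roots of the endpoints. -/
def iM (ξ₁ ξ₂ : ℝ) : ℝ := -√((‖B.γ ξ₁‖ * ‖B.γ ξ₂‖ + inner ℝ (B.γ ξ₁) (B.γ ξ₂)) / 2)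

/-- The discriminant of the equation for the duration of the inner arc. -/
def iDisc (h ξ₁ ξ₂ : ℝ) : ℝ := B.innerκ h ^ 2 * B.iM ξ₁ ξ₂ ^ 2 + (B.μ / 2) ^ 2 +
  B.μ / 2 * B.innerκ h * (‖B.γ ξ₁‖ + ‖B.γ ξ₂‖)

/-- The value of `iC` at the Levi-Civita duration of the inner arc. -/
def iCv (h ξ₁ ξ₂ : ℝ) : ℝ := (-(B.innerκ h * B.iM ξ₁ ξ₂) + √(B.iDisc h ξ₁ ξ₂)) / (B.μ / 2)

/-- The value of `iS` at the Levi-Civita duration of the inner arc. -/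
def iSv (h ξ₁ ξ₂ : ℝ) : ℝ := √((B.iCv h ξ₁ ξ₂ ^ 2 - 1) / B.innerκ h)

/-- The Levi-Civita duration of the inner arc. -/
def iτ (h ξ₁ ξ₂ : ℝ) : ℝ := Real.arsinh (√(B.innerκ h) * B.iSv h ξ₁ ξ₂) / √(B.innerκ h)

/-- The initial velocity of the inner arc. -/
def iV (h ξ₁ ξ₂ : ℝ) : ℂ := (2 / (B.iSv h ξ₁ ξ₂ * ‖B.γ ξ₁‖)) •
  ((1 / (2 * B.iM ξ₁ ξ₂)) • (‖B.γ ξ₂‖ • B.γ ξ₁ + ‖B.γ ξ₁‖ • B.γ ξ₂) - B.iCv h ξ₁ ξ₂ • B.γ ξ₁)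

variable {B}

lemma iM_symm (ξ₁ ξ₂ : ℝ) : B.iM ξ₂ ξ₁ = B.iM ξ₁ ξ₂ := by
  rw [iM, iM, mul_comm ‖B.γ ξ₂‖, real_inner_comm]

lemma iCv_symm (h ξ₁ ξ₂ : ℝ) : B.iCv h ξ₂ ξ₁ = B.iCv h ξ₁ ξ₂ := by
  rw [iCv, iCv, iDisc, iDisc, iM_symm, add_comm ‖B.γ ξ₂‖]

lemma iSv_symm (h ξ₁ ξ₂ : ℝ) : B.iSv h ξ₂ ξ₁ = B.iSv h ξ₁ ξ₂ := by
  rw [iSv, iSv, iCv_symm]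

lemma iDisc_pos {h : ℝ} (hh : 0 < h) (ξ₁ ξ₂ : ℝ) : 0 < B.iDisc h ξ₁ ξ₂ := by
  have := B.innerκ_pos hh
  have := B.μ_pos
  unfold iDisc
  positivity

lemma iM_neg {ξ₁ ξ₂ : ℝ} (hseg : (0 : ℂ) ∉ segment ℝ (B.γ ξ₁) (B.γ ξ₂)) : B.iM ξ₁ ξ₂ < 0 := by
  have := norm_mul_add_inner_pos hseg
  unfold iM
  rw [neg_lt_zero]
  exact Real.sqrt_pos.2 (by linarith)

lemma one_lt_iCv {h : ℝ} (hh : 0 < h) {ξ₁ ξ₂ : ℝ} : 1 < B.iCv h ξ₁ ξ₂ := by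
  have hκ := B.innerκ_pos hh
  have hμ := B.μ_pos
  have hM : B.iM ξ₁ ξ₂ ≤ 0 := neg_nonpos.2 (Real.sqrt_nonneg _)
  have hN : 0 < ‖B.γ ξ₁‖ + ‖B.γ ξ₂‖ :=
    add_pos (norm_pos_iff.2 (B.γ_ne_zero _)) (norm_pos_iff.2 (B.γ_ne_zero _))
  rw [iCv, one_lt_div (by positivity)]
  have h1 : B.μ / 2 + B.innerκ h * B.iM ξ₁ ξ₂ < √(B.iDisc h ξ₁ ξ₂) := by
    refine Real.lt_sqrt_of_sq_lt ?_
    rw [iDisc]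
    have h2 := mul_pos (mul_pos hμ hκ) hN
    have h3 := mul_nonneg (mul_pos hμ hκ).le (neg_nonneg.2 hM)
    nlinarith
  linarith

lemma iSv_pos {h : ℝ} (hh : 0 < h) {ξ₁ ξ₂ : ℝ} : 0 < B.iSv h ξ₁ ξ₂ := by
  have h1 := one_lt_iCv (B := B) hh (ξ₁ := ξ₁) (ξ₂ := ξ₂)
  refine Real.sqrt_pos.2 (div_pos ?_ (B.innerκ_pos hh))
  nlinarith

/-- The Levi-Civita description of an inner arc with explicit data. -/
lemma IsInnerArc.explicit {h ξ₁ ξ₂ T : ℝ} {z v : ℝ → ℂ} (hA : B.IsInnerArc h ξ₁ ξ₂ T z v)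
    (hh : 0 < h) (hseg : (0 : ℂ) ∉ segment ℝ (B.γ ξ₁) (B.γ ξ₂)) {w₁ q : ℂ}
    (hw₁ : w₁ ^ 2 = B.γ ξ₁) (hq : q = v 0 * (starRingEnd ℂ) w₁ / 2) :
    0 < B.iτ h ξ₁ ξ₂ ∧ lcTime (flow (B.iC h) (B.iS h) w₁ q) (B.iτ h ξ₁ ξ₂) = T ∧
      (∀ s ∈ Icc 0 (B.iτ h ξ₁ ξ₂), lcTime (flow (B.iC h) (B.iS h) w₁ q) s ∈ Icc 0 T) ∧
      (∀ s ∈ Icc 0 (B.iτ h ξ₁ ξ₂), z (lcTime (flow (B.iC h) (B.iS h) w₁ q) s) =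
        flow (B.iC h) (B.iS h) w₁ q s ^ 2) ∧
      flow (B.iC h) (B.iS h) w₁ q (B.iτ h ξ₁ ξ₂) ^ 2 = B.γ ξ₂ ∧
      ‖q‖ ^ 2 - B.innerκ h * ‖w₁‖ ^ 2 = B.μ / 2 ∧
      inner ℝ w₁ (flow (B.iC h) (B.iS h) w₁ q (B.iτ h ξ₁ ξ₂)) = B.iM ξ₁ ξ₂ ∧
      B.iC h (B.iτ h ξ₁ ξ₂) = B.iCv h ξ₁ ξ₂ ∧ B.iS h (B.iτ h ξ₁ ξ₂) = B.iSv h ξ₁ ξ₂ := by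
  obtain ⟨τ, hτ, hτT, hrange, heq, hw₂, he, hneg⟩ := hA.exists_lc hh hseg hw₁ hq
  have P := B.innerPropagator hh
  have hκ := B.innerκ_pos hh
  have hμ := B.μ_pos
  have hM : inner ℝ w₁ (flow (B.iC h) (B.iS h) w₁ q τ) = B.iM ξ₁ ξ₂ := by
    rw [iM, ← hw₁, ← hw₂, ← inner_sq_eq, Real.sqrt_sq_eq_abs, abs_of_neg hneg, neg_neg]
  have hC : B.iC h τ = B.iCv h ξ₁ ξ₂ := by
    have h1 := P.time_equation (T := τ) he
    have h2 := P.sq τ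
    have h3 : ‖w₁‖ ^ 2 = ‖B.γ ξ₁‖ := by rw [← hw₁, norm_pow]
    have h4 : ‖flow (B.iC h) (B.iS h) w₁ q τ‖ ^ 2 = ‖B.γ ξ₂‖ := by rw [← hw₂, norm_pow]
    rw [h3, h4, hM] at h1
    have h5 : (B.μ / 2 * B.iC h τ + B.innerκ h * B.iM ξ₁ ξ₂) ^ 2 = B.iDisc h ξ₁ ξ₂ := by
      rw [iDisc]
      linear_combination (B.μ / 2) ^ 2 * h2 - B.μ / 2 * B.innerκ h * h1
    have hM0 : B.iM ξ₁ ξ₂ < 0 := hM ▸ hneg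
    have hC1 := one_lt_iC (B := B) hh hτ
    -- This selects the larger root of the quadratic equation for `iC`. By `h7` even the expression
    -- with `2 * iM` is positive, and `iM` is negative.
    have h6 : 0 < B.μ / 2 * B.iC h τ + B.innerκ h * B.iM ξ₁ ξ₂ := by
      have hN : 0 < ‖B.γ ξ₁‖ + ‖B.γ ξ₂‖ :=
        add_pos (norm_pos_iff.2 (B.γ_ne_zero _)) (norm_pos_iff.2 (B.γ_ne_zero _))
      have h7 : B.iC h τ * (B.μ / 2 * B.iC h τ + 2 * (B.innerκ h * B.iM ξ₁ ξ₂)) =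
          B.μ / 2 + B.innerκ h * (‖B.γ ξ₁‖ + ‖B.γ ξ₂‖) := by
        linear_combination B.μ / 2 * h2 - B.innerκ h * h1
      have h8 : 0 < B.μ / 2 * B.iC h τ + 2 * (B.innerκ h * B.iM ξ₁ ξ₂) := by
        by_contra! hc
        have h9 : 0 < B.μ / 2 + B.innerκ h * (‖B.γ ξ₁‖ + ‖B.γ ξ₂‖) := by positivity
        nlinarith
      nlinarith [mul_pos hκ (neg_pos.2 hM0)]
    rw [iCv, ← h5, Real.sqrt_sq h6.le]
    field_simp
    ring
  have hS0 := iS_pos (B := B) hh hτ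
  have hS : B.iS h τ = B.iSv h ξ₁ ξ₂ := by
    have h2 := P.sq τ
    rw [hC] at h2
    rw [iSv]
    have h4 : (B.iCv h ξ₁ ξ₂ ^ 2 - 1) / B.innerκ h = B.iS h τ ^ 2 := by
      rw [div_eq_iff hκ.ne']
      linarith
    rw [h4, Real.sqrt_sq hS0.le]
  have hτ' : B.iτ h ξ₁ ξ₂ = τ := by
    have h3 := Real.sqrt_pos.2 hκ
    rw [iτ, ← hS, iS, mul_div_cancel₀ _ h3.ne', Real.arsinh_sinh]
    field_simp
  rw [hτ']
  exact ⟨hτ, hτT, hrange, heq, hw₂, he, hM, hC, hS⟩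

end RefractionBilliard

/-! ### Boundary velocities of inner arcs. -/

namespace RefractionBilliard

variable {B : RefractionBilliard}

lemma inner_smul_mul_eq (w w' : ℂ) : (2 * inner ℝ w w' : ℝ) • (w * w') =
    ‖w' ^ 2‖ • w ^ 2 + ‖w ^ 2‖ • w' ^ 2 := by
  rw [norm_pow, norm_pow, Complex.sq_norm, Complex.sq_norm, Complex.normSq_apply,
    Complex.normSq_apply]
  apply Complex.ext
  · simp [pow_two, Complex.inner]; ring
  · simp [pow_two, Complex.inner]; ring

/-- The initial velocity in the plane, in terms of the initial velocity in the Levi-Civita plane. -/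
lemma velocity_formula {w w' u : ℂ} {S C M : ℝ} (hw : w ≠ 0) (hS : S ≠ 0) (hM : M ≠ 0)
    (hMw : inner ℝ w w' = M) (hu : S • u = w' - C • w) :
    (2 / (S * ‖w ^ 2‖)) • ((1 / (2 * M)) • (‖w' ^ 2‖ • w ^ 2 + ‖w ^ 2‖ • w' ^ 2) - C • w ^ 2) *
      (starRingEnd ℂ) w = 2 * u := by
  rw [← inner_smul_mul_eq, hMw, smul_smul, one_div_mul_cancel (by simpa using hM), one_smul]
  have h1 : w * w' - C • w ^ 2 = w * (S • u) := by
    rw [hu]; simp only [Complex.real_smul]; ring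
  have h2 : ((‖w ^ 2‖ : ℝ) : ℂ) = w * (starRingEnd ℂ) w := by
    rw [Complex.mul_conj, Complex.normSq_eq_norm_sq, norm_pow]
  have h3 : (starRingEnd ℂ) w ≠ 0 := by simpa using hw
  have hS' : (S : ℂ) ≠ 0 := by exact_mod_cast hS
  rw [h1]
  simp only [Complex.real_smul]
  push_cast
  rw [h2]
  field_simp

/-- Once the inner product of the two roots is known, their product is a combination of the
endpoints, so no choice of root is left. The formula at the end is the one at the start with the
endpoints exchanged, up to sign. -/
lemma IsInnerArc.velocity {h ξ₁ ξ₂ T : ℝ} {z v : ℝ → ℂ} (hA : B.IsInnerArc h ξ₁ ξ₂ T z v)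
    (hh : 0 < h) (hseg : (0 : ℂ) ∉ segment ℝ (B.γ ξ₁) (B.γ ξ₂)) :
    v 0 = B.iV h ξ₁ ξ₂ ∧ v T = -B.iV h ξ₂ ξ₁ := by
  obtain ⟨w₁, hw₁⟩ := exists_sq_eq (B.γ ξ₁)
  obtain ⟨hτ, hτT, hrange, heq, hw₂, he, hM, hC, hS⟩ := hA.explicit hh hseg hw₁ rfl
  set q := v 0 * (starRingEnd ℂ) w₁ / 2 with hq
  set τ := B.iτ h ξ₁ ξ₂ with hτ'
  have P := B.innerPropagator hh
  have hS0 := (iSv_pos (B := B) hh (ξ₁ := ξ₁) (ξ₂ := ξ₂)).ne'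
  have hM0 := (iM_neg hseg).ne
  set w₂ := flow (B.iC h) (B.iS h) w₁ q τ with hw₂'
  have hw₁0 : w₁ ≠ 0 := by
    rintro rfl; exact B.γ_ne_zero ξ₁ (by rw [← hw₁]; simp)
  have hw₂0 : w₂ ≠ 0 := by
    intro h0; exact B.γ_ne_zero ξ₂ (by rw [← hw₂, h0]; simp)
  constructor
  · have h1 := smul_flow_start (B.iC h) (B.iS h) w₁ q τ
    rw [hS, hC] at h1
    have h2 := velocity_formula hw₁0 hS0 hM0 hM h1
    rw [hw₁, hw₂] at h2
    have h3 : (starRingEnd ℂ) w₁ ≠ 0 := by simpa using hw₁0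
    refine mul_right_cancel₀ h3 ?_
    rw [iV, h2, hq]
    ring
  · have h1 := P.smul_vel_end w₁ q τ
    rw [hS, hC] at h1
    have h1' : B.iSv h ξ₁ ξ₂ • (-flowVel (B.innerκ h) (B.iC h) (B.iS h) w₁ q τ) =
        w₁ - B.iCv h ξ₁ ξ₂ • w₂ := by rw [smul_neg, h1, neg_sub]
    have h2 := velocity_formula hw₂0 hS0 hM0 ((real_inner_comm _ _).trans hM) h1'
    rw [hw₁, hw₂] at h2
    have h3 : (starRingEnd ℂ) w₂ ≠ 0 := by simpa using hw₂0
    refine mul_right_cancel₀ h3 ?_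
    have h4 := hA.solution.velocity_lc P hτ hrange heq ⟨hτ.le, le_rfl⟩ hw₂0
    rw [hτT] at h4
    rw [iV, iSv_symm, iM_symm, iCv_symm, neg_mul, h2, h4]
    ring

/-! ### The length of inner arcs -/

/-- Between two zeros the flow is `S` times the velocity at the first one, which would have to
vanish together with the position. An inner arc thus has at most one collision, negligible in the
length integral. -/
lemma Propagator.subsingleton_zeros {κ : ℝ} {C S : ℝ → ℝ} (P : Propagator κ C S) {p q : ℂ}
    (hS : ∀ s, 0 < s → 0 < S s) (he : 0 < ‖q‖ ^ 2 - κ * ‖p‖ ^ 2) :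
    {s | flow C S p q s = 0}.Subsingleton := by
  have key : ∀ s s', flow C S p q s = 0 → flow C S p q s' = 0 → ¬ s < s' := by
    intro s s' h h' hlt
    have h1 := P.flow_add p q s (s' - s)
    rw [add_sub_cancel, h', h, flow, smul_zero, zero_add] at h1
    have h2 := (smul_eq_zero.1 h1.symm).resolve_left (hS _ (by linarith)).ne'
    have h3 := P.energy p q s
    rw [h2, h, norm_zero] at h3
    linarith
  intro s hs s' hs'
  exact le_antisymm (not_lt.1 (key s' s hs' hs)) (not_lt.1 (key s s' hs hs'))

/-- In the Levi-Civita time the integrand becomes `4 / √2` times the squared speed of the linear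
flow, off the collision, because `‖v‖ ‖w‖ = 2 ‖w'‖`. -/
lemma innerLength_eq {h ξ₁ ξ₂ : ℝ} (hex : ∃ T z v, B.IsInnerArc h ξ₁ ξ₂ T z v)
    (hh : 0 < h) (hseg : (0 : ℂ) ∉ segment ℝ (B.γ ξ₁) (B.γ ξ₂)) :
    B.innerLength h ξ₁ ξ₂ = 4 / √2 * (B.μ / 2 * B.iτ h ξ₁ ξ₂ / 2 +
      (B.iC h (B.iτ h ξ₁ ξ₂) * (‖B.γ ξ₁‖ + ‖B.γ ξ₂‖) - 2 * B.iM ξ₁ ξ₂) /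
        (2 * B.iS h (B.iτ h ξ₁ ξ₂))) := by
  have H : ∃ p : ℝ × (ℝ → ℂ) × (ℝ → ℂ), B.IsInnerArc h ξ₁ ξ₂ p.1 p.2.1 p.2.2 := by
    obtain ⟨T, z, v, hA⟩ := hex
    exact ⟨(T, z, v), hA⟩
  rw [innerLength, dif_pos H]
  have hA := Classical.choose_spec H
  set T := (Classical.choose H).1
  set z := (Classical.choose H).2.1
  set v := (Classical.choose H).2.2
  obtain ⟨w₁, hw₁⟩ := exists_sq_eq (B.γ ξ₁)
  obtain ⟨hτ, hτT, hrange, heq, hw₂, he, hM, hC, hS⟩ := hA.explicit hh hseg hw₁ rfl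
  set q := v 0 * (starRingEnd ℂ) w₁ / 2 with hq
  set τ := B.iτ h ξ₁ ξ₂ with hτ'
  have P := B.innerPropagator hh
  set w := flow (B.iC h) (B.iS h) w₁ q with hw
  have he0 : 0 < ‖q‖ ^ 2 - B.innerκ h * ‖w₁‖ ^ 2 := he ▸ half_pos B.μ_pos
  have hmono := P.strictMono_lcTime he0
  have hder := hasDerivAt_lcTime (P.continuous_flow w₁ q)
  have himg : lcTime w '' Icc 0 τ = Icc 0 T := by
    refine Subset.antisymm (image_subset_iff.2 hrange) ?_
    have hcont : ContinuousOn (lcTime w) (Icc 0 τ) := fun t _ =>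
      (hder t).continuousAt.continuousWithinAt
    have := intermediate_value_Icc hτ.le hcont
    rwa [lcTime_zero, hτT] at this
  have hcv := MeasureTheory.integral_image_eq_integral_abs_deriv_smul (s := Icc 0 τ)
    measurableSet_Icc (fun s _ => (hder s).hasDerivWithinAt) hmono.injective.injOn
    (fun s => ‖v s‖ * √(B.innerPotential h (z s)))
  rw [himg, MeasureTheory.integral_Icc_eq_integral_Ioc,
    MeasureTheory.integral_Icc_eq_integral_Ioc] at hcv
  rw [intervalIntegral.integral_of_le hA.pos.le, hcv]
  have hae : ∀ᵐ s ∂(MeasureTheory.volume.restrict (Ioc 0 τ)),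
      |‖w s‖ ^ 2| • (‖v (lcTime w s)‖ * √(B.innerPotential h (z (lcTime w s)))) =
      4 / √2 * ‖flowVel (B.innerκ h) (B.iC h) (B.iS h) w₁ q s‖ ^ 2 := by
    have hz : ∀ᵐ s ∂(MeasureTheory.volume.restrict (Ioc 0 τ)), s ∉ {s | w s = 0} :=
      MeasureTheory.ae_restrict_of_ae (MeasureTheory.measure_eq_zero_iff_ae_notMem.1
        ((P.subsingleton_zeros (fun s hs => iS_pos hh hs) he0).measure_zero _))
    filter_upwards [hz, MeasureTheory.ae_restrict_mem measurableSet_Ioc] with s hs hsI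
    have hsI' : s ∈ Icc 0 τ := ⟨hsI.1.le, hsI.2⟩
    have h1 : z (lcTime w s) ≠ 0 := by rw [heq s hsI']; exact pow_ne_zero 2 hs
    have h2 := hA.solution.conservation _ (hrange s hsI') h1
    have h3 : B.innerPotential h (z (lcTime w s)) = ‖v (lcTime w s)‖ ^ 2 / 2 := by linarith
    have h4 := congrArg norm (hA.solution.velocity_lc P hτ hrange heq hsI' hs)
    rw [norm_mul, norm_mul, RCLike.norm_conj, Complex.norm_two] at h4
    rw [h3, Real.sqrt_div (sq_nonneg _), Real.sqrt_sq (norm_nonneg _), abs_of_nonneg (sq_nonneg _),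
      smul_eq_mul]
    have h5 : ‖w s‖ ^ 2 * (‖v (lcTime w s)‖ * (‖v (lcTime w s)‖ / √2)) =
        (‖v (lcTime w s)‖ * ‖w s‖) ^ 2 / √2 := by ring
    rw [h5, h4]
    ring
  rw [MeasureTheory.integral_congr_ae hae, ← intervalIntegral.integral_of_le hτ.le,
    intervalIntegral.integral_const_mul, P.integral_norm_flowVel_sq he (by
      rw [hS]; exact (iSv_pos hh).ne')]
  have h3 : ‖w₁‖ ^ 2 = ‖B.γ ξ₁‖ := by rw [← hw₁, norm_pow]
  have h4 : ‖flow (B.iC h) (B.iS h) w₁ q τ‖ ^ 2 = ‖B.γ ξ₂‖ := by rw [← hw₂, norm_pow]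
  rw [h3, h4, hM]

end RefractionBilliard

/-! ### Transversality and length derivative of inner arcs. -/

namespace RefractionBilliard

variable (B : RefractionBilliard)

/-- A pair of non-antipodal intervals of boundary parameters whose points are joined by inner
arcs. -/
structure InnerPair (h a b c d : ℝ) : Prop where
  pos : 0 < h
  injOn : InjOn B.γ (Ioo c d)
  notAntipodal : ∀ ξ₁ ∈ Ioo a b, ∀ ξ₂ ∈ Ioo c d, (0 : ℂ) ∉ segment ℝ (B.γ ξ₁) (B.γ ξ₂)
  arcs : ∀ ξ₁ ∈ Ioo a b, ∀ ξ₂ ∈ Ioo c d, ∃ T z v, B.IsInnerArc h ξ₁ ξ₂ T z v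

variable {B}

lemma continuous_iM : Continuous fun x : ℝ × ℝ => B.iM x.1 x.2 := by
  have := B.continuous_γ
  unfold iM
  fun_prop

lemma continuous_iCv (h : ℝ) : Continuous fun x : ℝ × ℝ => B.iCv h x.1 x.2 := by
  have := B.continuous_γ
  have := continuous_iM (B := B)
  unfold iCv iDisc
  fun_prop

lemma continuous_iSv (h : ℝ) : Continuous fun x : ℝ × ℝ => B.iSv h x.1 x.2 := by
  have := continuous_iCv (B := B) h
  unfold iSv
  fun_prop

lemma continuous_iτ (h : ℝ) : Continuous fun x : ℝ × ℝ => B.iτ h x.1 x.2 := by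
  have := continuous_iSv (B := B) h
  unfold iτ
  exact (Real.continuous_arsinh.comp (by fun_prop)).div_const _

namespace InnerPair

variable {h a b c d : ℝ} (G : B.InnerPair h a b c d)

include G

lemma continuousOn_iV : ContinuousOn (fun x : ℝ × ℝ => B.iV h x.1 x.2) (Ioo a b ×ˢ Ioo c d) := by
  have h1 := B.continuous_γ
  have h2 := continuous_iM (B := B)
  have h3 := continuous_iSv (B := B) h
  have h4 := continuous_iCv (B := B) h
  have k1 : Continuous fun x : ℝ × ℝ => B.iSv h x.1 x.2 * ‖B.γ x.1‖ := by fun_prop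
  have k2 : Continuous fun x : ℝ × ℝ => 2 * B.iM x.1 x.2 := by fun_prop
  have k3 : Continuous fun x : ℝ × ℝ => ‖B.γ x.2‖ • B.γ x.1 + ‖B.γ x.1‖ • B.γ x.2 := by fun_prop
  have k4 : Continuous fun x : ℝ × ℝ => B.iCv h x.1 x.2 • B.γ x.1 := by fun_prop
  exact (continuousOn_const.div k1.continuousOn fun x hx =>
      mul_ne_zero (iSv_pos G.pos).ne' (norm_ne_zero_iff.2 (B.γ_ne_zero _))).smul
    (((continuousOn_const.div k2.continuousOn fun x hx =>
      mul_ne_zero two_ne_zero (iM_neg (G.notAntipodal _ hx.1 _ hx.2)).ne).smul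
        k3.continuousOn).sub k4.continuousOn)

lemma norm_sq_iV {ξ₁ ξ₂ : ℝ} (h₁ : ξ₁ ∈ Ioo a b) (h₂ : ξ₂ ∈ Ioo c d) :
    ‖B.iV h ξ₁ ξ₂‖ ^ 2 / 2 - B.innerPotential h (B.γ ξ₁) = 0 := by
  obtain ⟨T, z, v, hA⟩ := G.arcs ξ₁ h₁ ξ₂ h₂
  have h1 := hA.solution.conservation 0 ⟨le_rfl, hA.pos.le⟩ (by
    rw [hA.start_eq]; exact B.γ_ne_zero _)
  rwa [(hA.velocity G.pos (G.notAntipodal ξ₁ h₁ ξ₂ h₂)).1, hA.start_eq] at h1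

lemma path {ξ₁ ξ₂ : ℝ} (h₁ : ξ₁ ∈ Ioo a b) (h₂ : ξ₂ ∈ Ioo c d) : 0 < B.iτ h ξ₁ ξ₂ ∧
    (∀ s ∈ Ioo 0 (B.iτ h ξ₁ ξ₂),
      keplerPath (B.iC h) (B.iS h) (B.γ ξ₁, B.iV h ξ₁ ξ₂) s ∈ B.D) ∧
    keplerPath (B.iC h) (B.iS h) (B.γ ξ₁, B.iV h ξ₁ ξ₂) (B.iτ h ξ₁ ξ₂) = B.γ ξ₂ := by
  obtain ⟨T, z, v, hA⟩ := G.arcs ξ₁ h₁ ξ₂ h₂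
  have hseg := G.notAntipodal ξ₁ h₁ ξ₂ h₂
  obtain ⟨w₁, hw₁⟩ := exists_sq_eq (B.γ ξ₁)
  obtain ⟨hτ, hτT, hrange, heq, hw₂, he, -⟩ := hA.explicit G.pos hseg hw₁ rfl
  rw [(hA.velocity G.pos hseg).1] at hτT heq hw₂ he
  have hmono := (B.innerPropagator G.pos).strictMono_lcTime (he ▸ half_pos B.μ_pos)
  refine ⟨hτ, fun s hs => ?_, ?_⟩
  · rw [keplerPath_eq_sq hw₁, ← heq s ⟨hs.1.le, hs.2.le⟩]
    refine hA.inside _ ⟨?_, ?_⟩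
    · rw [← lcTime_zero]; exact hmono hs.1
    · rw [← hτT]; exact hmono hs.2
  · rw [keplerPath_eq_sq hw₁, hw₂]

lemma values {ξ₁ ξ₂ : ℝ} (h₁ : ξ₁ ∈ Ioo a b) (h₂ : ξ₂ ∈ Ioo c d) :
    B.iC h (B.iτ h ξ₁ ξ₂) = B.iCv h ξ₁ ξ₂ ∧ B.iS h (B.iτ h ξ₁ ξ₂) = B.iSv h ξ₁ ξ₂ ∧
    (‖B.γ ξ₁‖ + ‖B.γ ξ₂‖) - 2 * B.iC h (B.iτ h ξ₁ ξ₂) * B.iM ξ₁ ξ₂ =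
      B.μ / 2 * B.iS h (B.iτ h ξ₁ ξ₂) ^ 2 := by
  obtain ⟨T, z, v, hA⟩ := G.arcs ξ₁ h₁ ξ₂ h₂
  have hseg := G.notAntipodal ξ₁ h₁ ξ₂ h₂
  obtain ⟨w₁, hw₁⟩ := exists_sq_eq (B.γ ξ₁)
  obtain ⟨-, -, -, -, hw₂, he, hM, hC, hS⟩ := hA.explicit G.pos hseg hw₁ rfl
  refine ⟨hC, hS, ?_⟩
  have h3 := (B.innerPropagator G.pos).time_equation (T := B.iτ h ξ₁ ξ₂) he
  rwa [hM, ← norm_pow, ← norm_pow, hw₁, hw₂] at h3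

lemma iV_ne_zero {ξ₁ ξ₂ : ℝ} (h₁ : ξ₁ ∈ Ioo a b) (h₂ : ξ₂ ∈ Ioo c d) : B.iV h ξ₁ ξ₂ ≠ 0 := by
  intro h0
  have h1 := G.norm_sq_iV h₁ h₂
  have h2 : 0 < B.innerPotential h (B.γ ξ₁) := by
    have := B.E_pos
    have := B.μ_pos
    have := G.pos
    unfold innerPotential
    positivity
  rw [h0, norm_zero] at h1
  linarith

/-- Of two arcs with the same initial velocity, the longer one would pass through the endpoint of
the shorter one, a boundary point, while being inside `D`. -/
lemma injOn_iV {ξ₁ : ℝ} (h₁ : ξ₁ ∈ Ioo a b) : InjOn (fun η => B.iV h ξ₁ η) (Ioo c d) := by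
  have key : ∀ η ∈ Ioo c d, ∀ η' ∈ Ioo c d, B.iV h ξ₁ η = B.iV h ξ₁ η' →
      ¬ B.iτ h ξ₁ η < B.iτ h ξ₁ η' := by
    intro η hη η' hη' hV hlt
    obtain ⟨h2, -, h3⟩ := G.path h₁ hη
    have h4 := (G.path h₁ hη').2.1 _ ⟨h2, hlt⟩
    rw [← hV, h3] at h4
    exact B.γ_notMem _ h4
  intro η hη η' hη' hV
  have hττ : B.iτ h ξ₁ η = B.iτ h ξ₁ η' :=
    le_antisymm (not_lt.1 (key η' hη' η hη hV.symm)) (not_lt.1 (key η hη η' hη' hV))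
  refine G.injOn hη hη' ?_
  have hV' : B.iV h ξ₁ η = B.iV h ξ₁ η' := hV
  rw [← (G.path h₁ hη).2.2, ← (G.path h₁ hη').2.2, hV', hττ]

/-- Inner arcs start transversally. -/
theorem inner_normal_iV_neg {ξ₁ ξ₂ : ℝ} (h₁ : ξ₁ ∈ Ioo a b) (h₂ : ξ₂ ∈ Ioo c d) :
    inner ℝ (B.normal ξ₁) (B.iV h ξ₁ ξ₂) < 0 := by
  have P := B.innerPropagator G.pos
  have hnp : ∀ η ∈ Ioo c d, inner ℝ (B.normal ξ₁) (B.iV h ξ₁ η) ≤ 0 := by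
    intro η hη
    by_contra! hc
    have hd := P.hasDerivAt_keplerPath (B.γ ξ₁, B.iV h ξ₁ η) 0
    have h0 : keplerPath (B.iC h) (B.iS h) (B.γ ξ₁, B.iV h ξ₁ η) 0 = B.γ ξ₁ := by
      simp [keplerPath, P.C_zero, P.S_zero]
    have h0' : keplerDer (B.innerκ h) (B.iC h) (B.iS h) (B.γ ξ₁, B.iV h ξ₁ η) 0 =
        ‖B.γ ξ₁‖ • B.iV h ξ₁ η := by
      simp [keplerDer, P.C_zero, P.S_zero]
    rw [h0'] at hd
    have h1 := eventually_after (B.eventually_cone_notMem (by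
      rw [inner_smul_right]
      exact mul_pos (norm_pos_iff.2 (B.γ_ne_zero _)) hc)) hd h0
    obtain ⟨h2, h3, -⟩ := G.path h₁ hη
    obtain ⟨s, hs, hs'⟩ := (h1.and (Ioo_mem_nhdsGT h2)).exists
    exact hs (subset_closure (h3 s hs'))
  rcases (hnp ξ₂ h₂).lt_or_eq with h0 | h0
  · exact h0
  exfalso
  -- As for outer arcs, a tangential velocity could be rotated to an outward one that still belongs
  -- to an inner arc; hence the normal `-n`.
  obtain ⟨F, hF, hFle, τ, w, w₀, hτ, hw, hw₀, heq⟩ := exists_filter_of_circle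
    (q := fun η => B.iV h ξ₁ η) (r := ‖B.iV h ξ₁ ξ₂‖) h₂
    (G.continuousOn_iV.comp (f := fun η => (ξ₁, η)) (by fun_prop) fun η hη => ⟨h₁, hη⟩)
    (G.injOn_iV h₁) (norm_pos_iff.2 (G.iV_ne_zero h₁ h₂)) (fun η hη => by
      have h3 := G.norm_sq_iV h₁ h₂
      have h4 := G.norm_sq_iV h₁ hη
      rw [← sq_eq_sq₀ (norm_nonneg _) (norm_nonneg _)]
      linarith) (n := -B.normal ξ₁) (by
      rw [inner_neg_left, neg_ne_zero]
      exact inner_I_mul_ne_zero (normal_ne_zero ξ₁) (G.iV_ne_zero h₁ h₂) h0)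
  have h3 : Tendsto (fun η => inner ℝ (-B.normal ξ₁) (w η)) F (𝓝 (inner ℝ (-B.normal ξ₁) w₀)) :=
    tendsto_const_nhds.inner hw
  obtain ⟨η, k1, k2, k3, k4⟩ := (heq.and ((h3.eventually (gt_mem_nhds hw₀)).and
    ((hτ.eventually self_mem_nhdsWithin).and (hFle (Ioo_mem_nhds h₂.1 h₂.2))))).exists
  have h5 := hnp η k4
  rw [k1, inner_add_right, h0, inner_smul_right, zero_add] at h5
  rw [inner_neg_left] at k2
  have : 0 < τ η * inner ℝ (B.normal ξ₁) (w η) := mul_pos k3 (by linarith)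
  linarith

/-- The derivative of the inner length in the starting point is minus the tangential component of
the initial velocity. -/
theorem hasDerivAt_innerLength {ξ₁ ξ₂ : ℝ} (h₁ : ξ₁ ∈ Ioo a b) (h₂ : ξ₂ ∈ Ioo c d) :
    HasDerivAt (fun x => B.innerLength h x ξ₂)
      (-(inner ℝ (B.iV h ξ₁ ξ₂) (B.tangent ξ₁) / √2)) ξ₁ := by
  have hγ := B.hasDerivAt_γ ξ₁
  have hp := norm_pos_iff.2 (B.γ_ne_zero ξ₁)
  have hκ := B.innerκ_pos G.pos
  have hμ := B.μ_pos
  have hM := iM_neg (G.notAntipodal ξ₁ h₁ ξ₂ h₂)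
  have hS : 0 < B.iSv h ξ₁ ξ₂ := iSv_pos G.pos
  obtain ⟨eC, eS, -⟩ := G.values h₁ h₂
  have hnorm : HasDerivAt (fun x => ‖B.γ x‖) (inner ℝ (B.γ ξ₁) (B.tangent ξ₁) / ‖B.γ ξ₁‖) ξ₁ := by
    have h1 := hγ.norm_sq.sqrt (by positivity)
    simp only [Real.sqrt_sq (norm_nonneg _)] at h1
    refine h1.congr_deriv ?_
    field_simp
  have hin : HasDerivAt (fun x => (inner ℝ (B.γ x) (B.γ ξ₂) : ℝ))
      (inner ℝ (B.tangent ξ₁) (B.γ ξ₂)) ξ₁ := by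
    simpa using hγ.inner ℝ (hasDerivAt_const ξ₁ (B.γ ξ₂))
  have hm0 := (((hnorm.mul_const ‖B.γ ξ₂‖).add hin).div_const 2).sqrt (by
    have := norm_mul_add_inner_pos (G.notAntipodal ξ₁ h₁ ξ₂ h₂)
    exact (half_pos this).ne') |>.neg
  have hm : HasDerivAt (fun x => B.iM x ξ₂)
      ((inner ℝ (B.γ ξ₁) (B.tangent ξ₁) / ‖B.γ ξ₁‖ * ‖B.γ ξ₂‖ +
        inner ℝ (B.tangent ξ₁) (B.γ ξ₂)) / (4 * B.iM ξ₁ ξ₂)) ξ₁ := by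
    refine hm0.congr_deriv ?_
    have h1 : √((((fun x => ‖B.γ x‖ * ‖B.γ ξ₂‖) + fun x => (inner ℝ (B.γ x) (B.γ ξ₂) : ℝ)) ξ₁) / 2)
        = -B.iM ξ₁ ξ₂ := by
      rw [iM, neg_neg]; rfl
    rw [h1]
    field_simp
    ring
  have hTc : ContinuousAt (fun x => B.iτ h x ξ₂) ξ₁ := by
    have := continuous_iτ (B := B) h
    exact (this.comp (by fun_prop : Continuous fun x : ℝ => (x, ξ₂))).continuousAt
  have hd := (B.innerPropagator G.pos).hasDerivAt_length hκ.ne' (half_pos hμ).ne'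
    (hnorm.add_const ‖B.γ ξ₂‖) hm hTc (by
      filter_upwards [Ioo_mem_nhds h₁.1 h₁.2] with x hx using (G.values hx h₂).2.2)
    (by rw [eS]; exact hS.ne') (by
      -- The non-degeneracy quantity is exactly the square root of the discriminant, so inner arcs
      -- are never conjugate.
      rw [eC, iCv, mul_div_cancel₀ _ (half_pos hμ).ne']
      have := Real.sqrt_pos.2 (iDisc_pos (B := B) G.pos ξ₁ ξ₂)
      linarith)
  have hd' := (hd.const_mul (4 / √2)).congr_of_eventuallyEq (f₁ := fun x => B.innerLength h x ξ₂) (by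
    filter_upwards [Ioo_mem_nhds h₁.1 h₁.2] with x hx using
      innerLength_eq (G.arcs x hx ξ₂ h₂) G.pos (G.notAntipodal x hx ξ₂ h₂))
  refine hd'.congr_deriv ?_
  rw [eC, eS, iV, real_inner_smul_left, inner_sub_left, real_inner_smul_left, inner_add_left,
    real_inner_smul_left, real_inner_smul_left, real_inner_smul_left,
    real_inner_comm (B.γ ξ₂) (B.tangent ξ₁)]
  have h2 : (0 : ℝ) < √2 := by positivity
  field_simp
  ring

end InnerPair

end RefractionBilliard

namespace RefractionBilliard

/-! ### Orbits of continuous partial bijections -/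

section Orbits

variable {X : Type*} {R : X → X → Prop}

/-- The points through which there is a full orbit. -/
def orbitSet (R : X → X → Prop) : Set X :=
  {x | ∃ o : ℤ → X, o 0 = x ∧ ∀ k, R (o k) (o (k + 1))}

lemma mem_orbitSet {o : ℤ → X} (ho : ∀ k, R (o k) (o (k + 1))) (k : ℤ) : o k ∈ orbitSet R :=
  ⟨fun n => o (k + n), by simp, fun n => by
    simpa only [← add_assoc] using ho (k + n)⟩

/-- A full orbit through a point is, after shifting, a full orbit through its neighbours, so each
point has a successor and a predecessor in the set; the two uniqueness hypotheses make the step a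
bijection. -/
lemma exists_perm (h₁ : ∀ x y y', R x y → R x y' → y' = y) (h₂ : ∀ x x' y, R x y → R x' y → x' = x) :
    ∃ F : Equiv.Perm (orbitSet R), ∀ (x : orbitSet R) (y : X), R x y ↔ y = F x := by
  have hf : ∀ x : orbitSet R, ∃ y : orbitSet R, R x y := by
    rintro ⟨x, o, rfl, ho⟩
    exact ⟨⟨o 1, mem_orbitSet ho 1⟩, by simpa using ho 0⟩
  choose f hf using hf
  have hbij : Function.Bijective f := by
    constructor
    · intro x x' hxx'
      have h3 := hf x'
      rw [← hxx'] at h3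
      exact (Subtype.ext (h₂ _ _ _ (hf x) h3)).symm
    · rintro ⟨y, o, rfl, ho⟩
      refine ⟨⟨o (-1), mem_orbitSet ho (-1)⟩, Subtype.ext ?_⟩
      have h3 : R (o (-1)) (o 0) := by simpa using ho (-1)
      exact h₁ _ _ _ h3 (hf ⟨o (-1), mem_orbitSet ho (-1)⟩)
  refine ⟨Equiv.ofBijective f hbij, fun x y => ⟨fun hxy => ?_, fun hy => ?_⟩⟩
  · exact h₁ _ _ _ (hf x) hxy
  · rw [hy]; exact hf x

variable {F : Equiv.Perm (orbitSet R)} (hF : ∀ (x : orbitSet R) (y : X), R x y ↔ y = F x)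

include hF

lemma perm_zpow_eq {o : ℤ → X} (ho : ∀ k, R (o k) (o (k + 1))) (k : ℤ) :
    (F ^ k) ⟨o 0, mem_orbitSet ho 0⟩ = ⟨o k, mem_orbitSet ho k⟩ := by
  have hstep : ∀ k, F ⟨o k, mem_orbitSet ho k⟩ = ⟨o (k + 1), mem_orbitSet ho (k + 1)⟩ :=
    fun k => Subtype.ext ((hF _ _).1 (ho k)).symm
  induction k using Int.induction_on with
  | zero => rfl
  | succ n ih => rw [add_comm, zpow_add, zpow_one, Equiv.Perm.mul_apply, ih, hstep]; simp [add_comm]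
  | pred n ih =>
    rw [sub_eq_add_neg, add_comm, zpow_add, zpow_neg_one, Equiv.Perm.mul_apply, ih,
      Equiv.Perm.inv_eq_iff_eq, hstep]
    simp

lemma rel_zpow (x : orbitSet R) (k : ℤ) : R ((F ^ k) x) ((F ^ (k + 1)) x) := by
  rw [hF, add_comm, zpow_add, zpow_one, Equiv.Perm.mul_apply]

lemma continuous_zpow [TopologicalSpace X] (h₁ : ContRel R) (h₂ : ContRel fun y x => R x y)
    (k : ℤ) : Continuous fun x : orbitSet R => (F ^ k) x := by
  have hc : Continuous F := by
    rw [continuous_iff_continuousAt]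
    intro x
    rw [ContinuousAt, tendsto_subtype_rng]
    intro V hV
    have h3 := h₁ x (F x) ((hF _ _).2 rfl) V hV
    exact (continuous_subtype_val.tendsto x).eventually h3 |>.mono fun x' hx' =>
      hx' _ ((hF _ _).2 rfl)
  have hc' : Continuous (F⁻¹ : Equiv.Perm (orbitSet R)) := by
    have hr : ∀ y : orbitSet R, R ((F⁻¹ : Equiv.Perm (orbitSet R)) y) y := fun y =>
      (hF _ _).2 (by simp)
    rw [continuous_iff_continuousAt]
    intro y
    rw [ContinuousAt, tendsto_subtype_rng]
    intro V hV
    have h3 := h₂ y _ (hr y) V hV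
    exact (continuous_subtype_val.tendsto y).eventually h3 |>.mono fun y' hy' => hy' _ (hr y')
  induction k using Int.induction_on with
  | zero => exact continuous_id
  | succ n ih =>
    have : (fun x => (F ^ ((n : ℤ) + 1)) x) = fun x => F ((F ^ (n : ℤ)) x) := by
      funext x
      rw [add_comm, zpow_add, zpow_one, Equiv.Perm.mul_apply]
    rw [this]
    exact hc.comp ih
  | pred n ih =>
    have : (fun x => (F ^ (-(n : ℤ) - 1)) x) =
        fun x => (F⁻¹ : Equiv.Perm (orbitSet R)) ((F ^ (-(n : ℤ))) x) := by
      funext x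
      rw [sub_eq_add_neg, add_comm, zpow_add, zpow_neg_one, Equiv.Perm.mul_apply]
    rw [this]
    exact hc'.comp ih

end Orbits

/-! ### Admissible domains -/

variable {B : RefractionBilliard}

lemma NotAntipodal.symm {m : ℕ} {a b : Fin m → ℝ} {i j : Fin m} (h : B.NotAntipodal a b i j) :
    B.NotAntipodal a b j i := fun ξ₁ h₁ ξ₂ h₂ => by
  rw [segment_symm]; exact h ξ₂ h₂ ξ₁ h₁

lemma InnerArcProperty.subset_Ioo {m : ℕ} {a b : Fin m → ℝ} {h₀ : ℝ}
    (hI : B.InnerArcProperty a b h₀) (i : Fin m) : Ioo (a i) (b i) ⊆ Ioo 0 B.L := by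
  have := interior_maximal (hI.subset i) isOpen_Ioo
  rwa [interior_Icc] at this

lemma InnerArcProperty.goodInterval {m : ℕ} {a b : Fin m → ℝ} {h₀ : ℝ}
    (hI : B.InnerArcProperty a b h₀) (hO : ∀ i, B.OuterArcProperty (a i) (b i)) (i : Fin m) :
    B.GoodInterval (a i) (b i) where
  injOn := B.γ_injOn_Ioo.mono (hI.subset_Ioo i)
  notAntipodal := (hI.notAntipodal i).1
  arcs := hO i

lemma InnerArcProperty.innerPair {m : ℕ} {a b : Fin m → ℝ} {h₀ h : ℝ}
    (hI : B.InnerArcProperty a b h₀) (hh : h₀ < h) {i j : Fin m} (hij : B.NotAntipodal a b i j) :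
    B.InnerPair h (a i) (b i) (a j) (b j) where
  pos := hI.pos.trans hh
  injOn := B.γ_injOn_Ioo.mono (hI.subset_Ioo j)
  notAntipodal := hij
  arcs ξ₁ h₁ ξ₂ h₂ := by
    obtain ⟨T, z, v, hA, -⟩ := hI.existsUnique i j hij ξ₁ h₁ ξ₂ h₂ h hh
    exact ⟨T, z, v, hA⟩

lemma ChangeSignProperty.Icc_subset {m : ℕ} {a b α β : Fin m → ℝ} {h₁ : ℝ}
    (hC : B.ChangeSignProperty a b α β h₁) (i : Fin m) : Icc (α i) (β i) ⊆ Ioo (a i) (b i) :=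
  fun _ hξ => ⟨(hC.left_lt i).trans_le hξ.1, hξ.2.trans_lt (hC.lt_right i)⟩

/-- The derivative of the total length in terms of the velocities at the common endpoint. -/
lemma lengthDeriv_eq {h a b c d : ℝ} (G : B.GoodInterval a b) (G' : B.InnerPair h a b c d)
    {ξE ξ ξI : ℝ} (hE : ξE ∈ Ioo a b) (hξ : ξ ∈ Ioo a b) (hI : ξI ∈ Ioo c d) :
    B.lengthDeriv h ξE ξ ξI = (-inner ℝ (B.oq ξ ξE) (B.tangent ξ) -
      inner ℝ (B.iV h ξ ξI) (B.tangent ξ)) / √2 := by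
  rw [lengthDeriv, (G.hasDerivAt_outerLength hE hξ).deriv, (G'.hasDerivAt_innerLength hξ hI).deriv,
    (G.symm hE hξ).2, inner_neg_left]
  ring

end RefractionBilliard

/-! ### Realization of admissible words. -/

namespace RefractionBilliard

variable {B : RefractionBilliard}

/-- Consecutive outer and inner arcs with matching tangential components form an orbit of the first
return map. -/
lemma returns_of_tangential {m : ℕ} {a b α β : Fin m → ℝ} {h : ℝ} {i j : Fin m}
    (hij : B.NotAntipodal a b i j) (Gi : B.GoodInterval (a i) (b i))
    (Gj : B.GoodInterval (a j) (b j)) (G : B.InnerPair h (a i) (b i) (a j) (b j))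
    (G' : B.InnerPair h (a j) (b j) (a i) (b i))
    (hi : Icc (α i) (β i) ⊆ Ioo (a i) (b i)) (hj : Icc (α j) (β j) ⊆ Ioo (a j) (b j))
    {x₀ x₁ x₂ x₃ : ℝ} (h₀ : x₀ ∈ Icc (α i) (β i)) (h₁ : x₁ ∈ Icc (α i) (β i))
    (h₂ : x₂ ∈ Icc (α j) (β j)) (h₃ : x₃ ∈ Icc (α j) (β j))
    (e₁ : -inner ℝ (B.oq x₁ x₀) (B.tangent x₁) - inner ℝ (B.iV h x₁ x₂) (B.tangent x₁) = (0 : ℝ))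
    (e₂ : -inner ℝ (B.iV h x₂ x₁) (B.tangent x₂) - inner ℝ (B.oq x₂ x₃) (B.tangent x₂) = (0 : ℝ)) :
    B.Returns a b α β h (x₀, B.oq x₀ x₁) (x₂, B.oq x₂ x₃) := by
  have k₀ := hi h₀
  have k₁ := hi h₁
  have k₂ := hj h₂
  have k₃ := hj h₃
  have P := B.outerPropagator
  have hshell : ∀ {r : Fin m}, B.GoodInterval (a r) (b r) → ∀ {ξ η : ℝ}, ξ ∈ Ioo (a r) (b r) →
      η ∈ Ioo (a r) (b r) → ‖B.oq ξ η‖ ^ 2 / 2 - B.outerPotential (B.γ ξ) = 0 :=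
    fun Gr ξ η hξ hη => by
      have := Gr.norm_sq_oq hξ hη
      rw [this, outerPotential]; ring
  obtain ⟨T, z, v, hA⟩ := G.arcs x₁ k₁ x₂ k₂
  obtain ⟨hv0, hvT⟩ := hA.velocity G.pos (G.notAntipodal x₁ k₁ x₂ k₂)
  set u := B.ovel (B.γ x₀) (B.oq x₀ x₁) (B.oT x₀ x₁) with hu
  have hsymm : B.oq x₁ x₀ = -u := (Gi.symm k₀ k₁).2
  have hus : ‖u‖ ^ 2 / 2 - B.outerPotential (B.γ x₁) = 0 := by
    have := hshell Gi k₁ k₀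
    rwa [hsymm, norm_neg] at this
  have hun : inner ℝ (B.normal x₁) u < 0 := Gi.inner_normal_ovel_neg k₀ k₁
  refine ⟨i, j, hij, ⟨h₀, hshell Gi k₀ k₁, Gi.inner_normal_oq_pos k₀ k₁⟩,
    ⟨h₂, hshell Gj k₂ k₃, Gj.inner_normal_oq_pos k₂ k₃⟩, x₁, B.oT x₀ x₁,
    B.oflow (B.γ x₀) (B.oq x₀ x₁), B.ovel (B.γ x₀) (B.oq x₀ x₁), T, z, v,
    Gi.oT_pos k₀ k₁, (Gi.spec k₀ k₁).isOuterArc.solution, P.flow_zero _ _, P.flowVel_zero _ _,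
    fun s hs => Gi.notMem_closure k₀ k₁ hs, (Gi.spec k₀ k₁).end_eq, ⟨h₁, hus, hun⟩,
    hA.pos, hA.solution, hA.start_eq, ?_, hA.inside, hA.end_eq, ?_⟩
  -- Both velocities lie on the inner energy shell with inward sign, so they agree as soon as their
  -- tangential components do.
  · rw [hv0, B.refract_eq (σ := -1) (Or.inr rfl) (by linarith),
      B.eq_of_tangential (σ := -1) (Or.inr rfl) (G.norm_sq_iV k₁ k₂)
        (by linarith [G.inner_normal_iV_neg k₁ k₂])]
    rw [hsymm, inner_neg_left, neg_neg] at e₁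
    have e₁' : inner ℝ (B.iV h x₁ x₂) (B.tangent x₁) = inner ℝ u (B.tangent x₁) := by linarith
    rw [e₁']
  · have hn := G'.inner_normal_iV_neg k₂ k₁
    have hq := Gj.inner_normal_oq_pos k₂ k₃
    rw [hvT, B.refract_eq (σ := 1) (Or.inl rfl) (by simpa using hq),
      B.eq_of_tangential (v := -B.iV h x₂ x₁) (σ := 1) (Or.inl rfl)
        (by rw [norm_neg]; exact G'.norm_sq_iV k₂ k₁) (by rw [inner_neg_right]; linarith)]
    have e₂' : inner ℝ (-B.iV h x₂ x₁) (B.tangent x₂) = inner ℝ (B.oq x₂ x₃) (B.tangent x₂) := by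
      rw [inner_neg_left]; linarith
    rw [e₂']

/-- The initial velocity along the `n`-th edge of a chain of alternating outer and inner arcs. -/
def edgeVel (B : RefractionBilliard) (h : ℝ) (n : ℤ) : ℝ → ℝ → ℂ :=
  if Even n then B.oq else B.iV h

/-- Every admissible word is realized by an orbit of the first return relation. -/
theorem exists_orbit {m : ℕ} {a b α β : Fin m → ℝ} {h₀ h₁ h : ℝ}
    (hI : B.InnerArcProperty a b h₀) (hO : ∀ i, B.OuterArcProperty (a i) (b i))
    (hC : B.ChangeSignProperty a b α β h₁) (hh₀ : h₀ < h) (hh₁ : h₁ < h) (ℓ : B.Word a b) :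
    ∃ o : ℤ → ℝ × ℂ, (∀ k, B.Returns a b α β h (o k) (o (k + 1))) ∧
      ∀ k, (o k).1 ∈ Icc (α (ℓ.1 k)) (β (ℓ.1 k)) := by
  have hG := fun i => hI.goodInterval hO i
  have hP := fun {i j : Fin m} (hij : B.NotAntipodal a b i j) => hI.innerPair hh₀ hij
  have hsub := hC.Icc_subset
  -- If the two ends coincided, the change-sign product would be a square.
  have hlt : ∀ i, α i < β i := by
    intro i
    refine lt_of_le_of_ne (hC.le i) fun he => ?_
    have h2 := hC.mul_neg h hh₁ i i (hI.notAntipodal i).1 (α i) ⟨le_rfl, hC.le i⟩ (α i)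
      ⟨le_rfl, hC.le i⟩
    rw [← he] at h2
    nlinarith
  -- Vertices `2 k` and `2 k + 1` are the ends of the `k`-th outer arc, both in the interval `ℓ k`;
  -- inner arcs join `2 k + 1` to `2 k + 2`.
  set r : ℤ → Fin m := fun n => ℓ.1 (n / 2) with hr
  -- consecutive indices
  have heven : ∀ n : ℤ, Even n → r (n + 1) = r n := by
    rintro n ⟨k, rfl⟩
    have e1 : (k + k + 1) / 2 = (k + k) / 2 := by omega
    simp only [hr, e1]
  have hodd : ∀ n : ℤ, ¬ Even n → B.NotAntipodal a b (r n) (r (n + 1)) := by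
    intro n hn
    obtain ⟨k, rfl⟩ := Int.not_even_iff_odd.1 hn
    have e1 : (2 * k + 1) / 2 = k := by omega
    have e2 : (2 * k + 1 + 1) / 2 = k + 1 := by omega
    simp only [hr, e1, e2]
    exact ℓ.2 k
  have hcont : ∀ n, ContinuousOn (fun x : ℝ × ℝ => B.edgeVel h n x.1 x.2)
      (Icc (α (r n)) (β (r n)) ×ˢ Icc (α (r (n + 1))) (β (r (n + 1)))) := by
    intro n
    by_cases hn : Even n
    · rw [edgeVel, if_pos hn, heven n hn]
      exact (hG (r n)).continuousOn_oq.mono (prod_mono (hsub _) (hsub _))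
    · rw [edgeVel, if_neg hn]
      exact (hP (hodd n hn)).continuousOn_iV.mono (prod_mono (hsub _) (hsub _))
  have hcont' : ∀ n, ContinuousOn (fun x : ℝ × ℝ => B.edgeVel h n x.2 x.1)
      (Icc (α (r n)) (β (r n)) ×ˢ Icc (α (r (n + 1))) (β (r (n + 1)))) := by
    intro n
    have hsw : ContinuousOn (fun x : ℝ × ℝ => (x.2, x.1))
      (Icc (α (r n)) (β (r n)) ×ˢ Icc (α (r (n + 1))) (β (r (n + 1)))) := by fun_prop
    by_cases hn : Even n
    · simp only [edgeVel, if_pos hn]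
      refine ContinuousOn.comp (g := fun x : ℝ × ℝ => B.oq x.1 x.2)
        (f := fun x : ℝ × ℝ => (x.2, x.1)) (hG (r n)).continuousOn_oq hsw fun x hx => ?_
      rw [heven n hn] at hx
      exact ⟨hsub _ hx.2, hsub _ hx.1⟩
    · simp only [edgeVel, if_neg hn]
      exact ContinuousOn.comp (g := fun x : ℝ × ℝ => B.iV h x.1 x.2)
        (f := fun x : ℝ × ℝ => (x.2, x.1)) (hP (hodd n hn).symm).continuousOn_iV hsw
        fun x hx => ⟨hsub _ hx.2, hsub _ hx.1⟩
  have ht := B.continuous_tangent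
  have hfc : ∀ n, ContinuousOn
      (fun x : ℝ × ℝ => -(inner ℝ (B.edgeVel h n x.2 x.1) (B.tangent x.2) : ℝ))
      (Icc (α (r n)) (β (r n)) ×ˢ Icc (α (r (n + 1))) (β (r (n + 1)))) := fun n =>
    ((hcont' n).inner (𝕜 := ℝ) (ht.comp continuous_snd).continuousOn).neg
  have hgc : ∀ n, ContinuousOn
      (fun x : ℝ × ℝ => -(inner ℝ (B.edgeVel h n x.1 x.2) (B.tangent x.1) : ℝ))
      (Icc (α (r n)) (β (r n)) ×ˢ Icc (α (r (n + 1))) (β (r (n + 1)))) := fun n =>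
    ((hcont n).inner (𝕜 := ℝ) (ht.comp continuous_fst).continuousOn).neg
  -- The twist condition: transversality fixes the normal sign, so the tangential component
  -- determines the velocity on the shell, and the velocity determines the arc.
  have hinj : ∀ n, ∀ x ∈ Icc (α (r n)) (β (r n)),
      InjOn (fun y => -(inner ℝ (B.edgeVel h n x y) (B.tangent x) : ℝ))
        (Icc (α (r (n + 1))) (β (r (n + 1)))) := by
    intro n x hx y hy y' hy' hyy'
    have hyy := neg_inj.1 hyy'
    by_cases hn : Even n
    · simp only [edgeVel, if_pos hn] at hyy
      rw [heven n hn] at hy hy'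
      have k := hsub _ hx
      have k1 := hsub _ hy
      have k2 := hsub _ hy'
      refine (hG _).injOn_oq k k1 k2 ?_
      have e1 := B.eq_of_tangential (V := B.outerPotential (B.γ x)) (σ := 1) (Or.inl rfl)
        (by rw [(hG _).norm_sq_oq k k1, outerPotential]; ring)
        (by linarith [(hG _).inner_normal_oq_pos k k1])
      have e2 := B.eq_of_tangential (V := B.outerPotential (B.γ x)) (σ := 1) (Or.inl rfl)
        (by rw [(hG _).norm_sq_oq k k2, outerPotential]; ring)
        (by linarith [(hG _).inner_normal_oq_pos k k2])
      rw [e1, e2, hyy]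
    · simp only [edgeVel, if_neg hn] at hyy
      have k := hsub _ hx
      have k1 := hsub _ hy
      have k2 := hsub _ hy'
      have G := hP (hodd n hn)
      refine G.injOn_iV k k1 k2 ?_
      have e1 := B.eq_of_tangential (σ := -1) (Or.inr rfl) (G.norm_sq_iV k k1)
        (by linarith [G.inner_normal_iV_neg k k1])
      have e2 := B.eq_of_tangential (σ := -1) (Or.inr rfl) (G.norm_sq_iV k k2)
        (by linarith [G.inner_normal_iV_neg k k2])
      simp only
      rw [e1, e2, hyy]
  have hsign : ∀ n, ∀ x ∈ Icc (α (r n)) (β (r n)),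
      ∀ y ∈ Icc (α (r (n + 2))) (β (r (n + 2))),
      (-(inner ℝ (B.edgeVel h n (α (r (n + 1))) x) (B.tangent (α (r (n + 1)))) : ℝ) +
        -(inner ℝ (B.edgeVel h (n + 1) (α (r (n + 1))) y) (B.tangent (α (r (n + 1)))) : ℝ)) *
      (-(inner ℝ (B.edgeVel h n (β (r (n + 1))) x) (B.tangent (β (r (n + 1)))) : ℝ) +
        -(inner ℝ (B.edgeVel h (n + 1) (β (r (n + 1))) y) (B.tangent (β (r (n + 1)))) : ℝ)) < 0 := by
    intro n x hx y hy
    have hr2 : (0 : ℝ) < √2 := by positivity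
    have key : ∀ i j, B.NotAntipodal a b i j → ∀ ξE ∈ Icc (α i) (β i), ∀ ξI ∈ Icc (α j) (β j),
        (-inner ℝ (B.oq (α i) ξE) (B.tangent (α i)) -
          inner ℝ (B.iV h (α i) ξI) (B.tangent (α i))) *
        (-inner ℝ (B.oq (β i) ξE) (B.tangent (β i)) -
          inner ℝ (B.iV h (β i) ξI) (B.tangent (β i))) < (0 : ℝ) := by
      intro i j hij ξE hE ξI hξI
      have h2 := hC.mul_neg h hh₁ i j hij ξE hE ξI hξI
      rw [lengthDeriv_eq (hG i) (hP hij) (hsub i hE) (hsub i ⟨le_rfl, hC.le i⟩) (hsub j hξI),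
        lengthDeriv_eq (hG i) (hP hij) (hsub i hE) (hsub i ⟨hC.le i, le_rfl⟩) (hsub j hξI),
        div_mul_div_comm, div_neg_iff] at h2
      rcases h2 with h2 | h2
      · exact absurd h2.2 (by have := mul_pos hr2 hr2; linarith)
      · exact h2.1
    -- At the end of an outer edge this is the change-sign property itself. At the end of an inner
    -- edge the two arcs exchange roles; as both velocities are taken leaving the vertex, the same
    -- inequality applies.
    by_cases hn : Even n
    · have hn' : ¬ Even (n + 1) := by rw [Int.even_add_one, not_not]; exact hn
      have hNA := hodd (n + 1) hn'
      simp only [edgeVel, if_pos hn, if_neg hn']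
      rw [heven n hn] at hNA ⊢
      rw [add_assoc] at hNA
      have h2 := key _ _ hNA x hx y hy
      simp only [← sub_eq_add_neg]
      exact h2
    · have hn' : Even (n + 1) := Int.even_add_one.2 hn
      have hNA := (hodd n hn).symm
      simp only [edgeVel, if_neg hn, if_pos hn']
      have hy' : y ∈ Icc (α (r (n + 1))) (β (r (n + 1))) := by
        rw [← heven _ hn']; rwa [add_assoc]
      have h2 := key _ _ hNA y hy' x hx
      simp only [← sub_eq_add_neg]
      linarith [h2]
  -- The incoming term `f` uses the reversed edge, issuing from the common vertex. Snell's law thus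
  -- says that the tangential components of two outgoing velocities add up to zero.
  obtain ⟨x, hx, he⟩ := exists_chain (α := fun n => α (r n)) (β := fun n => β (r n))
    (f := fun n x y => -(inner ℝ (B.edgeVel h n y x) (B.tangent y) : ℝ))
    (g := fun n x y => -(inner ℝ (B.edgeVel h n x y) (B.tangent x) : ℝ)) (fun n => hlt _)
    hfc hgc hinj hsign
  refine ⟨fun k => (x (2 * k), B.oq (x (2 * k)) (x (2 * k + 1))), fun k => ?_, fun k => ?_⟩
  · have r0 : r (2 * k) = ℓ.1 k := by
      have e : (2 * k) / 2 = k := by omega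
      simp only [hr, e]
    have r1 : r (2 * k + 1) = ℓ.1 k := by
      have e : (2 * k + 1) / 2 = k := by omega
      simp only [hr, e]
    have r2 : r (2 * k + 2) = ℓ.1 (k + 1) := by
      have e : (2 * k + 2) / 2 = k + 1 := by omega
      simp only [hr, e]
    have r3 : r (2 * k + 3) = ℓ.1 (k + 1) := by
      have e : (2 * k + 3) / 2 = k + 1 := by omega
      simp only [hr, e]
    have e1 := he (2 * k)
    have e2 := he (2 * k + 1)
    have p1 : Even (2 * k) := even_two_mul k
    have p2 : ¬ Even (2 * k + 1) := by rw [Int.even_add_one, not_not]; exact p1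
    have p3 : Even (2 * k + 1 + 1) := Int.even_add_one.2 p2
    simp only [edgeVel, if_pos p1, if_neg p2, if_pos p3] at e1 e2
    have h22 : 2 * (k + 1) = 2 * k + 2 := by ring
    have h23 : 2 * (k + 1) + 1 = 2 * k + 3 := by ring
    rw [show 2 * k + 1 + 1 = 2 * k + 2 by ring, show 2 * k + 1 + 2 = 2 * k + 3 by ring] at e2
    have hNA := ℓ.2 k
    simp only [h22, show (2 * k + 2 + 1 : ℤ) = 2 * k + 3 by ring]
    refine returns_of_tangential hNA (hG _) (hG _) (hP hNA) (hP hNA.symm) (hsub _) (hsub _)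
      (r0 ▸ hx (2 * k)) (r1 ▸ hx (2 * k + 1)) (r2 ▸ hx (2 * k + 2)) (r3 ▸ hx (2 * k + 3)) ?_ ?_
    · linarith [e1]
    · linarith [e2]
  · have r0 : r (2 * k) = ℓ.1 k := by
      have e : (2 * k) / 2 = k := by omega
      simp only [hr, e]
    exact r0 ▸ hx (2 * k)

end RefractionBilliard

/-! ### The semiconjugacy with the shift. -/

open RefractionBilliard in
theorem theorem1p6 (B : RefractionBilliard) {m : ℕ} (a b α β : Fin m → ℝ)
    (hadm : B.IsAdmissible a b α β) :
    ∃ hbar : ℝ, ∀ h : ℝ, hbar < h →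
      ∃ (F : Equiv.Perm (B.returnSet a b α β h)) (π : B.returnSet a b α β h → B.Word a b),
        (∀ (x : B.returnSet a b α β h) (y : ℝ × ℂ),
          B.Returns a b α β h x y ↔ y = (F x : ℝ × ℂ)) ∧
        (∀ (x : B.returnSet a b α β h) (k : ℤ),
          ((F ^ k) x : ℝ × ℂ).1 ∈ Set.Icc (α ((π x).1 k)) (β ((π x).1 k))) ∧
        Continuous π ∧ Function.Surjective π ∧
        ∀ x, π (F x) = B.shift (π x) := by
  obtain ⟨h₀, h₁, h01, hI, hO, hC⟩ := hadm
  -- Above `h₁` the change-sign property holds, and `h₀ ≤ h₁` supplies the inner arcs.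
  refine ⟨h₁, fun h hh => ?_⟩
  have hh₀ : h₀ < h := h01.trans_lt hh
  have hpos : 0 < h := hI.pos.trans hh₀
  have hsub := hC.Icc_subset
  set K : Set ℝ := ⋃ i, Icc (α i) (β i) with hK
  have hKc : IsCompact K := isCompact_iUnion fun i => isCompact_Icc
  have hinj : InjOn B.γ K := B.γ_injOn_Ioo.mono
    (iUnion_subset fun i => (hsub i).trans (hI.subset_Ioo i))
  have hchain : ∀ x y, B.Returns a b α β h x y → B.ReturnChain h K x y := fun x y hxy =>
    hxy.chain hpos fun i => subset_iUnion (fun i => Icc (α i) (β i)) i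
  have hR : ContRel (B.Returns a b α β h) := (contRel_returnChain hpos hKc hinj).mono hchain
  have hR' : ContRel fun y x => B.Returns a b α β h x y :=
    (contRel_returnChain_flip hpos hKc hinj).mono fun y x => hchain x y
  obtain ⟨F, hF⟩ : ∃ F : Equiv.Perm (B.returnSet a b α β h), ∀ (x : B.returnSet a b α β h)
      (y : ℝ × ℂ), B.Returns a b α β h x y ↔ y = (F x : ℝ × ℂ) :=
    exists_perm (R := B.Returns a b α β h) (fun x y y' h h' => hR.unique h h')
      (fun x x' y h h' => hR'.unique h h')
  have hdisj : ∀ {i j : Fin m} {ξ : ℝ}, ξ ∈ Ioo (a i) (b i) → ξ ∈ Ioo (a j) (b j) → i = j := by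
    intro i j ξ hi hj
    by_contra hne
    exact disjoint_left.1 (hI.disjoint hne) hi hj
  have hrel : ∀ (x : B.returnSet a b α β h) (k : ℤ), ∃ i j, B.NotAntipodal a b i j ∧
      ((F ^ k) x : ℝ × ℂ).1 ∈ Icc (α i) (β i) ∧
      ((F ^ (k + 1)) x : ℝ × ℂ).1 ∈ Icc (α j) (β j) := by
    intro x k
    obtain ⟨i, j, hij, hx, hy, -⟩ := rel_zpow hF x k
    exact ⟨i, j, hij, hx.1, hy.1⟩
  have hidx : ∀ (x : B.returnSet a b α β h) (k : ℤ), ∃ i,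
      ((F ^ k) x : ℝ × ℂ).1 ∈ Icc (α i) (β i) := fun x k => by
    obtain ⟨i, j, -, hi, -⟩ := hrel x k
    exact ⟨i, hi⟩
  choose idx hidx using hidx
  have hidx_eq : ∀ {x : B.returnSet a b α β h} {k : ℤ} {i : Fin m},
      ((F ^ k) x : ℝ × ℂ).1 ∈ Ioo (a i) (b i) → idx x k = i := fun hi =>
    hdisj (hsub _ (hidx _ _)) hi
  refine ⟨F, fun x => ⟨idx x, fun k => ?_⟩, hF, hidx, ?_, ?_, ?_⟩
  · obtain ⟨i, j, hij, hi, hj⟩ := hrel x k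
    rwa [hidx_eq (hsub _ hi), hidx_eq (hsub _ hj)]
  -- The open intervals `(a i, b i)` are disjoint and contain the compact ones. By continuity of the
  -- `k`-th iterate, the `k`-th symbol is therefore locally constant.
  · refine Continuous.subtype_mk (continuous_pi fun k => ?_) _
    rw [continuous_iff_continuousAt]
    intro x
    have hc := continuous_fst.comp (continuous_subtype_val.comp (continuous_zpow hF hR hR' k))
    have h2 := hc.continuousAt.eventually (isOpen_Ioo.mem_nhds (hsub _ (hidx x k)))
    exact (continuousAt_const (y := idx x k)).congr (h2.mono fun x' hx' => (hidx_eq hx').symm)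
  · intro ℓ
    obtain ⟨o, ho, hoℓ⟩ := exists_orbit hI hO hC hh₀ hh ℓ
    obtain ⟨x, hx⟩ : ∃ x : B.returnSet a b α β h, ∀ k : ℤ, ((F ^ k) x : ℝ × ℂ) = o k :=
      ⟨⟨o 0, mem_orbitSet ho 0⟩, fun k => congrArg Subtype.val (perm_zpow_eq hF ho k)⟩
    refine ⟨x, Subtype.ext (funext fun k => ?_)⟩
    refine hidx_eq (hsub _ ?_)
    rw [hx]
    exact hoℓ k
  · intro x
    refine Subtype.ext (funext fun k => ?_)
    refine hidx_eq (hsub _ ?_)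
    have h2 := hidx x (k + 1)
    rw [zpow_add, zpow_one, Equiv.Perm.mul_apply] at h2
    exact h2

end
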